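/- Let $n\ge 3$ and let $\Omega\subset\mathbb{R}^n$ be a bounded open set with $C^2$ boundary and unit outer normal $\nu$. Let $\widetilde\Omega\subset\mathbb{R}^n$ be open with $\overline\Omega\subset\widetilde\Omega$, and let $\varphi\in C^\infty(\widetilde\Omega,\mathbb{R})$ be a limiting Carleman weight for the semiclassical Laplacian $-h^2\Delta$ in $\widetilde\Omega$, i.e. $\nabla\varphi\neq 0$ in $\widetilde\Omega$ and, with $$p_\varphi(x,\xi)=|\xi|^2+2i\,\nabla\varphi(x)\cdot\xi-|\nabla\varphi(x)|^2,$$ the Poisson bracket $\{\operatorname{Re}p_\varphi,\operatorname{Im}p_\varphi\}(x,\xi)$ vanishes whenever $(x,\xi)\in\widetilde\Omega\times\mathbb{R}^n$ and $p_\varphi(x,\xi)=0$. For $h,\varepsilon>0$ set $\widetilde\varphi=\varphi+\frac{h}{2\varepsilon}\varphi^2$, and let $\partial\Omega_\pm=\{x\in\partial\Omega:\ \pm\partial_\nu\varphi(x)\ge 0\}$. Then there exist constants $C>0$, $\varepsilon_0>0$ and $c_0>0$, depending only on $n$, $\Omega$, $\widetilde\Omega$ and $\varphi$, such that for all $0<\varepsilon\le\varepsilon_0$,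 all $0<h\le c_0\varepsilon$ and all complex-valued $v\in H^2(\Omega)$, $$ \begin{aligned} &\frac{h^2}{\varepsilon}\|v\|_{H^1_{\mathrm{scl}}(\Omega)}^2-h^3\int_{\partial\Omega_-}(\partial_\nu\widetilde\varphi)|\partial_\nu v|^2\,dS\\ &\quad\le C h\|v\|_{L^2(\partial\Omega)}^2+C h^3\int_{\partial\Omega}|\partial_\nu v||v|\,dS+C h^3\int_{\partial\Omega_+}(\partial_\nu\widetilde\varphi)|\partial_\nu v|^2\,dS\\ &\qquad+C h^3\|\nabla_t v\|_{L^2(\partial\Omega)}^2+C h^3\int_{\partial\Omega}|\nabla_t v||\partial_\nu v|\,dS +C\left\|e^{\widetilde\varphi/h}(-h^2\Delta)\bigl(e^{-\widetilde\varphi/h}v\bigr)\right\|_{L^2(\Omega)}^2 . \end{aligned} $$ Here $\|v\|^2_{H^1_{\mathrm{scl}}(\Omega)}=\|v\|_{L^2(\Omega)}^2+\|h\nabla v\|_{L^2(\Omega)}^2$; $H^2(\Omega)$ is the space of restrictions to $\Omega$ of functions in $H^2(\mathbb{R}^n)$, and no boundary condition is imposed on $v$; $dS$ is surface measure on $\partial\Omega$;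 $v$ and $\nabla v$ on $\partial\Omega$ are understood in the sense of traces, with $\partial_\nu v=\nu\cdot\nabla v$ and $\nabla_t v=\nabla v-(\partial_\nu v)\nu$. -/

import Mathlib

open MeasureTheory Filter Topology
open scoped ContDiff InnerProductSpace SchwartzMap

noncomputable section

/-- Euclidean space `ℝⁿ`. -/
abbrev Rn (n : ℕ) : Type := EuclideanSpace ℝ (Fin n)

/-- The standard basis vector `e_j` of `ℝⁿ`. -/
def stdVec {n : ℕ} (j : Fin n) : Rn n := EuclideanSpace.single j (1 : ℝ)

/-! ### Domains, outer normal, surface measure -/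

/-- `Ω` has `C²` boundary: near each boundary point, after a rotation taking the last axis to the
direction `e`, the set `Ω` is the region strictly below the graph of a `C²` function `ψ` of the
remaining coordinates `x - ⟪x, e⟫ e`. -/
def HasC2Boundary {n : ℕ} (Ω : Set (Rn n)) : Prop :=
  ∀ x₀ ∈ frontier Ω, ∃ (e : Rn n) (r : ℝ) (ψ : Rn n → ℝ),
    ‖e‖ = 1 ∧ 0 < r ∧ ContDiff ℝ 2 ψ ∧
    ∀ x ∈ Metric.ball x₀ r, (x ∈ Ω ↔ ⟪x, e⟫_ℝ < ψ (x - ⟪x, e⟫_ℝ • e))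

/-- `N` is the unit outer normal to `∂Ω` at `x`: directions making an obtuse angle with `N` point
into `Ω`, and directions making an acute angle with `N` point out of `Ω`. -/
def IsOuterUnitNormal {n : ℕ} (Ω : Set (Rn n)) (x N : Rn n) : Prop :=
  ‖N‖ = 1 ∧ ∀ w : Rn n,
    (⟪w, N⟫_ℝ < 0 → ∀ᶠ t in 𝓝[>] (0 : ℝ), x + t • w ∈ Ω) ∧
    (0 < ⟪w, N⟫_ℝ → ∀ᶠ t in 𝓝[>] (0 : ℝ), x + t • w ∉ Ω)

/-- There is at most one unit outer normal at each point. -/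
theorem IsOuterUnitNormal.unique {n : ℕ} {Ω : Set (Rn n)} {x N N' : Rn n}
    (h : IsOuterUnitNormal Ω x N) (h' : IsOuterUnitNormal Ω x N') : N = N' := by
  by_contra hne
  have hlt : ⟪N, N'⟫_ℝ < 1 :=
    (inner_lt_one_iff_real_of_norm_eq_one h.1 h'.1).2 hne
  have e1 : ⟪N' - N, N⟫_ℝ < 0 := by
    rw [inner_sub_left, real_inner_self_eq_norm_sq, h.1, real_inner_comm]
    linarith
  have e2 : 0 < ⟪N' - N, N'⟫_ℝ := by
    rw [inner_sub_left, real_inner_self_eq_norm_sq, h'.1]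
    linarith
  obtain ⟨t, ht1, ht2⟩ := (((h.2 _).1 e1).and ((h'.2 _).2 e2)).exists
  exact ht2 ht1

open Classical in
/-- The unit outer normal `ν` to `∂Ω`. -/
def outerNormal {n : ℕ} (Ω : Set (Rn n)) (x : Rn n) : Rn n :=
  if h : ∃ N, IsOuterUnitNormal Ω x N then h.choose else 0

/-- The surface measure `dS` on `∂Ω`: the `(n-1)`-dimensional Hausdorff measure, normalised so as to
agree with Lebesgue measure on hyperplanes, restricted to `∂Ω`. -/
def surfaceMeasure {n : ℕ} (Ω : Set (Rn n)) : Measure (Rn n) :=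
  (Measure.euclideanHausdorffMeasure (n - 1)).restrict (frontier Ω)

/-- The normal derivative `∂_ν f` on `∂Ω` of a function that is differentiable near `∂Ω`. -/
def smoothNormalDeriv {n : ℕ} (Ω : Set (Rn n)) (f : Rn n → ℝ) (x : Rn n) : ℝ :=
  fderiv ℝ f x (outerNormal Ω x)

/-- `∂Ω₊ = {x ∈ ∂Ω : ∂_ν φ(x) ≥ 0}`. -/
def boundaryPlus {n : ℕ} (Ω : Set (Rn n)) (φ : Rn n → ℝ) : Set (Rn n) :=
  {x ∈ frontier Ω | 0 ≤ smoothNormalDeriv Ω φ x}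

/-- `∂Ω₋ = {x ∈ ∂Ω : -∂_ν φ(x) ≥ 0}`. -/
def boundaryMinus {n : ℕ} (Ω : Set (Rn n)) (φ : Rn n → ℝ) : Set (Rn n) :=
  {x ∈ frontier Ω | 0 ≤ -smoothNormalDeriv Ω φ x}

/-! ### Limiting Carleman weights -/

/-- The semiclassical principal symbol `p_φ(x,ξ) = ξ² + 2i ∇φ·ξ - |∇φ|²` of the conjugated
operator `e^{φ/h} (-h²Δ) e^{-φ/h}`. -/
def carlemanSymbol {n : ℕ} (φ : Rn n → ℝ) (x ξ : Rn n) : ℂ :=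
  ((‖ξ‖ ^ 2 : ℝ) : ℂ) + 2 * Complex.I * ((⟪gradient φ x, ξ⟫_ℝ : ℝ) : ℂ)
    - ((‖gradient φ x‖ ^ 2 : ℝ) : ℂ)

/-- The Poisson bracket `{a,b} = ∇_ξ a · ∇_x b - ∇_x a · ∇_ξ b`. -/
def poissonBracket {n : ℕ} (a b : Rn n → Rn n → ℝ) (x ξ : Rn n) : ℝ :=
  ⟪gradient (fun η => a x η) ξ, gradient (fun y => b y ξ) x⟫_ℝ
    - ⟪gradient (fun y => a y ξ) x, gradient (fun η => b x η) ξ⟫_ℝ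

/-- `φ` is a (smooth) limiting Carleman weight for `-h²Δ` in the open set `U`. -/
def IsLimitingCarlemanWeight {n : ℕ} (U : Set (Rn n)) (φ : Rn n → ℝ) : Prop :=
  ContDiffOn ℝ ∞ φ U ∧ (∀ x ∈ U, gradient φ x ≠ 0) ∧
  ∀ x ∈ U, ∀ ξ : Rn n, carlemanSymbol φ x ξ = 0 →
    poissonBracket (fun y η => (carlemanSymbol φ y η).re)
      (fun y η => (carlemanSymbol φ y η).im) x ξ = 0

/-- The convexified weight `φ̃ = φ + (h / 2ε) φ²`. -/
def convexifiedWeight {n : ℕ} (φ : Rn n → ℝ) (h ε : ℝ) (x : Rn n) : ℝ :=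
  φ x + h / (2 * ε) * φ x ^ 2

/-! ### Weak derivatives and the Sobolev space `H²(Ω)` -/

/-- `g` is the weak partial derivative `∂_j u` in the open set `Ω`. -/
def HasWeakPartial {n : ℕ} (Ω : Set (Rn n)) (j : Fin n) (u g : Rn n → ℂ) : Prop :=
  LocallyIntegrableOn u Ω ∧ LocallyIntegrableOn g Ω ∧
  ∀ χ : Rn n → ℝ, ContDiff ℝ ∞ χ → HasCompactSupport χ → tsupport χ ⊆ Ω →
    ∫ x in Ω, fderiv ℝ χ x (stdVec j) • u x = - ∫ x in Ω, χ x • g x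

open Classical in
/-- The weak partial derivative `∂_j u` in `Ω` (unique up to a null subset of `Ω`). -/
def weakPartial {n : ℕ} (Ω : Set (Rn n)) (j : Fin n) (u : Rn n → ℂ) : Rn n → ℂ :=
  if h : ∃ g, HasWeakPartial Ω j u g then h.choose else 0

/-- The weak gradient of `u` in `Ω`. -/
def weakGradient {n : ℕ} (Ω : Set (Rn n)) (u : Rn n → ℂ) (x : Rn n) : EuclideanSpace ℂ (Fin n) :=
  WithLp.toLp 2 fun j => weakPartial Ω j u x

/-- The weak Laplacian of `u` in `Ω`. -/
def weakLaplacian {n : ℕ} (Ω : Set (Rn n)) (u : Rn n → ℂ) (x : Rn n) : ℂ :=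
  ∑ j, weakPartial Ω j (weakPartial Ω j u) x

/-- `v ∈ H²(Ω)`: `v` is the restriction to `Ω` of an element of `H²(ℝⁿ)`. -/
def MemH2 {n : ℕ} (Ω : Set (Rn n)) (v : Rn n → ℂ) : Prop :=
  ∃ V : Lp ℂ 2 (volume : Measure (Rn n)),
    TemperedDistribution.MemSobolev 2 2 (V : 𝓢'(Rn n, ℂ)) ∧ v =ᵐ[volume.restrict Ω] V

/-- The squared semiclassical norm
`‖v‖²_{H¹_scl(Ω)} = ‖v‖²_{L²(Ω)} + ‖h ∇v‖²_{L²(Ω)}`. -/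
def normSqH1scl {n : ℕ} (Ω : Set (Rn n)) (h : ℝ) (v : Rn n → ℂ) : ℝ :=
  (∫ x in Ω, ‖v x‖ ^ 2) + ∫ x in Ω, ‖(h : ℂ) • weakGradient Ω v x‖ ^ 2

/-- The conjugated operator `v ↦ e^{w/h} (-h²Δ) (e^{-w/h} v)` in `Ω`. -/
def conjLaplacian {n : ℕ} (Ω : Set (Rn n)) (h : ℝ) (w : Rn n → ℝ) (v : Rn n → ℂ) (x : Rn n) : ℂ :=
  (Real.exp (w x / h) : ℂ) *
    (-(h : ℂ) ^ 2 * weakLaplacian Ω (fun y => (Real.exp (-(w y / h)) : ℂ) * v y) x)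

/-! ### Boundary traces -/

/-- `g ∈ L²(∂Ω)` is the boundary trace of `u ∈ H¹(Ω)`: there are functions smooth up to the
boundary which converge to `u` in `H¹(Ω)` and whose restrictions to `∂Ω` converge to `g` in
`L²(∂Ω)`. -/
def HasTrace {n : ℕ} (Ω : Set (Rn n)) (u g : Rn n → ℂ) : Prop :=
  MemLp g 2 (surfaceMeasure Ω) ∧ ∃ w : ℕ → Rn n → ℂ, (∀ k, ContDiff ℝ ∞ (w k)) ∧
    Tendsto (fun k => eLpNorm (fun x => w k x - u x) 2 (volume.restrict Ω)) atTop (𝓝 0) ∧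
    (∀ j, Tendsto (fun k => eLpNorm (fun x => fderiv ℝ (w k) x (stdVec j) - weakPartial Ω j u x) 2
      (volume.restrict Ω)) atTop (𝓝 0)) ∧
    Tendsto (fun k => eLpNorm (fun x => w k x - g x) 2 (surfaceMeasure Ω)) atTop (𝓝 0)

open Classical in
/-- The boundary trace `u|_{∂Ω}` of `u ∈ H¹(Ω)`. -/
def boundaryTrace {n : ℕ} (Ω : Set (Rn n)) (u : Rn n → ℂ) : Rn n → ℂ :=
  if h : ∃ g, HasTrace Ω u g then h.choose else 0

/-- The boundary trace of the gradient of `v ∈ H²(Ω)`. -/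
def boundaryGradient {n : ℕ} (Ω : Set (Rn n)) (v : Rn n → ℂ) (x : Rn n) :
    EuclideanSpace ℂ (Fin n) :=
  WithLp.toLp 2 fun j => boundaryTrace Ω (weakPartial Ω j v) x

/-- The normal derivative `∂_ν v = ν · ∇v` on `∂Ω` of `v ∈ H²(Ω)`. -/
def normalDeriv {n : ℕ} (Ω : Set (Rn n)) (v : Rn n → ℂ) (x : Rn n) : ℂ :=
  ∑ j, ((outerNormal Ω x j : ℝ) : ℂ) * boundaryGradient Ω v x j

/-- The tangential gradient `∇_t v = ∇v - (∂_ν v) ν` on `∂Ω` of `v ∈ H²(Ω)`. -/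
def tangentialGradient {n : ℕ} (Ω : Set (Rn n)) (v : Rn n → ℂ) (x : Rn n) :
    EuclideanSpace ℂ (Fin n) :=
  WithLp.toLp 2 fun j =>
    boundaryGradient Ω v x j - normalDeriv Ω v x * ((outerNormal Ω x j : ℝ) : ℂ)

end

/-!
The estimate is first proved for functions `w` that are smooth up to the boundary and then extended
to `H²(Ω)` by density.

**The pointwise inequality.** Let `f = φ + (θ/2) φ²` with `θ = h/ε`, and write
`e^{f/h}(-h²Δ)e^{-f/h} = A + S` with `A = -h²Δ - |∇f|²` and `S = 2h ∇f · ∇ + h Δf`. Then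
`2 (A u) (S u)` is a divergence plus `4h³ f''(∇u, ∇u) + 4h f''(∇f, ∇f) u²` plus terms of lower
order.
By homogeneity, the vanishing of the Poisson bracket on the zero set of the symbol says that the
Hessian of `φ` is a multiple `λ` of the metric on the orthogonal complement of `∇φ` and takes the
value `-λ |∇φ|²` on `∇φ`; hence `φ''(ξ, ξ) - λ |ξ|²` is divisible by `∇φ · ξ`
(`IsLimitingCarlemanWeight.exists_carlemanBounds`). The two contributions of `λ` are removed by adding
a multiple of `λ u ∇u` to the flux, at the cost of a product `h λ u (A u)` that is absorbed by
`(A u)²`. The contribution that contains `∇φ · ∇u` is absorbed by `(S u)²`. What remains is the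
contribution of the convexification, which has size `κ u²` with `κ = h²/ε`; a further small multiple
of `κ u ∇u` in the flux turns part of it into `κ |h∇u|²`. All errors have size
`h² (u² + |h∇u|²)` and are smaller by a factor `ε`. This is `CarlemanBounds.div_flux_add_le`.

**The boundary terms.** Integration over `Ω` produces the normal component of the flux on the
boundary. Its part quadratic in the normal derivative is `2h³ ∂_ν f |∂_ν u|²`, and the rest is
controlled by the value and the tangential gradient of `u` (`neg_normal_flux_le`). The divergence
theorem is proved in graph charts, where it is the fundamental theorem of calculus along the vertical
direction, and globalised by a partition of unity. This yields some boundary measure `σ` for which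
it holds. Instead of identifying `σ` with the `(n-1)`-dimensional Hausdorff measure, it is only shown
that each is bounded by a multiple of the other (`exists_divergence_measure`). That is enough
because every boundary term of the estimate has a sign, once the normal term is split according to
the sign of `∂_ν φ` (`comparable_boundary_terms`, `CarlemanBounds.exists_boundary_estimate`).

**Density.** By Plancherel's theorem the elements of `H²(ℝⁿ)` are limits of Schwartz functions
together with their derivatives up to second order (`exists_schwartz_approximation`). The weak
derivatives in `Ω` are the `L²(Ω)` limits of the derivatives of the approximants. The divergence
theorem for `|w|² N`, with `N` a smooth field transversal to the boundary, gives the trace inequality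
`exists_integral_surfaceMeasure_le`, so the traces of a function and of its first derivatives are
limits of the boundary values of the approximants in `L²` (`tendsto_boundaryTrace`). Each term of the
estimate is an integral of a product of two such limits with a bounded weight, and therefore
converges.
-/

open scoped NNReal

noncomputable section

/-! ### The divergence theorem under a graph -/

section Graph

variable {E : Type*} [NormedAddCommGroup E] [InnerProductSpace ℝ E]

theorem inner_orthogonal_span_singleton {e : E} (y : (ℝ ∙ e)ᗮ) : ⟪(y : E), e⟫_ℝ = 0 :=
  Submodule.mem_orthogonal_singleton_iff_inner_left.1 y.2

/-- The projection to the hyperplane orthogonal to `e`, when `e` is a unit vector. -/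
def hyperplaneProj (e : E) (x : E) : E := x - ⟪x, e⟫_ℝ • e

theorem hyperplaneProj_mem {e : E} (he : ‖e‖ = 1) (x : E) : hyperplaneProj e x ∈ (ℝ ∙ e)ᗮ := by
  rw [Submodule.mem_orthogonal_singleton_iff_inner_left]
  simp [hyperplaneProj, inner_sub_left, inner_smul_left, he]

@[simp]
theorem hyperplaneProj_add_smul {e : E} (he : ‖e‖ = 1) (y : (ℝ ∙ e)ᗮ) (t : ℝ) :
    hyperplaneProj e ((y : E) + t • e) = y := by
  simp [hyperplaneProj, inner_add_left, inner_smul_left, he, inner_orthogonal_span_singleton]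

theorem inner_add_smul_self {e : E} (he : ‖e‖ = 1) (y : (ℝ ∙ e)ᗮ) (t : ℝ) :
    ⟪(y : E) + t • e, e⟫_ℝ = t := by
  simp [inner_add_left, inner_smul_left, he, inner_orthogonal_span_singleton]

@[fun_prop]
theorem contDiff_hyperplaneProj (e : E) {k : WithTop ℕ∞} : ContDiff ℝ k (hyperplaneProj e) := by
  unfold hyperplaneProj
  exact contDiff_id.sub ((contDiff_id.inner ℝ contDiff_const).smul contDiff_const)

/-- The shear `(y, s) ↦ y + (s + ψ(y)) e`, which takes the half space `s < 0` to the region below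
the graph of `ψ`. -/
def graphShear (e : E) (ψ : E → ℝ) (p : (ℝ ∙ e)ᗮ × ℝ) : E := (p.1 : E) + (p.2 + ψ p.1) • e

@[fun_prop]
theorem contDiff_graphShear (e : E) {ψ : E → ℝ} {k : WithTop ℕ∞} (hψ : ContDiff ℝ k ψ) :
    ContDiff ℝ k (graphShear e ψ) := by
  have h : ContDiff ℝ k (fun p : (ℝ ∙ e)ᗮ × ℝ => (p.1 : E)) :=
    (((ℝ ∙ e)ᗮ).subtypeL ∘L (ContinuousLinearMap.fst ℝ (ℝ ∙ e)ᗮ ℝ)).contDiff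
  exact h.add ((contDiff_snd.add (hψ.comp h)).smul contDiff_const)

theorem isClosedEmbedding_graphShear {e : E} (he : ‖e‖ = 1) {ψ : E → ℝ} (hψ : Continuous ψ) :
    IsClosedEmbedding (graphShear e ψ) := by
  have hl : Function.LeftInverse
      (fun x : E => ((⟨hyperplaneProj e x, hyperplaneProj_mem he x⟩ : (ℝ ∙ e)ᗮ),
        ⟪x, e⟫_ℝ - ψ (hyperplaneProj e x))) (graphShear e ψ) := by
    intro p
    ext
    · simp [graphShear, he]
    · simp [graphShear, he, inner_add_smul_self]
  refine hl.isClosedEmbedding ?_ ?_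
  · have := (contDiff_hyperplaneProj (k := 0) e).continuous
    fun_prop
  · unfold graphShear; fun_prop

theorem graphShear_preimage {e : E} (he : ‖e‖ = 1) (ψ : E → ℝ) :
    graphShear e ψ ⁻¹' {x | ⟪x, e⟫_ℝ < ψ (hyperplaneProj e x)} = Set.univ ×ˢ Set.Iio 0 := by
  ext p
  simp [graphShear, he, inner_add_smul_self]

variable [FiniteDimensional ℝ E] [MeasurableSpace E] [BorelSpace E]

/-- Orthogonal coordinates `(y, t) ↦ y + t e` along a unit vector `e` preserve volume. -/
theorem measurePreserving_orthogonal_add_smul {e : E} (he : ‖e‖ = 1) :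
    MeasurePreserving (fun p : (ℝ ∙ e)ᗮ × ℝ => (p.1 : E) + p.2 • e) volume volume := by
  have h1 := (Submodule.measurePreserving_measurableEquivProd (ℝ ∙ e) (0 : E)).symm
  rw [InnerProductSpace.euclideanHausdorffMeasure_eq_volume] at h1
  have h0 : MeasurePreserving (LinearIsometryEquiv.toSpanUnitSingleton e he : ℝ → (ℝ ∙ e))
      volume volume := LinearIsometryEquiv.measurePreserving _
  have h2 := h0.prod (MeasurePreserving.id (volume : Measure (ℝ ∙ e)ᗮ))
  have h3 : MeasurePreserving (Prod.swap : (ℝ ∙ e)ᗮ × ℝ → ℝ × (ℝ ∙ e)ᗮ)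
      ((volume : Measure (ℝ ∙ e)ᗮ).prod (volume : Measure ℝ))
      ((volume : Measure ℝ).prod (volume : Measure (ℝ ∙ e)ᗮ)) := Measure.measurePreserving_swap
  have h4 := (h1.comp h2).comp h3
  have h5 : (fun p : (ℝ ∙ e)ᗮ × ℝ => (p.1 : E) + p.2 • e) =
      ((((ℝ ∙ e).measurableEquivProd (0 : E)).symm : (ℝ ∙ e) × (ℝ ∙ e)ᗮ → E) ∘
        Prod.map (LinearIsometryEquiv.toSpanUnitSingleton e he : ℝ → (ℝ ∙ e)) id) ∘ Prod.swap := by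
    ext p
    simp [add_comm]
  rw [h5]
  exact h4

theorem measurePreserving_graphShear {e : E} (he : ‖e‖ = 1) {ψ : E → ℝ} (hψ : Continuous ψ) :
    MeasurePreserving (graphShear e ψ) volume volume := by
  have h : MeasurePreserving (fun p : (ℝ ∙ e)ᗮ × ℝ => (id p.1, p.2 + ψ p.1))
      ((volume : Measure (ℝ ∙ e)ᗮ).prod (volume : Measure ℝ))
      ((volume : Measure (ℝ ∙ e)ᗮ).prod (volume : Measure ℝ)) := by
    refine (MeasurePreserving.id (volume : Measure (ℝ ∙ e)ᗮ)).skew_product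
      (μc := (volume : Measure ℝ)) (μd := (volume : Measure ℝ)) (g := fun y s => s + ψ y) ?_ ?_
    · fun_prop
    · exact Eventually.of_forall fun y =>
        (MeasureTheory.measurePreserving_add_right (volume : Measure ℝ) (ψ y)).map_eq
  exact (measurePreserving_orthogonal_add_smul he).comp h

theorem integral_fderiv_eq_zero_of_hasCompactSupport {F : E → ℝ} (hF : ContDiff ℝ 1 F)
    (hc : HasCompactSupport F) (w : E) : ∫ x, fderiv ℝ F x w = 0 := by
  have hi : Integrable (fun x => fderiv ℝ F x w) :=
    ((hF.continuous_fderiv one_ne_zero).clm_apply continuous_const).integrable_of_hasCompactSupport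
      (hc.fderiv_apply (𝕜 := ℝ) w)
  have h := integral_mul_fderiv_eq_neg_fderiv_mul_of_integrable (μ := (volume : Measure E))
    (f := fun _ : E => (1 : ℝ)) (g := F) (v := w) (by simp) (by simpa using hi)
    (by simpa using hF.continuous.integrable_of_hasCompactSupport hc) (by simp)
    (fun x _ => (hF.differentiable one_ne_zero) x)
  simpa using h

/-- The divergence theorem for the region below a `C¹` graph, with the surface parametrised by the
hyperplane orthogonal to `e`. -/
theorem integral_fderiv_below_graph {e : E} (he : ‖e‖ = 1) {ψ : E → ℝ} (hψ : ContDiff ℝ 1 ψ)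
    {F : E → ℝ} (hF : ContDiff ℝ 1 F) (hc : HasCompactSupport F) (w : E) :
    ∫ x in {x | ⟪x, e⟫_ℝ < ψ (hyperplaneProj e x)}, fderiv ℝ F x w =
      ∫ y : (ℝ ∙ e)ᗮ, (⟪w, e⟫_ℝ - fderiv ℝ ψ y (hyperplaneProj e w)) *
        F (graphShear e ψ (y, 0)) := by
  have hT : ContDiff ℝ 1 (graphShear e ψ) := contDiff_graphShear e hψ
  have hcl := isClosedEmbedding_graphShear he hψ.continuous
  have hemb := hcl.measurableEmbedding
  rw [← (measurePreserving_graphShear he hψ.continuous).setIntegral_preimage_emb hemb,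
    graphShear_preimage he]
  set w' : (ℝ ∙ e)ᗮ := ⟨hyperplaneProj e w, hyperplaneProj_mem he w⟩ with hw'
  -- `F` in the flattened coordinates
  set H : (ℝ ∙ e)ᗮ × ℝ → ℝ := F ∘ graphShear e ψ with hH
  have hHd : ContDiff ℝ 1 H := hF.comp hT
  have hHc : HasCompactSupport H := hc.comp_isClosedEmbedding hcl
  set a : (ℝ ∙ e)ᗮ → ℝ := fun y => ⟪w, e⟫_ℝ - fderiv ℝ ψ y (hyperplaneProj e w) with ha
  have hac : Continuous a := by
    have := hψ.continuous_fderiv one_ne_zero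
    fun_prop
  -- in flattened coordinates `∂_w` is a normal derivative with coefficient `a` plus a derivative
  -- along the hyperplane; only the former contributes to the boundary integral
  have key : ∀ p : (ℝ ∙ e)ᗮ × ℝ, fderiv ℝ F (graphShear e ψ p) w =
      a p.1 * fderiv ℝ H p (0, 1) + fderiv ℝ H p (w', 0) := by
    intro p
    have hψ' := (hψ.differentiable one_ne_zero (p.1 : E)).hasFDerivAt
    have hTd : HasFDerivAt (graphShear e ψ)
        (((ℝ ∙ e)ᗮ).subtypeL ∘L (ContinuousLinearMap.fst ℝ _ _) +
        ((ContinuousLinearMap.snd ℝ _ _) +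
          (fderiv ℝ ψ p.1) ∘L (((ℝ ∙ e)ᗮ).subtypeL ∘L (ContinuousLinearMap.fst ℝ _ _))).smulRight e) p := by
      have h1 : HasFDerivAt (fun p : (ℝ ∙ e)ᗮ × ℝ => (p.1 : E))
        (((ℝ ∙ e)ᗮ).subtypeL ∘L (ContinuousLinearMap.fst ℝ _ _)) p :=
        (((ℝ ∙ e)ᗮ).subtypeL ∘L (ContinuousLinearMap.fst ℝ (ℝ ∙ e)ᗮ ℝ)).hasFDerivAt
      exact h1.add ((hasFDerivAt_snd.add (hψ'.comp p h1)).smul_const e)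
    have hHf : fderiv ℝ H p = (fderiv ℝ F (graphShear e ψ p)) ∘L _ :=
      ((hF.differentiable one_ne_zero _).hasFDerivAt.comp p hTd).fderiv
    have hw : w = ⟪w, e⟫_ℝ • e + hyperplaneProj e w := by simp [hyperplaneProj]
    rw [hHf]
    simp only [ContinuousLinearMap.comp_apply, add_apply, ContinuousLinearMap.smulRight_apply,
      ContinuousLinearMap.coe_fst', ContinuousLinearMap.coe_snd', map_zero, Submodule.subtypeL_apply,
      zero_add, add_zero, one_smul, map_add, map_smul, smul_eq_mul, ha, hw']
    conv_lhs => rw [hw]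
    simp only [map_add, map_smul, smul_eq_mul]
    ring
  simp_rw [key]
  have hcf : Continuous (fderiv ℝ H) := hHd.continuous_fderiv one_ne_zero
  have i1 : Integrable (fun p : (ℝ ∙ e)ᗮ × ℝ => a p.1 * fderiv ℝ H p (0, 1)) :=
    Continuous.integrable_of_hasCompactSupport (by fun_prop)
      ((hHc.fderiv_apply (𝕜 := ℝ) _).mul_left)
  have i2 : Integrable (fun p : (ℝ ∙ e)ᗮ × ℝ => fderiv ℝ H p (w', 0)) :=
    Continuous.integrable_of_hasCompactSupport (by fun_prop) (hHc.fderiv_apply (𝕜 := ℝ) _)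
  rw [integral_add i1.integrableOn i2.integrableOn]
  have hslice1 : ∀ y : (ℝ ∙ e)ᗮ, HasCompactSupport (fun s : ℝ => H (y, s)) := fun y =>
    hHc.comp_isClosedEmbedding (g := fun s => (y, s))
      ((Function.LeftInverse.isClosedEmbedding (f := Prod.snd) (fun _ => rfl)) (by fun_prop) (by fun_prop))
  have hslice2 : ∀ s : ℝ, HasCompactSupport (fun y : (ℝ ∙ e)ᗮ => H (y, s)) := fun s =>
    hHc.comp_isClosedEmbedding (g := fun y => (y, s))
      ((Function.LeftInverse.isClosedEmbedding (f := Prod.fst) (fun _ => rfl)) (by fun_prop) (by fun_prop))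
  have e1 : ∫ p in Set.univ ×ˢ Set.Iio (0 : ℝ), a p.1 * fderiv ℝ H p (0, 1) =
      ∫ y : (ℝ ∙ e)ᗮ, a y * F (graphShear e ψ (y, 0)) := by
    rw [Measure.volume_eq_prod, setIntegral_prod _ i1.integrableOn, setIntegral_univ]
    congr 1
    ext y
    simp only []
    rw [integral_const_mul]
    congr 1
    have hd : ∀ s : ℝ, deriv (fun s => H (y, s)) s = fderiv ℝ H (y, s) (0, 1) := fun s => by
      have h1 : HasDerivAt (fun s : ℝ => (y, s)) ((0 : (ℝ ∙ e)ᗮ), (1 : ℝ)) s :=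
        (hasDerivAt_const s y).prodMk (hasDerivAt_id s)
      exact ((hHd.differentiable one_ne_zero (y, s)).hasFDerivAt.comp_hasDerivAt s h1).deriv
    rw [← integral_Iic_eq_integral_Iio]
    simp_rw [← hd]
    exact (hslice1 y).integral_Iic_deriv_eq (by fun_prop) 0
  have e2 : ∫ p in Set.univ ×ˢ Set.Iio (0 : ℝ), fderiv ℝ H p (w', 0) = 0 := by
    rw [Measure.volume_eq_prod, ← Measure.prod_restrict, integral_prod_symm, Measure.restrict_univ]
    · refine integral_eq_zero_of_ae (Eventually.of_forall fun s => ?_)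
      have hd : ∀ y : (ℝ ∙ e)ᗮ, fderiv ℝ (fun y => H (y, s)) y w' = fderiv ℝ H (y, s) (w', 0) :=
        fun y => by
        have h1 : HasFDerivAt (𝕜 := ℝ) (fun y : (ℝ ∙ e)ᗮ => (y, s)) _ y :=
          (hasFDerivAt_id y).prodMk (hasFDerivAt_const s y)
        have h2 : fderiv ℝ (fun y => H (y, s)) y = _ :=
          ((hHd.differentiable one_ne_zero (y, s)).hasFDerivAt.comp y h1).fderiv
        rw [h2]
        simp [ContinuousLinearMap.comp_apply]
      simp_rw [← hd]
      exact integral_fderiv_eq_zero_of_hasCompactSupport (by fun_prop) (hslice2 s) w'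
    · rw [Measure.prod_restrict, ← Measure.volume_eq_prod]
      exact i2.integrableOn
  rw [e1, e2, add_zero]

end Graph

/-! ### The boundary in a graph chart -/

section Chart

variable {n : ℕ}

/-- The defining function `⟪x, e⟫ - ψ(x - ⟪x, e⟫ e)` of the region below the graph of `ψ`. -/
def graphDefining (e : Rn n) (ψ : Rn n → ℝ) (x : Rn n) : ℝ := ⟪x, e⟫_ℝ - ψ (hyperplaneProj e x)

@[fun_prop]
theorem contDiff_graphDefining (e : Rn n) {ψ : Rn n → ℝ} {k : WithTop ℕ∞} (hψ : ContDiff ℝ k ψ) :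
    ContDiff ℝ k (graphDefining e ψ) :=
  (contDiff_id.inner ℝ contDiff_const).sub (hψ.comp (contDiff_hyperplaneProj e))

theorem fderiv_graphDefining (e : Rn n) {ψ : Rn n → ℝ} (hψ : ContDiff ℝ 1 ψ) (x w : Rn n) :
    fderiv ℝ (graphDefining e ψ) x w =
      ⟪w, e⟫_ℝ - fderiv ℝ ψ (hyperplaneProj e x) (hyperplaneProj e w) := by
  have h1 : HasFDerivAt (fun x : Rn n => ⟪x, e⟫_ℝ) (innerSL ℝ e) x := by
    have := (innerSL ℝ e).hasFDerivAt (x := x)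
    convert this using 1
    ext y
    simp [real_inner_comm]
  have h2 : HasFDerivAt (hyperplaneProj e)
      (ContinuousLinearMap.id ℝ (Rn n) - (innerSL ℝ e).smulRight e) x :=
    (hasFDerivAt_id x).sub (h1.smul_const e)
  have h3 : fderiv ℝ (graphDefining e ψ) x = _ :=
    (h1.sub ((hψ.differentiable one_ne_zero _).hasFDerivAt.comp x h2)).fderiv
  rw [h3]
  simp [hyperplaneProj, real_inner_comm]

theorem inner_gradient_graphDefining (e : Rn n) {ψ : Rn n → ℝ} (x w : Rn n) :
    ⟪gradient (graphDefining e ψ) x, w⟫_ℝ = fderiv ℝ (graphDefining e ψ) x w := by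
  simp [gradient]

/-- The gradient of the defining function has component `1` along `e`, so the area density of the
graph over the hyperplane is at least `1`. -/
theorem inner_gradient_graphDefining_self {e : Rn n} (he : ‖e‖ = 1) {ψ : Rn n → ℝ}
    (hψ : ContDiff ℝ 1 ψ) (x : Rn n) : ⟪gradient (graphDefining e ψ) x, e⟫_ℝ = 1 := by
  rw [inner_gradient_graphDefining, fderiv_graphDefining e hψ]
  simp [hyperplaneProj, he]

theorem one_le_norm_gradient_graphDefining {e : Rn n} (he : ‖e‖ = 1) {ψ : Rn n → ℝ}
    (hψ : ContDiff ℝ 1 ψ) (x : Rn n) : 1 ≤ ‖gradient (graphDefining e ψ) x‖ := by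
  have h := real_inner_le_norm (gradient (graphDefining e ψ) x) e
  rwa [inner_gradient_graphDefining_self he hψ, he, mul_one] at h

theorem continuous_gradient_graphDefining (e : Rn n) {ψ : Rn n → ℝ} (hψ : ContDiff ℝ 1 ψ) :
    Continuous (gradient (graphDefining e ψ)) :=
  (InnerProductSpace.toDual ℝ (Rn n)).symm.continuous.comp
    ((contDiff_graphDefining e hψ).continuous_fderiv one_ne_zero)

theorem graphDefining_graphShear {e : Rn n} (he : ‖e‖ = 1) (ψ : Rn n → ℝ) (p : (ℝ ∙ e)ᗮ × ℝ) :
    graphDefining e ψ (graphShear e ψ p) = p.2 := by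
  simp [graphDefining, graphShear, he, inner_add_smul_self]

theorem graphDefining_add_smul {e : Rn n} (he : ‖e‖ = 1) (ψ : Rn n → ℝ) (x : Rn n) (t : ℝ) :
    graphDefining e ψ (x + t • e) = graphDefining e ψ x + t := by
  simp [graphDefining, hyperplaneProj, inner_add_left, inner_smul_left, he, add_smul]
  ring

variable {Ω : Set (Rn n)} {x₀ e : Rn n} {r : ℝ} {ψ : Rn n → ℝ}

theorem graphDefining_neg_iff
    (hΩ : ∀ x ∈ Metric.ball x₀ r, (x ∈ Ω ↔ ⟪x, e⟫_ℝ < ψ (x - ⟪x, e⟫_ℝ • e)))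
    {x : Rn n} (hx : x ∈ Metric.ball x₀ r) : x ∈ Ω ↔ graphDefining e ψ x < 0 := by
  rw [hΩ x hx, graphDefining, sub_neg, hyperplaneProj]

theorem mem_frontier_iff_graphDefining (he : ‖e‖ = 1) (hψ : Continuous ψ)
    (hΩ : ∀ x ∈ Metric.ball x₀ r, (x ∈ Ω ↔ ⟪x, e⟫_ℝ < ψ (x - ⟪x, e⟫_ℝ • e)))
    {x : Rn n} (hx : x ∈ Metric.ball x₀ r) : x ∈ frontier Ω ↔ graphDefining e ψ x = 0 := by
  have hc : Continuous (graphDefining e ψ) :=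
    (contDiff_graphDefining (k := 0) e (contDiff_zero.2 hψ)).continuous
  have hb : Metric.ball x₀ r ∈ 𝓝 x := Metric.isOpen_ball.mem_nhds hx
  constructor
  · intro hf
    rcases lt_trichotomy (graphDefining e ψ x) 0 with h | h | h
    · exact absurd (mem_interior_iff_mem_nhds.2 (by
        filter_upwards [hb, hc.continuousAt.eventually (gt_mem_nhds h)] with y hy hy2
        exact (graphDefining_neg_iff hΩ hy).2 hy2)) hf.2
    · exact h
    · have : Ωᶜ ∈ 𝓝 x := by
        filter_upwards [hb, hc.continuousAt.eventually (lt_mem_nhds h)] with y hy hy2 hyΩ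
        exact absurd ((graphDefining_neg_iff hΩ hy).1 hyΩ) (not_lt.2 hy2.le)
      exact absurd (mem_interior_iff_mem_nhds.2 this) (by
        rw [interior_compl]; exact fun h => h hf.1)
  · intro h0
    refine ⟨?_, fun hi => ?_⟩
    · have ht : Tendsto (fun t : ℝ => x + t • e) (𝓝[<] 0) (𝓝 x) := by
        have : Continuous (fun t : ℝ => x + t • e) := by fun_prop
        simpa using (this.tendsto 0).mono_left nhdsWithin_le_nhds
      refine mem_closure_of_tendsto ht ?_
      filter_upwards [ht.eventually hb, self_mem_nhdsWithin] with t ht1 ht2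
      rw [graphDefining_neg_iff hΩ ht1, graphDefining_add_smul he, h0, zero_add]
      exact ht2
    · have := (graphDefining_neg_iff hΩ hx).1 (interior_subset hi)
      exact absurd h0 this.ne

/-- The normalised gradient of the defining function is the outer normal: the sign of the derivative
of the defining function along a ray decides on which side of the boundary the ray starts. -/
theorem isOuterUnitNormal_gradient_graphDefining (he : ‖e‖ = 1) (hψ : ContDiff ℝ 1 ψ)
    (hΩ : ∀ x ∈ Metric.ball x₀ r, (x ∈ Ω ↔ ⟪x, e⟫_ℝ < ψ (x - ⟪x, e⟫_ℝ • e)))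
    {x : Rn n} (hx : x ∈ Metric.ball x₀ r) (hf : x ∈ frontier Ω) :
    IsOuterUnitNormal Ω x
      (‖gradient (graphDefining e ψ) x‖⁻¹ • gradient (graphDefining e ψ) x) := by
  have h1 := one_le_norm_gradient_graphDefining he hψ x
  have hpos : 0 < ‖gradient (graphDefining e ψ) x‖ := by linarith
  have h0 := (mem_frontier_iff_graphDefining he hψ.continuous hΩ hx).1 hf
  refine ⟨by rw [norm_smul, norm_inv, norm_norm, inv_mul_cancel₀ hpos.ne'], fun w => ?_⟩
  rw [inner_smul_right, real_inner_comm, inner_gradient_graphDefining]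
  -- the derivative of the defining function along the ray `x + t w`
  have hd : HasDerivAt (fun t : ℝ => graphDefining e ψ (x + t • w))
      (fderiv ℝ (graphDefining e ψ) x w) 0 := by
    have h2 : HasDerivAt (fun t : ℝ => x + t • w) w 0 := by
      simpa using ((hasDerivAt_id (0 : ℝ)).smul_const w).const_add x
    have h3 := ((contDiff_graphDefining e hψ).differentiable one_ne_zero x).hasFDerivAt
    have h4 : x = x + (0 : ℝ) • w := by simp
    have h5 : HasFDerivAt (graphDefining e ψ) (fderiv ℝ (graphDefining e ψ) x) (x + (0 : ℝ) • w) := by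
      rwa [← h4]
    exact h5.comp_hasDerivAt (0 : ℝ) h2
  have hb : ∀ᶠ t in 𝓝[>] (0 : ℝ), x + t • w ∈ Metric.ball x₀ r := by
    have : Continuous (fun t : ℝ => x + t • w) := by fun_prop
    exact ((this.tendsto 0).mono_left nhdsWithin_le_nhds).eventually
      (by
        change Metric.ball x₀ r ∈ 𝓝 (x + (0 : ℝ) • w)
        rw [zero_smul, add_zero]
        exact Metric.isOpen_ball.mem_nhds hx)
  have hsl := (hasDerivWithinAt_iff_tendsto_slope' (s := Set.Ioi 0) (by simp)).1
    hd.hasDerivWithinAt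
  have hs : ∀ t : ℝ, slope (fun t : ℝ => graphDefining e ψ (x + t • w)) 0 t =
      t⁻¹ * graphDefining e ψ (x + t • w) := by
    intro t
    simp [slope, h0]
  constructor
  · intro hw
    have hw' : fderiv ℝ (graphDefining e ψ) x w < 0 := by
      by_contra hcon
      exact absurd hw (not_lt.2 (mul_nonneg (by positivity) (not_lt.1 hcon)))
    filter_upwards [hb, hsl.eventually (gt_mem_nhds hw'), self_mem_nhdsWithin] with t ht1 ht2 ht3
    rw [graphDefining_neg_iff hΩ ht1]
    rw [hs] at ht2
    by_contra hcon
    exact absurd ht2 (not_lt.2 (mul_nonneg (inv_nonneg.2 (le_of_lt ht3)) (not_lt.1 hcon)))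
  · intro hw
    have hw' : 0 < fderiv ℝ (graphDefining e ψ) x w := by
      by_contra hcon
      exact absurd hw (not_lt.2 (mul_nonpos_of_nonneg_of_nonpos (by positivity) (not_lt.1 hcon)))
    filter_upwards [hb, hsl.eventually (lt_mem_nhds hw'), self_mem_nhdsWithin] with t ht1 ht2 ht3
    rw [graphDefining_neg_iff hΩ ht1]
    rw [hs] at ht2
    intro hcon
    exact absurd ht2 (not_lt.2 (mul_nonpos_of_nonneg_of_nonpos
      (inv_nonneg.2 (le_of_lt ht3)) hcon.le))

theorem IsOuterUnitNormal.outerNormal_eq {x N : Rn n} (h : IsOuterUnitNormal Ω x N) :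
    outerNormal Ω x = N := by
  have hex : ∃ N, IsOuterUnitNormal Ω x N := ⟨N, h⟩
  rw [outerNormal, dif_pos hex]
  exact hex.choose_spec.unique h

theorem outerNormal_eq_gradient_graphDefining (he : ‖e‖ = 1) (hψ : ContDiff ℝ 1 ψ)
    (hΩ : ∀ x ∈ Metric.ball x₀ r, (x ∈ Ω ↔ ⟪x, e⟫_ℝ < ψ (x - ⟪x, e⟫_ℝ • e)))
    {x : Rn n} (hx : x ∈ Metric.ball x₀ r) (hf : x ∈ frontier Ω) :
    outerNormal Ω x = ‖gradient (graphDefining e ψ) x‖⁻¹ • gradient (graphDefining e ψ) x :=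
  (isOuterUnitNormal_gradient_graphDefining he hψ hΩ hx hf).outerNormal_eq

/-- The divergence theorem for functions supported in a chart. -/
theorem setIntegral_fderiv_of_tsupport_subset_ball (hΩo : IsOpen Ω) (he : ‖e‖ = 1)
    (hψ : ContDiff ℝ 1 ψ)
    (hΩ : ∀ x ∈ Metric.ball x₀ r, (x ∈ Ω ↔ ⟪x, e⟫_ℝ < ψ (x - ⟪x, e⟫_ℝ • e)))
    {F : Rn n → ℝ} (hF : ContDiff ℝ 1 F) (hs : tsupport F ⊆ Metric.ball x₀ r) (w : Rn n) :
    ∫ x in Ω, fderiv ℝ F x w = ∫ y : (ℝ ∙ e)ᗮ,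
      (‖gradient (graphDefining e ψ) (graphShear e ψ (y, 0))‖ *
        ⟪outerNormal Ω (graphShear e ψ (y, 0)), w⟫_ℝ) * F (graphShear e ψ (y, 0)) := by
  have hc : HasCompactSupport F :=
    Metric.isCompact_of_isClosed_isBounded (isClosed_tsupport F) (Metric.isBounded_ball.subset hs)
  have hm : MeasurableSet {x | ⟪x, e⟫_ℝ < ψ (hyperplaneProj e x)} :=
    (isOpen_lt (by fun_prop)
      (hψ.continuous.comp (contDiff_hyperplaneProj (k := 0) e).continuous)).measurableSet
  have h1 : ∫ x in Ω, fderiv ℝ F x w =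
      ∫ x in {x | ⟪x, e⟫_ℝ < ψ (hyperplaneProj e x)}, fderiv ℝ F x w := by
    rw [← integral_indicator hΩo.measurableSet, ← integral_indicator hm]
    congr 1
    ext x
    by_cases hx : x ∈ Metric.ball x₀ r
    · have : x ∈ Ω ↔ x ∈ {x | ⟪x, e⟫_ℝ < ψ (hyperplaneProj e x)} := hΩ x hx
      simp only [Set.indicator, this]
    · have : fderiv ℝ F x = 0 := by
        by_contra hne
        exact hx (hs (support_fderiv_subset ℝ hne))
      simp [Set.indicator, this]
  rw [h1, integral_fderiv_below_graph he hψ hF hc]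
  congr 1
  ext y
  by_cases hx : graphShear e ψ (y, 0) ∈ Metric.ball x₀ r
  · have hf : graphShear e ψ (y, 0) ∈ frontier Ω :=
      (mem_frontier_iff_graphDefining he hψ.continuous hΩ hx).2 (graphDefining_graphShear he ψ _)
    have h2 := one_le_norm_gradient_graphDefining he hψ (graphShear e ψ (y, 0))
    rw [outerNormal_eq_gradient_graphDefining he hψ hΩ hx hf, inner_smul_left,
      inner_gradient_graphDefining, fderiv_graphDefining e hψ]
    have h3 : hyperplaneProj e (graphShear e ψ (y, 0)) = y := by simp [graphShear, he]
    rw [h3]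
    simp only [map_inv₀, conj_trivial]
    rw [mul_inv_cancel_left₀ (by linarith)]
  · have : F (graphShear e ψ (y, 0)) = 0 := by
      by_contra hne
      exact hx (hs (subset_tsupport F hne))
    simp [this]

end Chart

open scoped ENNReal

/-! ### A boundary measure for the divergence theorem -/

section LocalMeasure

variable {n : ℕ}

theorem volume_orthogonal_span_singleton {e : Rn n} (he : ‖e‖ = 1) :
    (volume : Measure (ℝ ∙ e)ᗮ) = Measure.euclideanHausdorffMeasure (n - 1) := by
  have h0 : e ≠ 0 := by
    rintro rfl
    simp at he
  have h := Submodule.finrank_add_finrank_orthogonal (ℝ ∙ e)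
  rw [finrank_span_singleton h0, finrank_euclideanSpace_fin] at h
  rw [← InnerProductSpace.euclideanHausdorffMeasure_eq_volume]
  congr 1
  omega

theorem antilipschitzWith_graphShear (e : Rn n) (ψ : Rn n → ℝ) :
    AntilipschitzWith 1 (fun y : (ℝ ∙ e)ᗮ => graphShear e ψ (y, 0)) := by
  refine AntilipschitzWith.of_le_mul_dist fun y z => ?_
  rw [NNReal.coe_one, one_mul, dist_eq_norm, dist_eq_norm]
  have h1 : graphShear e ψ (y, 0) - graphShear e ψ (z, 0) =
      ((y - z : (ℝ ∙ e)ᗮ) : Rn n) + (ψ y - ψ z) • e := by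
    simp only [graphShear, Submodule.coe_sub]
    module
  rw [h1]
  refine le_of_sq_le_sq ?_ (norm_nonneg _)
  rw [norm_add_sq_real, inner_smul_right, inner_orthogonal_span_singleton, Submodule.coe_norm]
  nlinarith [sq_nonneg ‖(ψ y - ψ z) • e‖]

/-- The surface measure on the graph of `ψ`, weighted by `χ`: the push-forward of Lebesgue measure
on the hyperplane orthogonal to `e`, with the area density given by the norm of the gradient of the
defining function. Negative values of `χ` are truncated to `0`. -/
def graphMeasure (e : Rn n) (ψ χ : Rn n → ℝ) : Measure (Rn n) :=
  ((volume : Measure (ℝ ∙ e)ᗮ).withDensity fun y =>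
    ((χ (graphShear e ψ (y, 0)) * ‖gradient (graphDefining e ψ) (graphShear e ψ (y, 0))‖).toNNReal :
      ℝ≥0∞)).map fun y => graphShear e ψ (y, 0)

variable {Ω : Set (Rn n)} {x₀ e : Rn n} {r : ℝ} {ψ χ : Rn n → ℝ}

theorem isClosedEmbedding_graphShear_zero (he : ‖e‖ = 1) (hψ : Continuous ψ) :
    IsClosedEmbedding (fun y : (ℝ ∙ e)ᗮ => graphShear e ψ (y, 0)) :=
  (isClosedEmbedding_graphShear he hψ).comp
    ((Function.LeftInverse.isClosedEmbedding (f := Prod.fst) (fun _ => rfl))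
      (by fun_prop) (by fun_prop))

theorem continuous_graphDensity (he : ‖e‖ = 1) (hψ : ContDiff ℝ 1 ψ) (hχ : Continuous χ) :
    Continuous fun y : (ℝ ∙ e)ᗮ => (χ (graphShear e ψ (y, 0)) *
      ‖gradient (graphDefining e ψ) (graphShear e ψ (y, 0))‖).toNNReal := by
  have h1 := (isClosedEmbedding_graphShear_zero he hψ.continuous).continuous
  have h2 := continuous_gradient_graphDefining e hψ
  exact continuous_real_toNNReal.comp ((hχ.comp h1).mul (h2.comp h1).norm)

theorem exists_graphDensity_le (he : ‖e‖ = 1) (hψ : ContDiff ℝ 1 ψ) (hχ : Continuous χ)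
    (hs : HasCompactSupport χ) :
    ∃ M : ℝ≥0, ∀ y : (ℝ ∙ e)ᗮ, (χ (graphShear e ψ (y, 0)) *
      ‖gradient (graphDefining e ψ) (graphShear e ψ (y, 0))‖).toNNReal ≤ M := by
  have h1 := isClosedEmbedding_graphShear_zero he hψ.continuous
  have h2 := continuous_gradient_graphDefining e hψ
  obtain ⟨M, hM⟩ := ((hχ.comp h1.continuous).mul
    (h2.comp h1.continuous).norm).bounded_above_of_compact_support
      ((hs.comp_isClosedEmbedding h1).mul_right)
  refine ⟨M.toNNReal, fun y => Real.toNNReal_le_toNNReal ((le_abs_self _).trans (hM y))⟩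

theorem isCompact_graphShear_preimage (he : ‖e‖ = 1) (hψ : Continuous ψ)
    (hs : HasCompactSupport χ) :
    IsCompact ((fun y : (ℝ ∙ e)ᗮ => graphShear e ψ (y, 0)) ⁻¹' tsupport χ) :=
  (isClosedEmbedding_graphShear_zero he hψ).isCompact_preimage hs

theorem graphMeasure_apply (he : ‖e‖ = 1) (hψ : ContDiff ℝ 1 ψ) {A : Set (Rn n)}
    (hA : MeasurableSet A) :
    graphMeasure e ψ χ A = ∫⁻ y in (fun y : (ℝ ∙ e)ᗮ => graphShear e ψ (y, 0)) ⁻¹' A,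
      ((χ (graphShear e ψ (y, 0)) *
        ‖gradient (graphDefining e ψ) (graphShear e ψ (y, 0))‖).toNNReal : ℝ≥0∞) := by
  have h1 := (isClosedEmbedding_graphShear_zero he hψ.continuous).measurableEmbedding
  rw [graphMeasure, Measure.map_apply h1.measurable hA, withDensity_apply _ (h1.measurable hA)]

/-- The graph parametrisation does not decrease distances, so Hausdorff measure on the graph
dominates Lebesgue measure on the hyperplane. -/
theorem graphMeasure_le (he : ‖e‖ = 1) (hψ : ContDiff ℝ 1 ψ) (hχ : Continuous χ)
    (hΩ : ∀ x ∈ Metric.ball x₀ r, (x ∈ Ω ↔ ⟪x, e⟫_ℝ < ψ (x - ⟪x, e⟫_ℝ • e)))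
    (hs : tsupport χ ⊆ Metric.ball x₀ r) :
    ∃ b : ℝ≥0, graphMeasure e ψ χ ≤ b • surfaceMeasure Ω := by
  have hc : HasCompactSupport χ :=
    Metric.isCompact_of_isClosed_isBounded (isClosed_tsupport χ) (Metric.isBounded_ball.subset hs)
  obtain ⟨M, hM⟩ := exists_graphDensity_le he hψ hχ hc
  have h1 := isClosedEmbedding_graphShear_zero he hψ.continuous
  refine ⟨M, Measure.le_iff.2 fun A hA => ?_⟩
  set γ := fun y : (ℝ ∙ e)ᗮ => graphShear e ψ (y, 0) with hγ
  set S := γ ⁻¹' tsupport χ with hS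
  have hSm : MeasurableSet S := (isCompact_graphShear_preimage he hψ.continuous hc).measurableSet
  have hAm : MeasurableSet (γ ⁻¹' A) := h1.measurableEmbedding.measurable hA
  calc graphMeasure e ψ χ A
      = ∫⁻ y in γ ⁻¹' A, ((χ (γ y) * ‖gradient (graphDefining e ψ) (γ y)‖).toNNReal : ℝ≥0∞) :=
        graphMeasure_apply he hψ hA
    _ ≤ ∫⁻ y in γ ⁻¹' A, S.indicator (fun _ => (M : ℝ≥0∞)) y := by
        refine lintegral_mono fun y => ?_
        by_cases hy : y ∈ S
        · rw [Set.indicator_of_mem hy]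
          exact ENNReal.coe_le_coe.2 (hM y)
        · have : χ (γ y) = 0 := by
            by_contra hne
            exact hy (subset_tsupport χ hne)
          simp [this]
    _ = M * volume (S ∩ γ ⁻¹' A) := by
        rw [lintegral_indicator hSm, Measure.restrict_restrict hSm, setLIntegral_const]
    _ ≤ M * surfaceMeasure Ω A := by
        gcongr
        rw [volume_orthogonal_span_singleton he, surfaceMeasure, Measure.restrict_apply hA,
          Measure.euclideanHausdorffMeasure_def, Measure.euclideanHausdorffMeasure_def,
          Measure.smul_apply, Measure.smul_apply]
        gcongr
        have h2 := (antilipschitzWith_graphShear e ψ).le_hausdorffMeasure_image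
          (d := ((n - 1 : ℕ) : ℝ)) (by positivity) (S ∩ γ ⁻¹' A)
        rw [ENNReal.coe_one, ENNReal.one_rpow, one_mul] at h2
        refine h2.trans (measure_mono ?_)
        rintro _ ⟨y, ⟨hy1, hy2⟩, rfl⟩
        exact ⟨hy2, (mem_frontier_iff_graphDefining he hψ.continuous hΩ (hs hy1)).2
          (graphDefining_graphShear he ψ _)⟩
    _ = (M • surfaceMeasure Ω) A := by rw [Measure.smul_apply]; rfl

theorem isFiniteMeasure_graphMeasure (he : ‖e‖ = 1) (hψ : ContDiff ℝ 1 ψ) (hχ : Continuous χ)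
    (hc : HasCompactSupport χ) : IsFiniteMeasure (graphMeasure e ψ χ) := by
  have h1 := isClosedEmbedding_graphShear_zero he hψ.continuous
  refine ⟨?_⟩
  rw [graphMeasure_apply he hψ MeasurableSet.univ, Set.preimage_univ, Measure.restrict_univ]
  have h2 : Integrable (fun y : (ℝ ∙ e)ᗮ => χ (graphShear e ψ (y, 0)) *
        ‖gradient (graphDefining e ψ) (graphShear e ψ (y, 0))‖) :=
    ((hχ.comp h1.continuous).mul ((continuous_gradient_graphDefining e hψ).comp
      h1.continuous).norm).integrable_of_hasCompactSupport
      ((hc.comp_isClosedEmbedding h1).mul_right)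
  exact h2.lintegral_lt_top

/-- The graph parametrisation is Lipschitz on compact sets, so Hausdorff measure on the graph is
dominated by Lebesgue measure on the hyperplane, and the area density is at least `1`. -/
theorem setLIntegral_surfaceMeasure_le (he : ‖e‖ = 1) (hψ : ContDiff ℝ 1 ψ) (hχ : Continuous χ)
    (h0 : ∀ x, 0 ≤ χ x)
    (hΩ : ∀ x ∈ Metric.ball x₀ r, (x ∈ Ω ↔ ⟪x, e⟫_ℝ < ψ (x - ⟪x, e⟫_ℝ • e)))
    (hs : tsupport χ ⊆ Metric.ball x₀ r) :
    ∃ b : ℝ≥0, ∀ A, MeasurableSet A →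
      ∫⁻ x in A, ENNReal.ofReal (χ x) ∂surfaceMeasure Ω ≤ b * graphMeasure e ψ χ A := by
  have hc : HasCompactSupport χ :=
    Metric.isCompact_of_isClosed_isBounded (isClosed_tsupport χ) (Metric.isBounded_ball.subset hs)
  have h1 := isClosedEmbedding_graphShear_zero he hψ.continuous
  set γ := fun y : (ℝ ∙ e)ᗮ => graphShear e ψ (y, 0) with hγ
  set S := γ ⁻¹' tsupport χ with hS
  have hSc : IsCompact S := isCompact_graphShear_preimage he hψ.continuous hc
  obtain ⟨R, hR⟩ := hSc.isBounded.subset_closedBall (0 : (ℝ ∙ e)ᗮ)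
  obtain ⟨L, hL⟩ : ∃ L, LipschitzOnWith L γ (Metric.closedBall 0 R) := by
    have : ContDiff ℝ 1 γ := (contDiff_graphShear e hψ).comp (contDiff_id.prodMk contDiff_const)
    exact this.contDiffOn.exists_lipschitzOnWith one_ne_zero (convex_closedBall _ _)
      (isCompact_closedBall _ _)
  set c : ℝ≥0 := L ^ ((n - 1 : ℕ) : ℝ)
  -- on the support of the weight, surface measure is dominated by Lebesgue measure on the chart
  have hle : (surfaceMeasure Ω).restrict (tsupport χ) ≤
      c • ((volume : Measure (ℝ ∙ e)ᗮ).restrict S).map γ := by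
    refine Measure.le_iff.2 fun A hA => ?_
    have hAm : MeasurableSet (γ ⁻¹' A) := h1.measurableEmbedding.measurable hA
    rw [Measure.smul_apply, Measure.map_apply h1.measurableEmbedding.measurable hA,
      Measure.restrict_apply hA, Measure.restrict_apply hAm, surfaceMeasure,
      Measure.restrict_apply (hA.inter (isClosed_tsupport χ).measurableSet),
      volume_orthogonal_span_singleton he,
      Measure.euclideanHausdorffMeasure_def, Measure.euclideanHausdorffMeasure_def,
      Measure.smul_apply, Measure.smul_apply, smul_comm]
    gcongr
    have h2 : A ∩ tsupport χ ∩ frontier Ω ⊆ γ '' (γ ⁻¹' A ∩ S) := by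
      rintro x ⟨⟨hx1, hx2⟩, hx3⟩
      have h3 := (mem_frontier_iff_graphDefining he hψ.continuous hΩ (hs hx2)).1 hx3
      have h4 : γ ⟨hyperplaneProj e x, hyperplaneProj_mem he x⟩ = x := by
        simp only [hγ, graphShear]
        rw [graphDefining, sub_eq_zero] at h3
        rw [zero_add, ← h3]
        simp [hyperplaneProj]
      exact ⟨_, ⟨by simpa [h4] using hx1, by simpa [hS, h4] using hx2⟩, h4⟩
    refine (measure_mono h2).trans (((hL.mono
      (Set.inter_subset_right.trans hR)).hausdorffMeasure_image_le (by positivity)).trans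
      (le_of_eq ?_))
    rw [ENNReal.smul_def, smul_eq_mul, ENNReal.coe_rpow_of_nonneg _ (by positivity)]
  refine ⟨c, fun A hA => ?_⟩
  have hχm : Measurable fun x => ENNReal.ofReal (χ x) := ENNReal.measurable_ofReal.comp hχ.measurable
  calc ∫⁻ x in A, ENNReal.ofReal (χ x) ∂surfaceMeasure Ω
      = ∫⁻ x in A, ENNReal.ofReal (χ x) ∂(surfaceMeasure Ω).restrict (tsupport χ) := by
        rw [Measure.restrict_restrict hA, Set.inter_comm,
          ← Measure.restrict_restrict (isClosed_tsupport χ).measurableSet]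
        rw [← lintegral_indicator (isClosed_tsupport χ).measurableSet]
        congr 1
        ext x
        by_cases hx : x ∈ tsupport χ
        · simp [hx]
        · simp [hx, image_eq_zero_of_notMem_tsupport hx]
    _ ≤ ∫⁻ x in A, ENNReal.ofReal (χ x) ∂(c • ((volume : Measure (ℝ ∙ e)ᗮ).restrict S).map γ) :=
        lintegral_mono' (Measure.restrict_mono le_rfl hle) le_rfl
    _ = c * ∫⁻ y in γ ⁻¹' A ∩ S, ENNReal.ofReal (χ (γ y)) := by
        have hAm : MeasurableSet (γ ⁻¹' A) := h1.measurableEmbedding.measurable hA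
        rw [Measure.restrict_smul, lintegral_smul_measure, ENNReal.smul_def, smul_eq_mul,
          setLIntegral_map hA hχm h1.measurableEmbedding.measurable,
          Measure.restrict_restrict hAm]
    _ ≤ c * graphMeasure e ψ χ A := by
        rw [graphMeasure_apply he hψ hA]
        refine mul_le_mul' le_rfl ?_
        refine (lintegral_mono_set Set.inter_subset_left).trans (lintegral_mono fun y => ?_)
        refine ENNReal.ofReal_le_ofReal ?_
        exact le_mul_of_one_le_right (h0 _) (one_le_norm_gradient_graphDefining he hψ _)

/-- The divergence theorem localised by a weight `χ` supported in a chart. -/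
theorem setIntegral_fderiv_mul_eq_graphMeasure (hΩo : IsOpen Ω) (he : ‖e‖ = 1)
    (hψ : ContDiff ℝ 1 ψ) (hχ : ContDiff ℝ 1 χ) (h0 : ∀ x, 0 ≤ χ x)
    (hΩ : ∀ x ∈ Metric.ball x₀ r, (x ∈ Ω ↔ ⟪x, e⟫_ℝ < ψ (x - ⟪x, e⟫_ℝ • e)))
    (hs : tsupport χ ⊆ Metric.ball x₀ r) {F : Rn n → ℝ} (hF : ContDiff ℝ 1 F) (w : Rn n) :
    ∫ x in Ω, fderiv ℝ (fun x => χ x * F x) x w =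
      ∫ x, ⟪outerNormal Ω x, w⟫_ℝ * F x ∂graphMeasure e ψ χ := by
  have h1 := (isClosedEmbedding_graphShear_zero he hψ.continuous).measurableEmbedding
  rw [setIntegral_fderiv_of_tsupport_subset_ball hΩo he hψ hΩ (hχ.mul hF)
    ((tsupport_mul_subset_left).trans hs), graphMeasure, h1.integral_map,
    integral_withDensity_eq_integral_smul (continuous_graphDensity he hψ hχ.continuous).measurable]
  congr 1
  ext y
  rw [NNReal.smul_def, Real.coe_toNNReal _ (mul_nonneg (h0 _) (norm_nonneg _)), smul_eq_mul]
  ring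

end LocalMeasure

/-! ### The divergence theorem on a bounded domain with `C²` boundary -/

section Global

variable {n : ℕ} {Ω : Set (Rn n)}

theorem norm_outerNormal (hΩ : HasC2Boundary Ω) {x : Rn n} (hx : x ∈ frontier Ω) :
    ‖outerNormal Ω x‖ = 1 := by
  obtain ⟨e, r, ψ, he, hr, hψ, h⟩ := hΩ x hx
  have hN := isOuterUnitNormal_gradient_graphDefining he (hψ.of_le one_le_two) h
    (Metric.mem_ball_self hr) hx
  rw [hN.outerNormal_eq]
  exact hN.1

theorem continuousOn_outerNormal (hΩ : HasC2Boundary Ω) :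
    ContinuousOn (outerNormal Ω) (frontier Ω) := by
  intro x hx
  obtain ⟨e, r, ψ, he, hr, hψ, h⟩ := hΩ x hx
  have hψ1 : ContDiff ℝ 1 ψ := hψ.of_le one_le_two
  have hc := continuous_gradient_graphDefining e hψ1
  have h1 : ContinuousAt (fun x => ‖gradient (graphDefining e ψ) x‖⁻¹ •
      gradient (graphDefining e ψ) x) x :=
    ((hc.norm.continuousAt).inv₀ (by
      have := one_le_norm_gradient_graphDefining he hψ1 x
      positivity)).smul hc.continuousAt
  refine h1.continuousWithinAt.congr_of_eventuallyEq_of_mem ?_ hx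
  filter_upwards [self_mem_nhdsWithin,
    mem_nhdsWithin_of_mem_nhds (Metric.ball_mem_nhds x hr)] with y hy1 hy2
  exact outerNormal_eq_gradient_graphDefining he hψ1 h hy2 hy1

theorem setIntegral_fderiv_eq_zero_of_tsupport_subset (hΩo : IsOpen Ω)
    {F : Rn n → ℝ} (hF : ContDiff ℝ 1 F) (hc : HasCompactSupport F) (hs : tsupport F ⊆ Ω)
    (w : Rn n) : ∫ x in Ω, fderiv ℝ F x w = 0 := by
  rw [← integral_fderiv_eq_zero_of_hasCompactSupport hF hc w, ← integral_indicator hΩo.measurableSet]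
  congr 1
  ext x
  by_cases hx : x ∈ Ω
  · simp [hx]
  · have : fderiv ℝ F x = 0 := by
      by_contra hne
      exact hx (hs (support_fderiv_subset ℝ hne))
    simp [this]

/-- A bounded `C²` domain is covered by finitely many charts and its interior; this is a smooth
partition of unity subordinate to such a cover. -/
theorem exists_partition_of_unity (hΩo : IsOpen Ω) (hΩb : Bornology.IsBounded Ω)
    {r : Rn n → ℝ} (hr : ∀ x ∈ frontier Ω, 0 < r x) :
    ∃ (t : Finset (Rn n)) (χ₀ : Rn n → ℝ) (χ : Rn n → Rn n → ℝ), ↑t ⊆ frontier Ω ∧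
      ContDiff ℝ ∞ χ₀ ∧ HasCompactSupport χ₀ ∧ tsupport χ₀ ⊆ Ω ∧
      (∀ z ∈ t, ContDiff ℝ ∞ (χ z) ∧ (∀ x, 0 ≤ χ z x) ∧ tsupport (χ z) ⊆ Metric.ball z (r z)) ∧
      ∀ x ∈ closure Ω, χ₀ x + ∑ z ∈ t, χ z x = 1 := by
  have hfc : IsCompact (frontier Ω) :=
    Metric.isCompact_of_isClosed_isBounded isClosed_frontier
      (hΩb.closure.subset frontier_subset_closure)
  obtain ⟨t, ht1, ht2⟩ := hfc.elim_nhds_subcover (fun z => Metric.ball z (r z))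
    fun z hz => Metric.ball_mem_nhds z (hr z hz)
  obtain ⟨f, hf⟩ := SmoothPartitionOfUnity.exists_isSubordinate (modelWithCornersSelf ℝ (Rn n))
    (s := closure Ω) isClosed_closure
    (fun i : Option t => i.elim Ω fun z => Metric.ball (z : Rn n) (r z))
    (by rintro (_ | z) <;> simp [hΩo, Metric.isOpen_ball])
    (by
      intro x hx
      by_cases hxΩ : x ∈ Ω
      · exact Set.mem_iUnion.2 ⟨none, hxΩ⟩
      · have hxf : x ∈ frontier Ω := by
          rw [hΩo.frontier_eq]
          exact ⟨hx, hxΩ⟩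
        obtain ⟨z, hz, hxz⟩ := Set.mem_iUnion₂.1 (ht2 hxf)
        exact Set.mem_iUnion.2 ⟨some ⟨z, hz⟩, hxz⟩)
  have hsm : ∀ i, ContDiff ℝ ∞ (f i) := fun i => (f i).contMDiff.contDiff
  refine ⟨t, f none, fun z => if hz : z ∈ t then f (some ⟨z, hz⟩) else 0, fun z hz => ht1 z hz,
    hsm _, ?_, hf none, ?_, ?_⟩
  · exact Metric.isCompact_of_isClosed_isBounded (isClosed_tsupport _) (hΩb.subset (hf none))
  · intro z hz
    simp only [hz, ↓reduceDIte]
    exact ⟨hsm _, fun x => f.nonneg _ _, hf (some ⟨z, hz⟩)⟩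
  · intro x hx
    have h1 := f.sum_eq_one hx
    rw [finsum_eq_sum_of_fintype, Fintype.sum_option] at h1
    rw [← h1, ← Finset.sum_coe_sort t]
    congr 1
    refine Finset.sum_congr rfl fun z _ => ?_
    simp

/-- On a bounded `C²` domain the divergence theorem holds with a boundary measure that is
comparable to surface measure, and some smooth vector field is uniformly transversal to the
boundary. The measure is the sum over a partition of unity of the surface measures of the charts.
It is in fact surface measure, but comparability avoids the area formula. -/
theorem exists_divergence_measure (hΩo : IsOpen Ω) (hΩb : Bornology.IsBounded Ω)
    (hΩ : HasC2Boundary Ω) :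
    IsFiniteMeasure (surfaceMeasure Ω) ∧
    (∃ σ : Measure (Rn n), IsFiniteMeasure σ ∧ (∃ b : ℝ≥0, σ ≤ b • surfaceMeasure Ω) ∧
      (∃ b : ℝ≥0, surfaceMeasure Ω ≤ b • σ) ∧
      ∀ F : Rn n → ℝ, ContDiff ℝ 1 F → ∀ w : Rn n,
        ∫ x in Ω, fderiv ℝ F x w = ∫ x, ⟪outerNormal Ω x, w⟫_ℝ * F x ∂σ) ∧
    ∃ N : Rn n → Rn n, ContDiff ℝ ∞ N ∧ ∃ c > 0, ∀ x ∈ frontier Ω,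
      c ≤ ⟪N x, outerNormal Ω x⟫_ℝ := by
  have hfc : IsCompact (frontier Ω) :=
    Metric.isCompact_of_isClosed_isBounded isClosed_frontier
      (hΩb.closure.subset frontier_subset_closure)
  have hΩ' : ∀ x : Rn n, ∃ (e : Rn n) (r : ℝ) (ψ : Rn n → ℝ), x ∈ frontier Ω →
    ‖e‖ = 1 ∧ 0 < r ∧ ContDiff ℝ 2 ψ ∧
    ∀ y ∈ Metric.ball x r, (y ∈ Ω ↔ ⟪y, e⟫_ℝ < ψ (y - ⟪y, e⟫_ℝ • e)) := by
    intro x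
    by_cases hx : x ∈ frontier Ω
    · obtain ⟨e, r, ψ, h⟩ := hΩ x hx
      exact ⟨e, r, ψ, fun _ => h⟩
    · exact ⟨0, 0, 0, fun h => absurd h hx⟩
  choose e r ψ hch using hΩ'
  obtain ⟨t, χ₀, χ, htf, hχ₀, hχ₀c, hχ₀s, hχ, hsum⟩ :=
    exists_partition_of_unity hΩo hΩb fun x hx => (hch x hx).2.1
  have he : ∀ z ∈ t, ‖e z‖ = 1 := fun z hz => (hch z (htf hz)).1
  have hψ : ∀ z ∈ t, ContDiff ℝ 1 (ψ z) := fun z hz => (hch z (htf hz)).2.2.1.of_le one_le_two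
  have hΩz := fun z (hz : z ∈ t) => (hch z (htf hz)).2.2.2
  have hχ1 : ∀ z ∈ t, ContDiff ℝ 1 (χ z) := fun z hz => (hχ z hz).1.of_le (by norm_cast)
  have hχc : ∀ z ∈ t, HasCompactSupport (χ z) := fun z hz =>
    Metric.isCompact_of_isClosed_isBounded (isClosed_tsupport _)
      (Metric.isBounded_ball.subset (hχ z hz).2.2)
  -- the interior member of the partition of unity vanishes on the boundary
  have hsumf : ∀ x ∈ frontier Ω, ∑ z ∈ t, χ z x = 1 := by
    intro x hx
    have h1 := hsum x (frontier_subset_closure hx)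
    have h2 : χ₀ x = 0 := by
      refine image_eq_zero_of_notMem_tsupport fun h => ?_
      rw [hΩo.frontier_eq] at hx
      exact hx.2 (hχ₀s h)
    rwa [h2, zero_add] at h1
  set σ : Measure (Rn n) := ∑ z ∈ t, graphMeasure (e z) (ψ z) (χ z) with hσ
  have hfin : ∀ z ∈ t, IsFiniteMeasure (graphMeasure (e z) (ψ z) (χ z)) := fun z hz =>
    isFiniteMeasure_graphMeasure (he z hz) (hψ z hz) (hχ1 z hz).continuous (hχc z hz)
  have hσfin : IsFiniteMeasure σ := by
    refine ⟨?_⟩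
    rw [hσ, Measure.finsetSum_apply]
    exact ENNReal.sum_lt_top.2 fun z hz => (hfin z hz).measure_univ_lt_top
  have hub : ∃ b : ℝ≥0, σ ≤ b • surfaceMeasure Ω := by
    have h1 : ∀ z : Rn n, ∃ b : ℝ≥0, z ∈ t →
        graphMeasure (e z) (ψ z) (χ z) ≤ b • surfaceMeasure Ω := by
      intro z
      by_cases hz : z ∈ t
      · obtain ⟨b, hb⟩ := graphMeasure_le (he z hz) (hψ z hz) (hχ1 z hz).continuous (hΩz z hz)
          (hχ z hz).2.2
        exact ⟨b, fun _ => hb⟩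
      · exact ⟨0, fun h => absurd h hz⟩
    choose b hb using h1
    refine ⟨∑ z ∈ t, b z, ?_⟩
    rw [Finset.sum_smul]
    exact Finset.sum_le_sum hb
  have hlb : ∃ b : ℝ≥0, surfaceMeasure Ω ≤ b • σ := by
    have h1 : ∀ z : Rn n, ∃ b : ℝ≥0, z ∈ t → ∀ A, MeasurableSet A →
        ∫⁻ x in A, ENNReal.ofReal (χ z x) ∂surfaceMeasure Ω ≤
          b * graphMeasure (e z) (ψ z) (χ z) A := by
      intro z
      by_cases hz : z ∈ t
      · obtain ⟨b, hb⟩ := setLIntegral_surfaceMeasure_le (he z hz) (hψ z hz)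
          (hχ1 z hz).continuous (hχ z hz).2.1 (hΩz z hz) (hχ z hz).2.2
        exact ⟨b, fun _ => hb⟩
      · exact ⟨0, fun h => absurd h hz⟩
    choose b hb using h1
    refine ⟨∑ z ∈ t, b z, Measure.le_iff.2 fun A hA => ?_⟩
    have hae : ∀ᵐ x ∂(surfaceMeasure Ω).restrict A,
        (1 : ℝ≥0∞) = ∑ z ∈ t, ENNReal.ofReal (χ z x) := by
      refine ae_restrict_of_ae ?_
      filter_upwards [ae_restrict_mem isClosed_frontier.measurableSet] with x hx
      rw [← ENNReal.ofReal_sum_of_nonneg fun z hz => (hχ z hz).2.1 x, hsumf x hx, ENNReal.ofReal_one]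
    calc surfaceMeasure Ω A = ∫⁻ x in A, 1 ∂surfaceMeasure Ω := by simp
      _ = ∫⁻ x in A, ∑ z ∈ t, ENNReal.ofReal (χ z x) ∂surfaceMeasure Ω := lintegral_congr_ae hae
      _ = ∑ z ∈ t, ∫⁻ x in A, ENNReal.ofReal (χ z x) ∂surfaceMeasure Ω :=
          lintegral_finsetSum' _ fun z hz =>
            (ENNReal.measurable_ofReal.comp (hχ1 z hz).continuous.measurable).aemeasurable
      _ ≤ ∑ z ∈ t, (b z : ℝ≥0∞) * σ A := by
          refine Finset.sum_le_sum fun z hz => (hb z hz A hA).trans ?_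
          refine mul_le_mul' le_rfl ?_
          rw [hσ, Measure.finsetSum_apply]
          exact Finset.single_le_sum (f := fun z => graphMeasure (e z) (ψ z) (χ z) A)
            (fun _ _ => zero_le) hz
      _ = ((∑ z ∈ t, b z) • σ) A := by
          rw [Measure.smul_apply, ENNReal.smul_def, smul_eq_mul, ← Finset.sum_mul,
            ENNReal.ofNNReal_finsetSum]
  have hSfin : IsFiniteMeasure (surfaceMeasure Ω) := by
    obtain ⟨b, hb⟩ := hlb
    exact isFiniteMeasure_of_le _ hb
  refine ⟨hSfin, ⟨σ, hσfin, hub, hlb, fun F hF w => ?_⟩, ?_⟩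
  · have hχ₀1 : ContDiff ℝ 1 χ₀ := hχ₀.of_le (by norm_cast)
    have hd : ∀ x ∈ Ω, fderiv ℝ F x w = fderiv ℝ (fun x => χ₀ x * F x) x w +
        ∑ z ∈ t, fderiv ℝ (fun x => χ z x * F x) x w := by
      intro x hx
      have h1 : F =ᶠ[𝓝 x] fun x => χ₀ x * F x + ∑ z ∈ t, χ z x * F x := by
        filter_upwards [hΩo.mem_nhds hx] with y hy
        rw [← Finset.sum_mul, ← add_mul, hsum y (subset_closure hy), one_mul]
      have d0 : DifferentiableAt ℝ (fun x => χ₀ x * F x) x :=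
        (hχ₀1.mul hF).differentiable one_ne_zero x
      have d1 : ∀ z ∈ t, DifferentiableAt ℝ (fun x => χ z x * F x) x := fun z hz =>
        ((hχ1 z hz).mul hF).differentiable one_ne_zero x
      rw [h1.fderiv_eq, fderiv_fun_add d0 (DifferentiableAt.fun_sum d1), fderiv_fun_sum d1]
      simp
    have hint : ∀ g : Rn n → ℝ, ContDiff ℝ 1 g → IntegrableOn (fun x => fderiv ℝ g x w) Ω := by
      intro g hg
      have hcont : Continuous (fun x => fderiv ℝ g x w) :=
        (hg.continuous_fderiv one_ne_zero).clm_apply continuous_const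
      exact (hcont.continuousOn.integrableOn_compact
        (Metric.isCompact_of_isClosed_isBounded isClosed_closure hΩb.closure)).mono_set subset_closure
    rw [setIntegral_congr_fun hΩo.measurableSet hd,
      integral_add (hint _ (hχ₀1.mul hF))
        (integrable_finsetSum _ fun z hz => hint _ ((hχ1 z hz).mul hF)),
      integral_finsetSum _ (fun z hz => hint _ ((hχ1 z hz).mul hF)),
      setIntegral_fderiv_eq_zero_of_tsupport_subset hΩo (hχ₀1.mul hF) (hχ₀c.mul_right)
        ((tsupport_mul_subset_left).trans hχ₀s), zero_add]
    have hmeas : AEStronglyMeasurable (fun x => ⟪outerNormal Ω x, w⟫_ℝ * F x) (surfaceMeasure Ω) := by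
      refine ContinuousOn.aestronglyMeasurable ?_ isClosed_frontier.measurableSet
      exact ((continuousOn_outerNormal hΩ).inner continuousOn_const).mul hF.continuous.continuousOn
    obtain ⟨B, hB⟩ := hfc.exists_bound_of_continuousOn
      (((continuousOn_outerNormal hΩ).inner (𝕜 := ℝ)
        (continuousOn_const (c := w))).mul hF.continuous.continuousOn)
    have hbd : ∀ᵐ x ∂surfaceMeasure Ω, ‖⟪outerNormal Ω x, w⟫_ℝ * F x‖ ≤ B := by
      filter_upwards [ae_restrict_mem isClosed_frontier.measurableSet] with x hx
      exact hB x hx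
    have hI : Integrable (fun x => ⟪outerNormal Ω x, w⟫_ℝ * F x) (surfaceMeasure Ω) :=
      Integrable.of_bound hmeas B hbd
    obtain ⟨b, hb⟩ := hub
    rw [hσ, integral_finsetSum_measure]
    · refine Finset.sum_congr rfl fun z hz => ?_
      exact setIntegral_fderiv_mul_eq_graphMeasure hΩo (he z hz) (hψ z hz) (hχ1 z hz)
        (hχ z hz).2.1 (hΩz z hz) (hχ z hz).2.2 hF w
    · intro z hz
      have h2 : graphMeasure (e z) (ψ z) (χ z) ≤ b • surfaceMeasure Ω := le_trans (by
        refine Measure.le_iff.2 fun A _ => ?_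
        rw [hσ, Measure.finsetSum_apply]
        exact Finset.single_le_sum (f := fun z => graphMeasure (e z) (ψ z) (χ z) A)
          (fun _ _ => zero_le) hz) hb
      exact (hI.smul_measure_nnreal (c := b)).mono_measure h2
  -- the transversal field is the average of the vertical directions of the charts
  · refine ⟨fun x => ∑ z ∈ t, χ z x • e z,
      ContDiff.sum fun z hz => (hχ z hz).1.smul contDiff_const, ?_⟩
    have hpos : ∀ x ∈ frontier Ω, 0 < ⟪∑ z ∈ t, χ z x • e z, outerNormal Ω x⟫_ℝ := by
      intro x hx
      rw [sum_inner]
      have hterm : ∀ z ∈ t, 0 < χ z x → 0 < ⟪χ z x • e z, outerNormal Ω x⟫_ℝ := by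
        intro z hz hpos
        have hxb : x ∈ Metric.ball z (r z) := (hχ z hz).2.2 (subset_tsupport _ hpos.ne')
        rw [outerNormal_eq_gradient_graphDefining (he z hz) (hψ z hz) (hΩz z hz) hxb hx,
          inner_smul_left, inner_smul_right, real_inner_comm,
          inner_gradient_graphDefining_self (he z hz) (hψ z hz)]
        have := one_le_norm_gradient_graphDefining (he z hz) (hψ z hz) x
        simp only [conj_trivial, mul_one]
        positivity
      refine Finset.sum_pos' (fun z hz => ?_) ?_
      · rcases ((hχ z hz).2.1 x).eq_or_lt with h | h
        · simp [← h]
        · exact (hterm z hz h).le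
      · by_contra! hcon
        have : ∑ z ∈ t, χ z x = 0 := Finset.sum_eq_zero fun z hz => by
          by_contra hne
          exact absurd (hterm z hz (lt_of_le_of_ne ((hχ z hz).2.1 x) (Ne.symm hne)))
            (not_lt.2 (hcon z hz))
        rw [hsumf x hx] at this
        exact one_ne_zero this
    have hcont : ContinuousOn (fun x => ⟪∑ z ∈ t, χ z x • e z, outerNormal Ω x⟫_ℝ)
        (frontier Ω) := by
      refine ContinuousOn.inner ?_ (continuousOn_outerNormal hΩ)
      exact continuousOn_finsetSum _ fun z hz =>
        ((hχ1 z hz).continuous.smul continuous_const).continuousOn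
    rcases (frontier Ω).eq_empty_or_nonempty with hemp | hne
    · exact ⟨1, one_pos, fun x hx => by simp [hemp] at hx⟩
    · obtain ⟨x₁, hx₁, hmin⟩ := hfc.exists_isMinOn hne hcont
      exact ⟨_, hpos x₁ hx₁, fun x hx => hmin hx⟩

end Global

/-! ### Partial derivatives and divergence identities -/

section Calculus

variable {n : ℕ}

/-- The classical partial derivative `∂_j u`. -/
def pderiv {F : Type*} [NormedAddCommGroup F] [NormedSpace ℝ F] (j : Fin n) (u : Rn n → F)
    (x : Rn n) : F := fderiv ℝ u x (stdVec j)

@[fun_prop]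
theorem ContDiff.pderiv {F : Type*} [NormedAddCommGroup F] [NormedSpace ℝ F] {u : Rn n → F}
    (hu : ContDiff ℝ ∞ u) (j : Fin n) : ContDiff ℝ ∞ (pderiv j u) :=
  (hu.fderiv_right (m := ∞) (by norm_cast)).clm_apply contDiff_const

theorem ContDiff.differentiableAt_top {F : Type*} [NormedAddCommGroup F] [NormedSpace ℝ F]
    {u : Rn n → F} (hu : ContDiff ℝ ∞ u) (x : Rn n) : DifferentiableAt ℝ u x :=
  hu.differentiable (by norm_num) x

theorem pderiv_mul {𝔸 : Type*} [NormedCommRing 𝔸] [NormedAlgebra ℝ 𝔸] {u v : Rn n → 𝔸}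
    (hu : ContDiff ℝ ∞ u) (hv : ContDiff ℝ ∞ v) (j : Fin n) (x : Rn n) :
    pderiv j (fun x => u x * v x) x = u x * pderiv j v x + v x * pderiv j u x := by
  simp [pderiv, fderiv_fun_mul (hu.differentiableAt_top x) (hv.differentiableAt_top x)]

theorem pderiv_add {F : Type*} [NormedAddCommGroup F] [NormedSpace ℝ F] {u v : Rn n → F}
    (hu : ContDiff ℝ ∞ u) (hv : ContDiff ℝ ∞ v) (j : Fin n) (x : Rn n) :
    pderiv j (fun x => u x + v x) x = pderiv j u x + pderiv j v x := by
  simp [pderiv, fderiv_fun_add (hu.differentiableAt_top x) (hv.differentiableAt_top x)]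

theorem pderiv_const_mul {𝔸 : Type*} [NormedCommRing 𝔸] [NormedAlgebra ℝ 𝔸] {u : Rn n → 𝔸}
    (hu : ContDiff ℝ ∞ u) (c : 𝔸) (j : Fin n) (x : Rn n) :
    pderiv j (fun x => c * u x) x = c * pderiv j u x := by
  simp [pderiv, fderiv_const_mul (hu.differentiableAt_top x)]

theorem pderiv_sum {F : Type*} [NormedAddCommGroup F] [NormedSpace ℝ F] {ι : Type*} {s : Finset ι}
    {u : ι → Rn n → F} (hu : ∀ i ∈ s, ContDiff ℝ ∞ (u i)) (j : Fin n) (x : Rn n) :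
    pderiv j (fun x => ∑ i ∈ s, u i x) x = ∑ i ∈ s, pderiv j (u i) x := by
  simp [pderiv, fderiv_fun_sum fun i hi => (hu i hi).differentiableAt_top x]

theorem pderiv_pderiv_eq {F : Type*} [NormedAddCommGroup F] [NormedSpace ℝ F] {u : Rn n → F}
    (hu : ContDiff ℝ ∞ u) (j k : Fin n) (x : Rn n) :
    pderiv j (pderiv k u) x = fderiv ℝ (fderiv ℝ u) x (stdVec j) (stdVec k) := by
  have hd : DifferentiableAt ℝ (fderiv ℝ u) x :=
    (hu.fderiv_right (m := ∞) (by norm_cast)).differentiable (by norm_num) x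
  unfold pderiv
  rw [fderiv_clm_apply hd (differentiableAt_const _)]
  simp

theorem pderiv_comm {F : Type*} [NormedAddCommGroup F] [NormedSpace ℝ F] {u : Rn n → F}
    (hu : ContDiff ℝ ∞ u) (j k : Fin n) (x : Rn n) :
    pderiv j (pderiv k u) x = pderiv k (pderiv j u) x := by
  rw [pderiv_pderiv_eq hu, pderiv_pderiv_eq hu]
  exact (hu.contDiffAt.isSymmSndFDerivAt (by simp; norm_cast)).eq _ _

theorem gradient_apply (f : Rn n → ℝ) (x : Rn n) (j : Fin n) : gradient f x j = pderiv j f x := by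
  have h : ⟪gradient f x, stdVec j⟫_ℝ = pderiv j f x := by simp [gradient, pderiv]
  rw [← h, stdVec, EuclideanSpace.inner_single_right]
  simp

theorem inner_eq_sum (v w : Rn n) : ⟪v, w⟫_ℝ = ∑ j, v j * w j := by
  rw [PiLp.inner_apply]
  exact Finset.sum_congr rfl fun j _ => by simp [mul_comm]

theorem eq_sum_stdVec (v : Rn n) : v = ∑ j, v j • stdVec j := by
  ext k
  simp [stdVec, Pi.single_apply]

theorem fderiv_eq_sum_pderiv {F : Type*} [NormedAddCommGroup F] [NormedSpace ℝ F] (u : Rn n → F)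
    (x w : Rn n) : fderiv ℝ u x w = ∑ j, w j • pderiv j u x := by
  conv_lhs => rw [eq_sum_stdVec w]
  simp [pderiv]

/-- The pairing `∇f · ∇u`. -/
def gradDot (f u : Rn n → ℝ) (x : Rn n) : ℝ := ∑ j, pderiv j f x * pderiv j u x

/-- The Laplacian `∑ ∂_j ∂_j u`. -/
def lapl {F : Type*} [NormedAddCommGroup F] [NormedSpace ℝ F] (u : Rn n → F) (x : Rn n) : F :=
  ∑ j, pderiv j (pderiv j u) x

/-- The Hessian quadratic form `f''(∇u, ∇u)`. -/
def hessGrad (f u : Rn n → ℝ) (x : Rn n) : ℝ :=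
  ∑ j, ∑ k, pderiv j (pderiv k f) x * pderiv j u x * pderiv k u x

theorem gradDot_eq_inner (f u : Rn n → ℝ) (x : Rn n) :
    gradDot f u x = ⟪gradient f x, gradient u x⟫_ℝ := by
  rw [gradDot, inner_eq_sum]
  simp_rw [gradient_apply]

theorem gradDot_self (f : Rn n → ℝ) (x : Rn n) : gradDot f f x = ‖gradient f x‖ ^ 2 := by
  rw [gradDot_eq_inner, real_inner_self_eq_norm_sq]

theorem abs_gradDot_le (f u : Rn n → ℝ) (x : Rn n) :
    |gradDot f u x| ≤ ‖gradient f x‖ * ‖gradient u x‖ := by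
  rw [gradDot_eq_inner]
  exact abs_real_inner_le_norm _ _

@[fun_prop]
theorem ContDiff.gradDot {f u : Rn n → ℝ} (hf : ContDiff ℝ ∞ f) (hu : ContDiff ℝ ∞ u) :
    ContDiff ℝ ∞ (gradDot f u) :=
  ContDiff.sum fun j _ => (hf.pderiv j).mul (hu.pderiv j)

@[fun_prop]
theorem ContDiff.lapl {F : Type*} [NormedAddCommGroup F] [NormedSpace ℝ F] {u : Rn n → F}
    (hu : ContDiff ℝ ∞ u) : ContDiff ℝ ∞ (lapl u) :=
  ContDiff.sum fun j _ => (hu.pderiv j).pderiv j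

theorem pderiv_gradDot {f u : Rn n → ℝ} (hf : ContDiff ℝ ∞ f) (hu : ContDiff ℝ ∞ u) (j : Fin n)
    (x : Rn n) : pderiv j (gradDot f u) x =
      ∑ k, (pderiv k f x * pderiv j (pderiv k u) x + pderiv k u x * pderiv j (pderiv k f) x) := by
  have h : gradDot f u = fun x => ∑ k, pderiv k f x * pderiv k u x := rfl
  rw [h, pderiv_sum (fun k _ => (hf.pderiv k).mul (hu.pderiv k))]
  exact Finset.sum_congr rfl fun k _ => pderiv_mul (hf.pderiv k) (hu.pderiv k) j x

theorem div_grad_mul {c u : Rn n → ℝ} (hc : ContDiff ℝ ∞ c) (hu : ContDiff ℝ ∞ u) (x : Rn n) :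
    ∑ j, pderiv j (fun x => pderiv j u x * c x) x = c x * lapl u x + gradDot c u x := by
  simp_rw [fun j => pderiv_mul (hu.pderiv j) hc j x]
  rw [Finset.sum_add_distrib, lapl, gradDot, Finset.mul_sum, add_comm]
  congr 1
  exact Finset.sum_congr rfl fun j _ => mul_comm _ _

/-- The mixed term `∑ ∂_j u ∂_k f ∂_j∂_k u`, which occurs in the divergence of both
`(∇f · ∇u) ∇u` and `|∇u|² ∇f`. -/
def mixedHess (f u : Rn n → ℝ) (x : Rn n) : ℝ :=
  ∑ j, ∑ k, pderiv j u x * pderiv k f x * pderiv j (pderiv k u) x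

theorem gradDot_gradDot_left {f u : Rn n → ℝ} (hf : ContDiff ℝ ∞ f) (hu : ContDiff ℝ ∞ u)
    (x : Rn n) : gradDot (gradDot f u) u x = hessGrad f u x + mixedHess f u x := by
  rw [gradDot, hessGrad, mixedHess, ← Finset.sum_add_distrib]
  refine Finset.sum_congr rfl fun j _ => ?_
  rw [pderiv_gradDot hf hu, Finset.sum_mul, ← Finset.sum_add_distrib]
  exact Finset.sum_congr rfl fun k _ => by ring

theorem gradDot_gradDot_self {f u : Rn n → ℝ} (hu : ContDiff ℝ ∞ u)
    (x : Rn n) : gradDot (gradDot u u) f x = 2 * mixedHess f u x := by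
  rw [gradDot, mixedHess, Finset.sum_comm, Finset.mul_sum]
  refine Finset.sum_congr rfl fun j _ => ?_
  rw [pderiv_gradDot hu hu, Finset.sum_mul, Finset.mul_sum]
  exact Finset.sum_congr rfl fun k _ => by rw [pderiv_comm hu k j]; ring

theorem gradDot_gradDot_hess {f : Rn n → ℝ} (hf : ContDiff ℝ ∞ f) (x : Rn n) :
    gradDot (gradDot f f) f x = 2 * hessGrad f f x := by
  rw [gradDot_gradDot_self hf, mixedHess, hessGrad]
  congr 1
  exact Finset.sum_congr rfl fun j _ => Finset.sum_congr rfl fun k _ => by ring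

theorem gradDot_mul_left {a b u : Rn n → ℝ} (ha : ContDiff ℝ ∞ a) (hb : ContDiff ℝ ∞ b) (x : Rn n) :
    gradDot (fun x => a x * b x) u x = a x * gradDot b u x + b x * gradDot a u x := by
  simp_rw [gradDot, fun j => pderiv_mul ha hb j x, Finset.mul_sum, ← Finset.sum_add_distrib]
  exact Finset.sum_congr rfl fun j _ => by ring

theorem gradDot_comm (f u : Rn n → ℝ) (x : Rn n) : gradDot f u x = gradDot u f x :=
  Finset.sum_congr rfl fun _ _ => mul_comm _ _

/-- The flux in the pointwise Carleman inequality. Write `e^{f/h}(-h²Δ)e^{-f/h}` as `A + S` with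
`A = -h²Δ - |∇f|²` and `S = 2h ∇f · ∇ + h Δf`. The terms that do not involve `m` and `d` have
divergence `2 (A u) (S u)` up to terms without second derivatives of `u`. The remaining terms are
multiples of `u ∇u`; the function `m` and the number `d` are free multipliers. -/
def carlemanFlux (h : ℝ) (f m : Rn n → ℝ) (d : ℝ) (u : Rn n → ℝ) (j : Fin n) (x : Rn n) : ℝ :=
  -4 * h ^ 3 * (pderiv j u x * gradDot f u x) + 2 * h ^ 3 * (pderiv j f x * gradDot u u x)
    - 2 * h ^ 3 * (pderiv j u x * (lapl f x * u x))
    - 2 * h * (pderiv j f x * (gradDot f f x * (u x * u x)))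
    + 4 * h ^ 3 * (pderiv j u x * (m x * u x)) - d * (pderiv j u x * u x)

theorem ContDiff.carlemanFlux {h d : ℝ} {f m u : Rn n → ℝ} (hf : ContDiff ℝ ∞ f)
    (hm : ContDiff ℝ ∞ m) (hu : ContDiff ℝ ∞ u) (j : Fin n) :
    ContDiff ℝ ∞ (carlemanFlux h f m d u j) := by
  unfold _root_.carlemanFlux
  fun_prop

/-- The operator `e^{f/h}(-h²Δ)e^{-f/h}` on real functions, written out: the bracketed summands are
its formally self-adjoint and antisymmetric parts. -/
def conjOp (h : ℝ) (f u : Rn n → ℝ) (x : Rn n) : ℝ :=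
  (-h ^ 2 * lapl u x - gradDot f f x * u x) + (2 * h * gradDot f u x + h * lapl f x * u x)

/-- The divergence of the flux. The two occurrences of `mixedHess f u` cancel each other, so second
derivatives of `u` enter only through `Δu`. -/
theorem div_carlemanFlux {h d : ℝ} {f m u : Rn n → ℝ} (hf : ContDiff ℝ ∞ f)
    (hm : ContDiff ℝ ∞ m) (hu : ContDiff ℝ ∞ u) (x : Rn n) :
    ∑ j, pderiv j (carlemanFlux h f m d u j) x =
      -4 * h ^ 3 * (gradDot f u x * lapl u x + (hessGrad f u x + mixedHess f u x))
      + 2 * h ^ 3 * (gradDot u u x * lapl f x + 2 * mixedHess f u x)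
      - 2 * h ^ 3 * (lapl f x * u x * lapl u x
          + (lapl f x * gradDot u u x + u x * gradDot (lapl f) u x))
      - 2 * h * (gradDot f f x * (u x * u x) * lapl f x +
          (gradDot f f x * (2 * (u x * gradDot f u x)) + u x * u x * (2 * hessGrad f f x)))
      + 4 * h ^ 3 * (m x * u x * lapl u x + (m x * gradDot u u x + u x * gradDot m u x))
      - d * (u x * lapl u x + gradDot u u x) := by
  have hff : ContDiff ℝ ∞ (gradDot f f) := by fun_prop
  have hl : ContDiff ℝ ∞ (lapl f) := by fun_prop
  have e1 := div_grad_mul (hf.gradDot hu) hu x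
  have e2 := div_grad_mul (hu.gradDot hu) hf x
  have e3 := div_grad_mul (hl.mul hu) hu x
  have e4 := div_grad_mul (hff.mul (hu.mul hu)) hf x
  have e5 := div_grad_mul (hm.mul hu) hu x
  have e6 := div_grad_mul hu hu x
  rw [gradDot_gradDot_left hf hu] at e1
  rw [gradDot_gradDot_self hu] at e2
  rw [gradDot_mul_left hl hu] at e3
  rw [gradDot_mul_left hff (hu.mul hu), gradDot_mul_left hu hu, gradDot_gradDot_hess hf,
    gradDot_comm u f] at e4
  rw [gradDot_mul_left hm hu] at e5
  have hsplit : ∀ j, pderiv j (carlemanFlux h f m d u j) x =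
      -4 * h ^ 3 * pderiv j (fun x => pderiv j u x * gradDot f u x) x
      + 2 * h ^ 3 * pderiv j (fun x => pderiv j f x * gradDot u u x) x
      + -2 * h ^ 3 * pderiv j (fun x => pderiv j u x * (lapl f x * u x)) x
      + -2 * h * pderiv j (fun x => pderiv j f x * (gradDot f f x * (u x * u x))) x
      + 4 * h ^ 3 * pderiv j (fun x => pderiv j u x * (m x * u x)) x
      + -d * pderiv j (fun x => pderiv j u x * u x) x := by
    intro j
    have h0 : carlemanFlux h f m d u j = fun x => -4 * h ^ 3 * (pderiv j u x * gradDot f u x)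
        + 2 * h ^ 3 * (pderiv j f x * gradDot u u x)
        + -2 * h ^ 3 * (pderiv j u x * (lapl f x * u x))
        + -2 * h * (pderiv j f x * (gradDot f f x * (u x * u x)))
        + 4 * h ^ 3 * (pderiv j u x * (m x * u x)) + -d * (pderiv j u x * u x) := by
      ext x
      simp only [carlemanFlux]
      ring
    rw [h0]
    rw [pderiv_add (by fun_prop) (by fun_prop), pderiv_add (by fun_prop) (by fun_prop),
      pderiv_add (by fun_prop) (by fun_prop), pderiv_add (by fun_prop) (by fun_prop),
      pderiv_add (by fun_prop) (by fun_prop), pderiv_const_mul (by fun_prop),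
      pderiv_const_mul (by fun_prop), pderiv_const_mul (by fun_prop),
      pderiv_const_mul (by fun_prop), pderiv_const_mul (by fun_prop),
      pderiv_const_mul (by fun_prop)]
  simp_rw [hsplit, Finset.sum_add_distrib, ← Finset.mul_sum]
  rw [e1, e2, e3, e4, e5, e6]
  ring

end Calculus

/-! ### The pointwise Carleman inequality -/

section Pointwise

variable {n : ℕ}

/-- Cross terms between `q` and a linear expression in `U` of size `B q` are absorbed by squares. -/
theorem abs_mul_mul_le_of_abs_le {B h U M q : ℝ} (hh : 0 < h) (hB : 0 ≤ B) (hM : |M| ≤ B * q) :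
    |2 * h ^ 3 * (U * M)| ≤ B * h ^ 2 * (U ^ 2 + (h * q) ^ 2) := by
  have h1 : |U * M| ≤ |U| * (B * q) := by
    rw [abs_mul]
    gcongr
  have h2 : 2 * (|U| * (h * q)) ≤ U ^ 2 + (h * q) ^ 2 := by
    have := two_mul_le_add_sq |U| (h * q)
    rw [sq_abs] at this
    linarith
  rw [abs_mul, abs_of_pos (by positivity : 0 < 2 * h ^ 3)]
  calc 2 * h ^ 3 * |U * M| ≤ 2 * h ^ 3 * (|U| * (B * q)) := by gcongr
    _ = B * h ^ 2 * (2 * (|U| * (h * q))) := by ring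
    _ ≤ _ := by gcongr

/-- The remainder of the Hessian term contains a factor `∇f · ∇u`, which is controlled by the
first-order part `S = 2h ∇f · ∇u + h Δf u` of the operator. -/
theorem hessian_remainder_ge {B h g l U D q ρ : ℝ} (hB : 0 ≤ B) (hh : 0 < h) (hg : 0 < g)
    (hl : |l| ≤ B) (hq : 0 ≤ q) (hρ : |ρ| ≤ B * |D| * q) :
    -((2 * h * (g * D) + h * l * U) ^ 2 / 2 + 3 * B ^ 2 * h ^ 2 * (h * q) ^ 2
      + B ^ 2 * h ^ 2 * U ^ 2) ≤ 4 * h ^ 3 * g * ρ := by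
  obtain ⟨S, hS⟩ : ∃ S, S = 2 * h * (g * D) + h * l * U := ⟨_, rfl⟩
  obtain ⟨X, hX⟩ : ∃ X, X = h * q := ⟨_, rfl⟩
  have hX0 : 0 ≤ X := by rw [hX]; positivity
  rw [← hS, ← hX]
  have h1 : 2 * h * (g * |D|) ≤ |S| + h * B * |U| := by
    have : 2 * h * (g * |D|) = |S - h * l * U| := by
      rw [hS, add_sub_cancel_right, abs_mul, abs_mul g, abs_of_pos hg,
        abs_of_pos (by positivity : 0 < 2 * h)]
    rw [this]
    refine (abs_sub _ _).trans ?_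
    rw [abs_mul, abs_mul, abs_of_pos hh]
    gcongr
  have h2 : |4 * h ^ 3 * g * ρ| ≤ 2 * h * X * B * (|S| + h * B * |U|) := by
    rw [abs_mul, abs_of_pos (by positivity : 0 < 4 * h ^ 3 * g)]
    calc 4 * h ^ 3 * g * |ρ| ≤ 4 * h ^ 3 * g * (B * |D| * q) := by gcongr
      _ = 2 * h * X * B * (2 * h * (g * |D|)) := by rw [hX]; ring
      _ ≤ _ := by gcongr
  have h3 := sq_nonneg (|S| - 2 * h * X * B)
  have h4 := sq_nonneg (h * B * (X - |U|))
  have h5 : |S| ^ 2 = S ^ 2 := sq_abs S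
  have h6 : |U| ^ 2 = U ^ 2 := sq_abs U
  have h7 : (|S| - 2 * h * X * B) ^ 2 =
      S ^ 2 - 4 * (h * X * B * |S|) + 4 * (B ^ 2 * h ^ 2 * X ^ 2) := by
    rw [← h5]; ring
  have h8 : (h * B * (X - |U|)) ^ 2 = B ^ 2 * h ^ 2 * X ^ 2 - 2 * (B ^ 2 * h ^ 2 * X * |U|)
      + B ^ 2 * h ^ 2 * U ^ 2 := by
    rw [← h6]; ring
  have h9 : 2 * h * X * B * (|S| + h * B * |U|) =
      2 * (h * X * B * |S|) + 2 * (B ^ 2 * h ^ 2 * X * |U|) := by ring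
  have h10 := neg_abs_le (4 * h ^ 3 * g * ρ)
  rw [h7] at h3
  rw [h8] at h4
  linarith

/-- The pointwise Carleman inequality as an inequality between real numbers. With `f` the
convexified weight `φ + (θ/2) φ²` and `m` the multiplier of the flux, the variables stand for
`g = 1 + θ φ`, `s = |∇φ|²`, `l = Δf`, `U = u`, `L = Δu`, `D = ∇φ · ∇u`, `q = |∇u|`,
`Q = φ''(∇u, ∇u)`, `T = mixedHess f u`, `R = ∇(Δf) · ∇u` and `M = ∇m · ∇u`; the number `lam` is the
value of the Hessian of `φ` on unit vectors orthogonal to `∇φ`.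

The choice `m = g lam` turns `Q` into `Q - lam q²`, which is bounded by a multiple of `|D| q`, and
trades the part `-g³ lam s U²` of `f''(∇f, ∇f) U²` for a multiple of `A U`. Convexification leaves the positive term
`4 κ g² s² U²` with `κ = h²/ε`, and the multiplier `δ κ` trades a part of it for `δ κ h² q²`. All
other terms are of order `h² (U² + h² q²)`, which is at most `ε` times what has been gained. -/
theorem carleman_real_inequality {B s₀ δ ε h θ g s lam m l U L D q Q T R M : ℝ}
    (hB : 1 ≤ B) (hh : 0 < h) (hθ : 0 < θ) (hεθ : h = ε * θ) (hhθ : h * θ ≤ 1)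
    (hs : s₀ ≤ g ^ 2 * s ^ 2) (hsB : g ^ 2 * s ≤ B) (hg : 0 < g)
    (hm : m = g * lam) (hmB : |m| ≤ B) (hl : |l| ≤ B) (hq : 0 ≤ q)
    (hQ : |Q - lam * q ^ 2| ≤ B * |D| * q) (hR : |R| ≤ B * q) (hM : |M| ≤ B * q)
    (hδ0 : 0 < δ) (hδ1 : δ ≤ 1) (hδ : δ * (B + 1) ≤ 2 * s₀)
    (hε1 : 12 * B ^ 2 * ε ≤ s₀) (hε2 : 12 * B ^ 2 * ε ≤ δ / 2) :
    -4 * h ^ 3 * (g * D * L + ((g * Q + θ * D ^ 2) + T))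
      + 2 * h ^ 3 * (q ^ 2 * l + 2 * T)
      - 2 * h ^ 3 * (l * U * L + (l * q ^ 2 + U * R))
      - 2 * h * (g ^ 2 * s * (U * U) * l + (g ^ 2 * s * (2 * (U * (g * D)))
          + U * U * (2 * (-g ^ 3 * lam * s + θ * g ^ 2 * s ^ 2))))
      + 4 * h ^ 3 * (m * U * L + (m * q ^ 2 + U * M))
      - δ * (h * θ) * h ^ 2 * (U * L + q ^ 2)
      + min s₀ (δ / 2) * (h * θ) * (U ^ 2 + h ^ 2 * q ^ 2)
    ≤ ((-h ^ 2 * L - g ^ 2 * s * U) + (2 * h * (g * D) + h * l * U)) ^ 2 := by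
  set A := -h ^ 2 * L - g ^ 2 * s * U with hA
  set S := 2 * h * (g * D) + h * l * U with hS
  set X := h * q with hX
  set κ := h * θ with hκ
  have hκ0 : 0 < κ := by positivity
  have hX0 : 0 ≤ X := by positivity
  have hεκ : h ^ 2 = ε * κ := by rw [hκ, sq]; nth_rewrite 1 [hεθ]; ring
  -- expansion of the square, with the divergence terms removed
  have key : (A + S) ^ 2 - (-4 * h ^ 3 * (g * D * L + ((g * Q + θ * D ^ 2) + T))
      + 2 * h ^ 3 * (q ^ 2 * l + 2 * T)
      - 2 * h ^ 3 * (l * U * L + (l * q ^ 2 + U * R))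
      - 2 * h * (g ^ 2 * s * (U * U) * l + (g ^ 2 * s * (2 * (U * (g * D)))
          + U * U * (2 * (-g ^ 3 * lam * s + θ * g ^ 2 * s ^ 2))))
      + 4 * h ^ 3 * (m * U * L + (m * q ^ 2 + U * M))
      - δ * κ * h ^ 2 * (U * L + q ^ 2)) =
      A ^ 2 + S ^ 2 + 4 * h * m * A * U - 4 * h ^ 3 * (U * M) + 4 * h ^ 3 * g * (Q - lam * q ^ 2)
      + 4 * h ^ 2 * κ * D ^ 2 + 2 * h ^ 3 * (U * R) + 4 * κ * (g ^ 2 * s ^ 2) * U ^ 2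
      + δ * κ * (X ^ 2 - A * U - g ^ 2 * s * U ^ 2) := by
    rw [hA, hS, hX, hκ, hm]
    ring
  -- half of `A²` absorbs the product with `m`, the other half (in `e5`) the product with `δ κ`
  have e1 : -(A ^ 2 / 2 + 8 * B ^ 2 * h ^ 2 * U ^ 2) ≤ 4 * h * m * A * U := by
    have h1 : m ^ 2 ≤ B ^ 2 := sq_le_sq' (by linarith [abs_le.1 hmB]) (abs_le.1 hmB).2
    have h2 : m ^ 2 * (h ^ 2 * U ^ 2) ≤ B ^ 2 * (h ^ 2 * U ^ 2) := by gcongr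
    have h3 := sq_nonneg (A + 4 * h * m * U)
    have h4 : (A + 4 * h * m * U) ^ 2 = A ^ 2 + 2 * (4 * h * m * A * U) +
      16 * (m ^ 2 * (h ^ 2 * U ^ 2)) := by ring
    linarith
  have e2 := hessian_remainder_ge (U := U) (by linarith : 0 ≤ B) hh hg hl hq hQ
  have e3 := (abs_le.1 (abs_mul_mul_le_of_abs_le (U := U) hh (by linarith) hM)).2
  have e4 := (abs_le.1 (abs_mul_mul_le_of_abs_le (U := U) hh (by linarith) hR)).1
  rw [← hS, ← hX] at e2
  rw [← hX] at e3 e4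
  clear_value A S X κ
  have e5 : -(δ * κ * U ^ 2) ≤ A ^ 2 / 2 - δ * κ * (A * U) := by
    have h1 : (δ * κ) ^ 2 ≤ δ * κ := by
      have h2 : δ * κ ≤ 1 := mul_le_one₀ hδ1 hκ0.le hhθ
      have h3 : 0 ≤ δ * κ := by positivity
      rw [sq]
      exact mul_le_of_le_one_left h3 h2
    have h2 : (δ * κ) ^ 2 * U ^ 2 ≤ δ * κ * U ^ 2 := by gcongr
    have h3 := sq_nonneg (A - δ * κ * U)
    have h4 : (A - δ * κ * U) ^ 2 = A ^ 2 - 2 * (δ * κ * (A * U)) + (δ * κ) ^ 2 * U ^ 2 := by ring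
    have h5 : 0 ≤ δ * κ * U ^ 2 := by positivity
    linarith
  have e6 : 4 * κ * s₀ * U ^ 2 ≤ 4 * κ * (g ^ 2 * s ^ 2) * U ^ 2 := by gcongr
  have e7 : δ * κ * (g ^ 2 * s * U ^ 2) ≤ δ * κ * (B * U ^ 2) := by gcongr
  have e8 : 0 ≤ 4 * h ^ 2 * κ * D ^ 2 := by positivity
  have hB2 : B ≤ B ^ 2 := le_self_pow₀ hB two_ne_zero
  have e9 : B * h ^ 2 * (U ^ 2 + X ^ 2) ≤ B ^ 2 * h ^ 2 * (U ^ 2 + X ^ 2) := by gcongr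
  -- the errors of order `h² = ε κ` are absorbed since `ε` is small
  have e10 : 12 * B ^ 2 * h ^ 2 * U ^ 2 ≤ s₀ * κ * U ^ 2 := by
    rw [hεκ]
    calc 12 * B ^ 2 * (ε * κ) * U ^ 2 = (12 * B ^ 2 * ε) * κ * U ^ 2 := by ring
      _ ≤ _ := by gcongr
  have e11 : 12 * B ^ 2 * h ^ 2 * X ^ 2 ≤ δ / 2 * κ * X ^ 2 := by
    rw [hεκ]
    calc 12 * B ^ 2 * (ε * κ) * X ^ 2 = (12 * B ^ 2 * ε) * κ * X ^ 2 := by ring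
      _ ≤ _ := by gcongr
  have e12 : δ * (B + 1) * (κ * U ^ 2) ≤ 2 * s₀ * (κ * U ^ 2) := by gcongr
  have e13 : min s₀ (δ / 2) * κ * (U ^ 2 + h ^ 2 * q ^ 2) ≤
      s₀ * κ * U ^ 2 + δ / 2 * κ * X ^ 2 := by
    have h1 : min s₀ (δ / 2) * (κ * U ^ 2) ≤ s₀ * (κ * U ^ 2) := by
      gcongr
      exact min_le_left _ _
    have h2 : min s₀ (δ / 2) * (κ * X ^ 2) ≤ δ / 2 * (κ * X ^ 2) := by
      gcongr
      exact min_le_right _ _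
    rw [hX] at h2 ⊢
    linarith
  have e14 : 0 ≤ B ^ 2 * h ^ 2 * X ^ 2 := by positivity
  have e15 := sq_nonneg S
  linarith

/-- The convexified weight `φ + (θ / 2) φ²`, with `θ = h / ε`. -/
def convexWeight (φ : Rn n → ℝ) (θ : ℝ) (x : Rn n) : ℝ := φ x + θ / 2 * (φ x * φ x)

theorem ContDiff.convexWeight {φ : Rn n → ℝ} (hφ : ContDiff ℝ ∞ φ) (θ : ℝ) :
    ContDiff ℝ ∞ (convexWeight φ θ) := by
  unfold _root_.convexWeight
  fun_prop

variable {φ : Rn n → ℝ}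

theorem pderiv_convexWeight (hφ : ContDiff ℝ ∞ φ) (θ : ℝ) (j : Fin n) :
    pderiv j (convexWeight φ θ) = fun x => (1 + θ * φ x) * pderiv j φ x := by
  ext x
  unfold convexWeight
  rw [pderiv_add hφ (by fun_prop), pderiv_const_mul (by fun_prop), pderiv_mul hφ hφ]
  ring

theorem pderiv_pderiv_convexWeight (hφ : ContDiff ℝ ∞ φ) (θ : ℝ) (j k : Fin n) (x : Rn n) :
    pderiv j (pderiv k (convexWeight φ θ)) x =
      (1 + θ * φ x) * pderiv j (pderiv k φ) x + θ * (pderiv j φ x * pderiv k φ x) := by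
  rw [pderiv_convexWeight hφ, pderiv_mul (by fun_prop) (by fun_prop),
    pderiv_add contDiff_const (by fun_prop), pderiv_const_mul hφ]
  have : pderiv j (fun _ : Rn n => (1 : ℝ)) x = 0 := by simp [pderiv]
  rw [this]
  ring

theorem gradDot_convexWeight (hφ : ContDiff ℝ ∞ φ) (θ : ℝ) (u : Rn n → ℝ) (x : Rn n) :
    gradDot (convexWeight φ θ) u x = (1 + θ * φ x) * gradDot φ u x := by
  simp_rw [gradDot, pderiv_convexWeight hφ, Finset.mul_sum, mul_assoc]

theorem gradDot_convexWeight_self (hφ : ContDiff ℝ ∞ φ) (θ : ℝ) (x : Rn n) :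
    gradDot (convexWeight φ θ) (convexWeight φ θ) x = (1 + θ * φ x) ^ 2 * gradDot φ φ x := by
  rw [gradDot_convexWeight hφ, gradDot_comm, gradDot_convexWeight hφ]
  ring

theorem hessGrad_convexWeight (hφ : ContDiff ℝ ∞ φ) (θ : ℝ) (u : Rn n → ℝ) (x : Rn n) :
    hessGrad (convexWeight φ θ) u x =
      (1 + θ * φ x) * hessGrad φ u x + θ * gradDot φ u x ^ 2 := by
  rw [sq, gradDot, Finset.sum_mul_sum, hessGrad, hessGrad, Finset.mul_sum, Finset.mul_sum,
    ← Finset.sum_add_distrib]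
  refine Finset.sum_congr rfl fun j _ => ?_
  rw [Finset.mul_sum, Finset.mul_sum, ← Finset.sum_add_distrib]
  refine Finset.sum_congr rfl fun k _ => ?_
  rw [pderiv_pderiv_convexWeight hφ]
  ring

theorem hessGrad_convexWeight_self (hφ : ContDiff ℝ ∞ φ) (θ : ℝ) (x : Rn n) :
    hessGrad (convexWeight φ θ) (convexWeight φ θ) x =
      (1 + θ * φ x) ^ 3 * hessGrad φ φ x + θ * (1 + θ * φ x) ^ 2 * gradDot φ φ x ^ 2 := by
  rw [hessGrad_convexWeight hφ, gradDot_comm, gradDot_convexWeight hφ]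
  have : hessGrad φ (convexWeight φ θ) x = (1 + θ * φ x) ^ 2 * hessGrad φ φ x := by
    simp_rw [hessGrad, pderiv_convexWeight hφ, Finset.mul_sum]
    exact Finset.sum_congr rfl fun j _ => Finset.sum_congr rfl fun k _ => by ring
  rw [this]
  ring

theorem lapl_convexWeight (hφ : ContDiff ℝ ∞ φ) (θ : ℝ) :
    lapl (convexWeight φ θ) =
      fun x => lapl φ x + θ * (φ x * lapl φ x + gradDot φ φ x) := by
  ext x
  simp_rw [lapl, pderiv_pderiv_convexWeight hφ, gradDot, Finset.sum_add_distrib,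
    ← Finset.mul_sum]
  ring

theorem gradDot_lapl_convexWeight (hφ : ContDiff ℝ ∞ φ) (θ : ℝ) (u : Rn n → ℝ) (x : Rn n) :
    gradDot (lapl (convexWeight φ θ)) u x = gradDot (lapl φ) u x +
      θ * gradDot (fun x => φ x * lapl φ x + gradDot φ φ x) u x := by
  rw [lapl_convexWeight hφ]
  simp_rw [gradDot, Finset.mul_sum, ← Finset.sum_add_distrib]
  refine Finset.sum_congr rfl fun j _ => ?_
  have h1 : ContDiff ℝ ∞ (fun x => φ x * lapl φ x + gradDot φ φ x) := by fun_prop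
  have h2 := pderiv_add (hφ.lapl) (contDiff_const (c := θ) |>.mul h1) j x
  have h3 := pderiv_const_mul h1 θ j x
  simp only [gradDot] at h2 h3
  rw [h2, h3]
  ring

/-- The quantitative content of the limiting Carleman condition on a set `K`, together with bounds
for the finitely many functions that enter the constants of the estimate. Here `lam` is the common
value of the Hessian of `φ` on unit vectors orthogonal to `∇φ`. The functions `φ Δφ + |∇φ|²` and
`φ lam` are the coefficients of `θ` in the Laplacian of the convexified weight and in the multiplier
of the flux. -/
structure CarlemanBounds (K : Set (Rn n)) (φ lam : Rn n → ℝ) (B s₀ : ℝ) : Prop where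
  one_le : 1 ≤ B
  pos : 0 < s₀
  le_grad : ∀ x ∈ K, s₀ ≤ gradDot φ φ x
  phi : ∀ x ∈ K, |φ x| ≤ B
  grad : ∀ x ∈ K, ‖gradient φ x‖ ≤ B
  lap : ∀ x ∈ K, |lapl φ x| ≤ B
  grad_lap : ∀ x ∈ K, ‖gradient (lapl φ) x‖ ≤ B
  grad_lap' : ∀ x ∈ K, ‖gradient (fun x => φ x * lapl φ x + gradDot φ φ x) x‖ ≤ B
  lam_le : ∀ x ∈ K, |lam x| ≤ B
  grad_lam : ∀ x ∈ K, ‖gradient lam x‖ ≤ B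
  grad_lam' : ∀ x ∈ K, ‖gradient (fun x => φ x * lam x) x‖ ≤ B
  hess_self : ∀ x ∈ K, hessGrad φ φ x = -lam x * gradDot φ φ x
  hess : ∀ x ∈ K, ∀ u : Rn n → ℝ,
    |hessGrad φ u x - lam x * ‖gradient u x‖ ^ 2| ≤ B * |gradDot φ u x| * ‖gradient u x‖

/-- The multiplier `(1 + θ φ) lam` of the flux. -/
def carlemanMultiplier (φ lam : Rn n → ℝ) (θ : ℝ) (x : Rn n) : ℝ := (1 + θ * φ x) * lam x

theorem gradDot_carlemanMultiplier {lam : Rn n → ℝ} (hφ : ContDiff ℝ ∞ φ)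
    (hlam : ContDiff ℝ ∞ lam) (θ : ℝ) (u : Rn n → ℝ) (x : Rn n) :
    gradDot (carlemanMultiplier φ lam θ) u x = gradDot lam u x +
      θ * gradDot (fun x => φ x * lam x) u x := by
  have h0 : carlemanMultiplier φ lam θ = fun x => lam x + θ * (φ x * lam x) := by
    ext x
    simp only [carlemanMultiplier]
    ring
  rw [h0]
  simp_rw [gradDot, Finset.mul_sum, ← Finset.sum_add_distrib]
  refine Finset.sum_congr rfl fun j _ => ?_
  rw [pderiv_add hlam (by fun_prop), pderiv_const_mul (by fun_prop)]
  ring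

theorem CarlemanBounds.one_add_mem {K : Set (Rn n)} {lam : Rn n → ℝ} {B s₀ θ : ℝ}
    (H : CarlemanBounds K φ lam B s₀) (hθ0 : 0 ≤ θ) (hθ1 : θ * B ≤ 1 / 2) {x : Rn n} (hx : x ∈ K) :
    1 / 2 ≤ 1 + θ * φ x ∧ 1 + θ * φ x ≤ 2 := by
  have h1 := abs_le.1 (H.phi x hx)
  constructor <;> nlinarith

/-- The pointwise Carleman inequality: up to a divergence, the square of the conjugated operator
controls `u` and `h ∇u` with the gain `h²/ε` produced by convexification. The constant `4 B²` bounds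
the coefficients formed with the convexified weight, since `1 + θ φ` lies between `1/2` and `2`. -/
theorem CarlemanBounds.div_flux_add_le {K : Set (Rn n)} {lam : Rn n → ℝ} {B s₀ : ℝ}
    (hφ : ContDiff ℝ ∞ φ) (hlam : ContDiff ℝ ∞ lam) (H : CarlemanBounds K φ lam B s₀)
    {δ ε h : ℝ} (hδ0 : 0 < δ) (hδ1 : δ ≤ 1) (hδ : δ * (4 * B ^ 2 + 1) ≤ s₀ ^ 2 / 2)
    (hε0 : 0 < ε) (hε1 : 12 * (4 * B ^ 2) ^ 2 * ε ≤ s₀ ^ 2 / 4)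
    (hε2 : 12 * (4 * B ^ 2) ^ 2 * ε ≤ δ / 2) (hε3 : ε ≤ 1) (hh : 0 < h)
    (hhε : h / ε * B ≤ 1 / 2) {u : Rn n → ℝ} (hu : ContDiff ℝ ∞ u) {x : Rn n} (hx : x ∈ K) :
    ∑ j, pderiv j (carlemanFlux h (convexWeight φ (h / ε)) (carlemanMultiplier φ lam (h / ε))
      (δ * (h * (h / ε)) * h ^ 2) u j) x
      + min (s₀ ^ 2 / 4) (δ / 2) * (h ^ 2 / ε) * (u x ^ 2 + h ^ 2 * ‖gradient u x‖ ^ 2)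
    ≤ conjOp h (convexWeight φ (h / ε)) u x ^ 2 := by
  set θ := h / ε with hθ
  have hθ0 : 0 < θ := by positivity
  have hB := H.one_le
  have hθ1 : θ ≤ 1 / 2 := by nlinarith
  obtain ⟨hg1, hg2⟩ := H.one_add_mem hθ0.le hhε hx
  have hs := H.le_grad x hx
  have hgs : gradDot φ φ x ≤ B ^ 2 := by
    rw [gradDot_self]
    have := H.grad x hx
    gcongr
  have hεθ : h = ε * θ := by rw [hθ]; field_simp
  have hκ : h ^ 2 / ε = h * θ := by rw [hθ]; field_simp
  have hm : ContDiff ℝ ∞ (carlemanMultiplier φ lam θ) := by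
    unfold carlemanMultiplier
    fun_prop
  have hq := norm_nonneg (gradient u x)
  have habs : ∀ {a b : Rn n → ℝ}, ‖gradient a x‖ ≤ B → ‖gradient b x‖ ≤ B →
      |gradDot a u x + θ * gradDot b u x| ≤ 4 * B ^ 2 * ‖gradient u x‖ := by
    intro a b ha hb
    have h1 := (abs_gradDot_le a u x).trans (mul_le_mul_of_nonneg_right ha hq)
    have h2 := (abs_gradDot_le b u x).trans (mul_le_mul_of_nonneg_right hb hq)
    calc |gradDot a u x + θ * gradDot b u x| ≤ |gradDot a u x| + |θ * gradDot b u x| := abs_add_le _ _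
      _ = |gradDot a u x| + θ * |gradDot b u x| := by rw [abs_mul, abs_of_pos hθ0]
      _ ≤ B * ‖gradient u x‖ + 1 * (B * ‖gradient u x‖) := by gcongr; linarith
      _ = 2 * B * ‖gradient u x‖ := by ring
      _ ≤ 4 * B ^ 2 * ‖gradient u x‖ := by
        gcongr ?_ * _
        nlinarith
  have main := carleman_real_inequality (B := 4 * B ^ 2) (s₀ := s₀ ^ 2 / 4) (δ := δ) (ε := ε)
    (h := h) (θ := θ) (g := 1 + θ * φ x) (s := gradDot φ φ x) (lam := lam x)
    (m := carlemanMultiplier φ lam θ x) (l := lapl (convexWeight φ θ) x) (U := u x)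
    (L := lapl u x) (D := gradDot φ u x) (q := ‖gradient u x‖) (Q := hessGrad φ u x)
    (T := mixedHess (convexWeight φ θ) u x)
    (R := gradDot (lapl (convexWeight φ θ)) u x) (M := gradDot (carlemanMultiplier φ lam θ) u x)
    (by nlinarith) hh hθ0 hεθ (by nlinarith)
    (by
      have h1 : (1 / 2 : ℝ) ^ 2 * s₀ ^ 2 ≤ (1 + θ * φ x) ^ 2 * gradDot φ φ x ^ 2 := by
        have := H.pos
        gcongr
      linarith)
    (by
      have h0 : 0 ≤ gradDot φ φ x := H.pos.le.trans hs
      calc (1 + θ * φ x) ^ 2 * gradDot φ φ x ≤ 2 ^ 2 * B ^ 2 := by gcongr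
        _ = _ := by ring)
    (by linarith) rfl
    (by
      rw [carlemanMultiplier, abs_mul, abs_of_pos (by linarith : 0 < 1 + θ * φ x)]
      have := H.lam_le x hx
      calc (1 + θ * φ x) * |lam x| ≤ 2 * B := by gcongr
        _ ≤ _ := by nlinarith)
    (by
      rw [lapl_convexWeight hφ]
      have h1 := abs_le.1 (H.lap x hx)
      have h2 : |(1 + θ * φ x) * lapl φ x| ≤ 2 * B := by
        rw [abs_mul, abs_of_pos (by linarith : 0 < 1 + θ * φ x)]
        have := H.lap x hx
        gcongr
      have h3 : |θ * gradDot φ φ x| ≤ 1 * B ^ 2 := by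
        have h0 : 0 ≤ gradDot φ φ x := H.pos.le.trans hs
        rw [abs_of_nonneg (by positivity)]
        gcongr
        linarith
      calc |lapl φ x + θ * (φ x * lapl φ x + gradDot φ φ x)|
          = |(1 + θ * φ x) * lapl φ x + θ * gradDot φ φ x| := by ring_nf
        _ ≤ 2 * B + 1 * B ^ 2 := (abs_add_le _ _).trans (add_le_add h2 h3)
        _ ≤ _ := by nlinarith)
    hq
    ((H.hess x hx u).trans (by
      gcongr
      nlinarith))
    (by
      rw [gradDot_lapl_convexWeight hφ]
      exact habs (H.grad_lap x hx) (H.grad_lap' x hx))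
    (by
      rw [gradDot_carlemanMultiplier hφ hlam]
      exact habs (H.grad_lam x hx) (H.grad_lam' x hx))
    hδ0 hδ1 (by linarith) hε1 hε2
  rw [div_carlemanFlux (hφ.convexWeight θ) hm hu, conjOp, gradDot_convexWeight hφ,
    hessGrad_convexWeight hφ, hessGrad_convexWeight_self hφ, gradDot_convexWeight_self hφ,
    H.hess_self x hx, gradDot_self u, hκ]
  refine le_trans (le_of_eq ?_) main
  ring

end Pointwise

/-! ### Consequences of the limiting Carleman condition -/

section Weight

variable {n : ℕ}

/-- A function that is smooth near a closed set agrees near that set with a globally smooth one. -/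
theorem exists_contDiff_eqOn_of_contDiffOn {K U : Set (Rn n)} (hK : IsClosed K) (hU : IsOpen U)
    (hKU : K ⊆ U) {f : Rn n → ℝ} (hf : ContDiffOn ℝ ∞ f U) :
    ∃ g : Rn n → ℝ, ContDiff ℝ ∞ g ∧ ∃ V, IsOpen V ∧ K ⊆ V ∧ V ⊆ U ∧ Set.EqOn g f V := by
  obtain ⟨χ, h0, h1, -⟩ := exists_contMDiffMap_zero_one_nhds_of_isClosed
    (modelWithCornersSelf ℝ (Rn n)) (n := (⊤ : ℕ∞)) hU.isClosed_compl hK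
    (Set.disjoint_compl_left_iff_subset.2 hKU)
  have hχ : ContDiff ℝ ∞ χ := χ.contMDiff.contDiff
  obtain ⟨V, hV, hKV, hV1⟩ := eventually_nhdsSet_iff_exists.1 h1
  refine ⟨fun x => χ x * f x, contDiff_iff_contDiffAt.2 fun x => ?_, V ∩ U, ?_, ?_, ?_, ?_⟩
  · by_cases hx : x ∈ U
    · exact hχ.contDiffAt.mul (hf.contDiffAt (hU.mem_nhds hx))
    · have h2 : (fun x => χ x * f x) =ᶠ[𝓝 x] fun _ => 0 := by
        filter_upwards [eventually_nhdsSet_iff_forall.1 h0 x hx] with y hy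
        rw [hy, zero_mul]
      exact contDiffAt_const.congr_of_eventuallyEq h2
  · exact hV.inter hU
  · exact Set.subset_inter hKV hKU
  · exact Set.inter_subset_right
  · intro x hx
    simp [hV1 x hx.1]

theorem fderiv_fderiv_eq_sum {φ : Rn n → ℝ} (hφ : ContDiff ℝ ∞ φ) (x a b : Rn n) :
    fderiv ℝ (fderiv ℝ φ) x a b = ∑ j, ∑ k, pderiv j (pderiv k φ) x * a j * b k := by
  rw [fderiv_eq_sum_pderiv, sum_apply]
  refine Finset.sum_congr rfl fun j _ => ?_
  conv_lhs => rw [eq_sum_stdVec b]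
  rw [map_sum]
  refine Finset.sum_congr rfl fun k _ => ?_
  rw [map_smul, pderiv_pderiv_eq hφ, smul_apply, smul_eq_mul, smul_eq_mul, pderiv]
  ring

theorem hessGrad_eq {φ : Rn n → ℝ} (hφ : ContDiff ℝ ∞ φ) (u : Rn n → ℝ) (x : Rn n) :
    hessGrad φ u x = fderiv ℝ (fderiv ℝ φ) x (gradient u x) (gradient u x) := by
  rw [fderiv_fderiv_eq_sum hφ]
  simp_rw [gradient_apply]
  rfl

/-- A quadratic form that is a multiple `lam` of the metric on the orthogonal complement of `p`
differs from `lam ‖ξ‖²` by a multiple of `⟪p, ξ⟫`. -/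
theorem abs_bilinear_sub_le {E : Type*} [NormedAddCommGroup E] [InnerProductSpace ℝ E]
    (H : E →L[ℝ] E →L[ℝ] ℝ) {p : E} (hp : p ≠ 0) {lam : ℝ}
    (hpp : H p p = -lam * ‖p‖ ^ 2) (hH : ∀ ζ : E, ⟪p, ζ⟫_ℝ = 0 → H ζ ζ = lam * ‖ζ‖ ^ 2) (ξ : E) :
    |H ξ ξ - lam * ‖ξ‖ ^ 2| ≤ (4 * ‖H‖ * ‖p‖⁻¹) * |⟪p, ξ⟫_ℝ| * ‖ξ‖ := by
  have hp0 : 0 < ‖p‖ := norm_pos_iff.2 hp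
  obtain ⟨τ, hτ⟩ : ∃ τ, τ = ⟪p, ξ⟫_ℝ / ‖p‖ ^ 2 := ⟨_, rfl⟩
  obtain ⟨ζ, hζ⟩ : ∃ ζ, ζ = ξ - τ • p := ⟨_, rfl⟩
  have hτp : τ * ‖p‖ ^ 2 = ⟪p, ξ⟫_ℝ := by rw [hτ]; field_simp
  have hpζ : ⟪p, ζ⟫_ℝ = 0 := by
    rw [hζ, inner_sub_right, inner_smul_right, real_inner_self_eq_norm_sq, hτp, sub_self]
  have hξ : ξ = ζ + τ • p := by rw [hζ]; abel
  have hnorm : ‖ξ‖ ^ 2 = ‖ζ‖ ^ 2 + τ ^ 2 * ‖p‖ ^ 2 := by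
    rw [hξ, norm_add_sq_real, inner_smul_right, real_inner_comm, hpζ, norm_smul, mul_pow,
      Real.norm_eq_abs, sq_abs]
    ring
  have hζξ : ‖ζ‖ ≤ ‖ξ‖ := by
    refine le_of_sq_le_sq ?_ (norm_nonneg _)
    rw [hnorm]
    have : 0 ≤ τ ^ 2 * ‖p‖ ^ 2 := by positivity
    linarith
  have hτξ : |τ| * ‖p‖ ≤ ‖ξ‖ := by
    refine le_of_sq_le_sq ?_ (norm_nonneg _)
    rw [hnorm, mul_pow, sq_abs]
    have : 0 ≤ ‖ζ‖ ^ 2 := by positivity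
    linarith
  have e : H ξ ξ - lam * ‖ξ‖ ^ 2 = τ * (H ζ p + H p ζ) + 2 * (τ * τ) * H p p := by
    rw [hnorm]
    conv_lhs => rw [hξ]
    simp only [map_add, map_smul, add_apply, smul_apply,
      smul_eq_mul]
    rw [hH ζ hpζ, hpp]
    ring
  have b1 : |H ζ p| ≤ ‖H‖ * ‖ξ‖ * ‖p‖ := by
    refine (H.le_opNorm₂ ζ p).trans ?_
    gcongr
  have b2 : |H p ζ| ≤ ‖H‖ * ‖p‖ * ‖ξ‖ := by
    refine (H.le_opNorm₂ p ζ).trans ?_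
    gcongr
  have b3 : |H p p| ≤ ‖H‖ * ‖p‖ * ‖p‖ := H.le_opNorm₂ p p
  have e2 : ‖p‖⁻¹ * |⟪p, ξ⟫_ℝ| = |τ| * ‖p‖ := by
    rw [← hτp, abs_mul, abs_of_pos (by positivity : 0 < ‖p‖ ^ 2)]
    field_simp
  calc |H ξ ξ - lam * ‖ξ‖ ^ 2| ≤ |τ * (H ζ p + H p ζ)| + |2 * (τ * τ) * H p p| := by
        rw [e]; exact abs_add_le _ _
    _ ≤ |τ| * (‖H‖ * ‖ξ‖ * ‖p‖ + ‖H‖ * ‖p‖ * ‖ξ‖) + 2 * (|τ| * |τ|) * (‖H‖ * ‖p‖ * ‖p‖) := by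
        rw [abs_mul, abs_mul, abs_mul, abs_mul, abs_two]
        gcongr
        exact (abs_add_le _ _).trans (add_le_add b1 b2)
    _ = 2 * (|τ| * ‖p‖) * ‖H‖ * ‖ξ‖ + 2 * (|τ| * ‖p‖) * ‖H‖ * (|τ| * ‖p‖) := by ring
    _ ≤ 2 * (|τ| * ‖p‖) * ‖H‖ * ‖ξ‖ + 2 * (|τ| * ‖p‖) * ‖H‖ * ‖ξ‖ := by gcongr
    _ = 4 * ‖H‖ * (‖p‖⁻¹ * |⟪p, ξ⟫_ℝ|) * ‖ξ‖ := by rw [e2]; ring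
    _ = _ := by ring

theorem carlemanSymbol_re (φ : Rn n → ℝ) (x ξ : Rn n) :
    (carlemanSymbol φ x ξ).re = ‖ξ‖ ^ 2 - ‖gradient φ x‖ ^ 2 := by
  simp [carlemanSymbol, -Complex.ofReal_pow]

theorem carlemanSymbol_im (φ : Rn n → ℝ) (x ξ : Rn n) :
    (carlemanSymbol φ x ξ).im = 2 * ⟪gradient φ x, ξ⟫_ℝ := by
  simp [carlemanSymbol, -Complex.ofReal_pow]

/-- The Poisson bracket of the real and imaginary parts of the symbol is
`4 (φ''(ξ, ξ) + φ''(∇φ, ∇φ))`. -/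
theorem poissonBracket_carlemanSymbol {φ : Rn n → ℝ} (hφ : ContDiff ℝ ∞ φ) (x ξ : Rn n) :
    poissonBracket (fun y η => (carlemanSymbol φ y η).re)
      (fun y η => (carlemanSymbol φ y η).im) x ξ =
    4 * (fderiv ℝ (fderiv ℝ φ) x ξ ξ +
      fderiv ℝ (fderiv ℝ φ) x (gradient φ x) (gradient φ x)) := by
  simp_rw [carlemanSymbol_re, carlemanSymbol_im]
  have g1 : gradient (fun η : Rn n => ‖η‖ ^ 2 - ‖gradient φ x‖ ^ 2) ξ = (2 : ℝ) • ξ := by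
    refine HasGradientAt.gradient ?_
    rw [hasGradientAt_iff_hasFDerivAt]
    refine ((hasStrictFDerivAt_norm_sq ξ).hasFDerivAt.sub_const (‖gradient φ x‖ ^ 2)).congr_fderiv ?_
    ext w
    simp
  have g2 : gradient (fun η : Rn n => 2 * ⟪gradient φ x, η⟫_ℝ) ξ = (2 : ℝ) • gradient φ x := by
    refine HasGradientAt.gradient ?_
    rw [hasGradientAt_iff_hasFDerivAt]
    refine (((innerSL ℝ (gradient φ x)).hasFDerivAt (x := ξ)).const_mul 2).congr_fderiv ?_
    ext w
    simp
  have hd : DifferentiableAt ℝ (fderiv ℝ φ) x :=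
    (hφ.fderiv_right (m := ∞) (by norm_cast)).differentiable (by norm_num) x
  have hin : ∀ y w : Rn n, ⟪gradient φ y, w⟫_ℝ = fderiv ℝ φ y w := by
    intro y w
    simp [gradient]
  have g3 : ∀ w, ⟪gradient (fun y : Rn n => 2 * ⟪gradient φ y, ξ⟫_ℝ) x, w⟫_ℝ =
      2 * fderiv ℝ (fderiv ℝ φ) x w ξ := by
    intro w
    have h1 : HasFDerivAt (fun y : Rn n => 2 * ⟪gradient φ y, ξ⟫_ℝ) _ x :=
      ((hd.hasFDerivAt.clm_apply (hasFDerivAt_const ξ x)).const_mul 2).congr_of_eventuallyEq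
        (Eventually.of_forall fun y => by simp [hin])
    have h2 := h1.fderiv
    simp only [gradient, InnerProductSpace.toDual_symm_apply] at h2 ⊢
    rw [h2]
    simp
  have g4 : ∀ w, ⟪gradient (fun y : Rn n => ‖ξ‖ ^ 2 - ‖gradient φ y‖ ^ 2) x, w⟫_ℝ =
      -2 * fderiv ℝ (fderiv ℝ φ) x w (gradient φ x) := by
    intro w
    have h0 : (fun y : Rn n => ‖ξ‖ ^ 2 - ‖gradient φ y‖ ^ 2) =
        fun y => ‖ξ‖ ^ 2 - gradDot φ φ y := by
      ext y
      rw [gradDot_self]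
    have h3 : ⟪gradient (fun y : Rn n => ‖ξ‖ ^ 2 - ‖gradient φ y‖ ^ 2) x, w⟫_ℝ =
      fderiv ℝ (fun y : Rn n => ‖ξ‖ ^ 2 - ‖gradient φ y‖ ^ 2) x w := by
      simp [gradient]
    rw [h3, h0, fderiv_const_sub, neg_apply, fderiv_eq_sum_pderiv, fderiv_fderiv_eq_sum hφ,
      Finset.mul_sum, ← Finset.sum_neg_distrib]
    refine Finset.sum_congr rfl fun j _ => ?_
    rw [pderiv_gradDot hφ hφ, smul_eq_mul, Finset.mul_sum, Finset.mul_sum,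
      ← Finset.sum_neg_distrib]
    refine Finset.sum_congr rfl fun k _ => ?_
    rw [gradient_apply]
    ring
  rw [poissonBracket, g1, g2, inner_smul_left, real_inner_comm, g3, inner_smul_right, g4]
  simp
  ring

theorem IsLimitingCarlemanWeight.congr {U V : Set (Rn n)} {φ φ' : Rn n → ℝ}
    (hφ : IsLimitingCarlemanWeight U φ) (hV : IsOpen V) (hVU : V ⊆ U) (h : Set.EqOn φ' φ V) :
    IsLimitingCarlemanWeight V φ' := by
  have hgr : ∀ x ∈ V, gradient φ' =ᶠ[𝓝 x] gradient φ := by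
    intro x hx
    have h1 : ∀ᶠ y in 𝓝 x, φ' =ᶠ[𝓝 y] φ :=
      ((h.eventuallyEq_of_mem (hV.mem_nhds hx))).eventually_nhds
    filter_upwards [h1] with y hy
    simp only [gradient, hy.fderiv_eq]
  have hsym : ∀ x ∈ V, ∀ᶠ y in 𝓝 x, ∀ η, carlemanSymbol φ' y η = carlemanSymbol φ y η := by
    intro x hx
    filter_upwards [hgr x hx] with y hy η
    simp only [carlemanSymbol, hy]
  refine ⟨(hφ.1.mono hVU).congr h, fun x hx => ?_, fun x hx ξ h0 => ?_⟩
  · rw [(hgr x hx).self_of_nhds]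
    exact hφ.2.1 x (hVU hx)
  · have h1 := hsym x hx
    have hx0 := h1.self_of_nhds
    rw [← hφ.2.2 x (hVU hx) ξ (by rw [← hx0 ξ, h0])]
    have e1 : (fun y => (carlemanSymbol φ' y ξ).re) =ᶠ[𝓝 x] fun y => (carlemanSymbol φ y ξ).re := by
      filter_upwards [h1] with y hy
      rw [hy]
    have e2 : (fun y => (carlemanSymbol φ' y ξ).im) =ᶠ[𝓝 x] fun y => (carlemanSymbol φ y ξ).im := by
      filter_upwards [h1] with y hy
      rw [hy]
    simp only [poissonBracket, gradient, e1.fderiv_eq, e2.fderiv_eq, hx0]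

/-- For a limiting Carleman weight the Hessian restricted to the orthogonal complement of the
gradient is a multiple of the metric, by homogeneity of the Poisson bracket. -/
theorem IsLimitingCarlemanWeight.hessian_orthogonal {V : Set (Rn n)} {φ : Rn n → ℝ}
    (hφ : IsLimitingCarlemanWeight V φ) (hs : ContDiff ℝ ∞ φ) {x : Rn n} (hx : x ∈ V) {ζ : Rn n}
    (hζ : ⟪gradient φ x, ζ⟫_ℝ = 0) :
    fderiv ℝ (fderiv ℝ φ) x ζ ζ =
      -(hessGrad φ φ x / gradDot φ φ x) * ‖ζ‖ ^ 2 := by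
  have hp : 0 < ‖gradient φ x‖ := norm_pos_iff.2 (hφ.2.1 x hx)
  rw [gradDot_self, hessGrad_eq hs]
  rcases eq_or_ne ζ 0 with rfl | hne
  · simp
  have hz : 0 < ‖ζ‖ := norm_pos_iff.2 hne
  obtain ⟨c, hc⟩ : ∃ c, c = ‖gradient φ x‖ / ‖ζ‖ := ⟨_, rfl⟩
  have hc0 : 0 < c := by rw [hc]; positivity
  have hcz : c * ‖ζ‖ = ‖gradient φ x‖ := by rw [hc]; field_simp
  -- the multiple of `ζ` of length `|∇φ|` is a zero of the symbol
  have h0 : carlemanSymbol φ x (c • ζ) = 0 := by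
    apply Complex.ext
    · rw [carlemanSymbol_re, norm_smul, Real.norm_eq_abs, abs_of_pos hc0, hcz]
      simp
    · rw [carlemanSymbol_im, inner_smul_right, hζ]
      simp
  have h1 := hφ.2.2 x hx _ h0
  rw [poissonBracket_carlemanSymbol hs] at h1
  simp only [map_smul, smul_apply, smul_eq_mul] at h1
  rw [← hcz]
  field_simp
  linarith

theorem continuous_gradient_of_contDiff {f : Rn n → ℝ} (hf : ContDiff ℝ ∞ f) :
    Continuous (gradient f) :=
  (InnerProductSpace.toDual ℝ (Rn n)).symm.continuous.comp (hf.continuous_fderiv (by norm_num))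

theorem continuous_norm_fderiv_fderiv {E : Type*} [NormedAddCommGroup E] [NormedSpace ℝ E]
    {f : E → ℝ} (hf : ContDiff ℝ ∞ f) : Continuous (fun x => ‖fderiv ℝ (fderiv ℝ f) x‖) :=
  ((hf.fderiv_right (m := ∞) (by norm_cast)).continuous_fderiv (by norm_num)).norm

@[fun_prop]
theorem ContDiff.hessGrad {f u : Rn n → ℝ} (hf : ContDiff ℝ ∞ f) (hu : ContDiff ℝ ∞ u) :
    ContDiff ℝ ∞ (hessGrad f u) :=
  ContDiff.sum fun j _ => ContDiff.sum fun k _ =>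
    (((hf.pderiv k).pderiv j).mul (hu.pderiv j)).mul (hu.pderiv k)

/-- A limiting Carleman weight near the closure of a bounded set may be replaced by a globally
smooth function, and then satisfies the quantitative Carleman condition. Since the Hessian takes the
value `-lam |∇φ|²` on `∇φ` and is `lam` times the metric on the orthogonal complement of `∇φ`, it
equals `lam |ξ|²` up to a multiple of `∇φ · ξ`. -/
theorem IsLimitingCarlemanWeight.exists_carlemanBounds {U K : Set (Rn n)} {φ : Rn n → ℝ}
    (hφ : IsLimitingCarlemanWeight U φ) (hU : IsOpen U) (hK : IsCompact K) (hKU : K ⊆ U) :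
    ∃ φ' lam : Rn n → ℝ, ContDiff ℝ ∞ φ' ∧ ContDiff ℝ ∞ lam ∧
      (∃ V, IsOpen V ∧ K ⊆ V ∧ Set.EqOn φ' φ V) ∧ ∃ B s₀, CarlemanBounds K φ' lam B s₀ := by
  obtain ⟨φ', hφ', V, hV, hKV, hVU, hEq⟩ :=
    exists_contDiff_eqOn_of_contDiffOn hK.isClosed hU hKU hφ.1
  have hL := hφ.congr hV hVU hEq
  have hpos : ∀ x ∈ V, 0 < gradDot φ' φ' x := fun x hx => by
    rw [gradDot_self]
    have := norm_pos_iff.2 (hL.2.1 x hx)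
    positivity
  obtain ⟨lam, hlam, W, hW, hKW, hWV, hEqW⟩ :=
    exists_contDiff_eqOn_of_contDiffOn hK.isClosed hV hKV
      (f := fun x => -(hessGrad φ' φ' x / gradDot φ' φ' x))
      (((hφ'.hessGrad hφ').contDiffOn.div (hφ'.gradDot hφ').contDiffOn
        fun x hx => (hpos x hx).ne').neg)
  refine ⟨φ', lam, hφ', hlam, ⟨V, hV, hKV, hEq⟩, ?_⟩
  have bd : ∀ f : Rn n → ℝ, ContinuousOn f K → ∃ C, ∀ x ∈ K, |f x| ≤ C := fun f hf => by
    obtain ⟨C, hC⟩ := hK.exists_bound_of_continuousOn hf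
    exact ⟨C, fun x hx => hC x hx⟩
  have hgc : ∀ f : Rn n → ℝ, ContDiff ℝ ∞ f → ContinuousOn (fun x => ‖gradient f x‖) K :=
    fun f hf => (continuous_gradient_of_contDiff hf).norm.continuousOn
  have hΨ : ContDiff ℝ ∞ (fun x => φ' x * lapl φ' x + gradDot φ' φ' x) := by fun_prop
  obtain ⟨C1, h1⟩ := bd φ' hφ'.continuous.continuousOn
  obtain ⟨C2, h2⟩ := bd _ (hgc φ' hφ')
  obtain ⟨C3, h3⟩ := bd (lapl φ') hφ'.lapl.continuous.continuousOn
  obtain ⟨C4, h4⟩ := bd _ (hgc _ hφ'.lapl)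
  obtain ⟨C5, h5⟩ := bd _ (hgc _ hΨ)
  obtain ⟨C6, h6⟩ := bd lam hlam.continuous.continuousOn
  obtain ⟨C7, h7⟩ := bd _ (hgc _ hlam)
  obtain ⟨C8, h8⟩ := bd _ (hgc _ (hφ'.mul hlam))
  obtain ⟨C9, h9⟩ := bd (fun x => 4 * ‖fderiv ℝ (fderiv ℝ φ') x‖ * ‖gradient φ' x‖⁻¹) (by
    have hc3 := continuous_norm_fderiv_fderiv hφ'
    refine ((continuous_const.mul hc3).continuousOn).mul ((hgc φ' hφ').inv₀ fun x hx => ?_)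
    exact (norm_pos_iff.2 (hL.2.1 x (hKV hx))).ne')
  obtain ⟨s₀, hs₀, hs⟩ : ∃ s₀ > 0, ∀ x ∈ K, s₀ ≤ gradDot φ' φ' x := by
    rcases K.eq_empty_or_nonempty with rfl | hne
    · exact ⟨1, one_pos, by simp⟩
    · obtain ⟨z, hz, hmin⟩ := hK.exists_isMinOn hne (hφ'.gradDot hφ').continuous.continuousOn
      exact ⟨_, hpos z (hKV hz), fun x hx => hmin hx⟩
  obtain ⟨B, hB⟩ : ∃ B, B = 1 + |C1| + |C2| + |C3| + |C4| + |C5| + |C6| + |C7| + |C8| + |C9| :=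
    ⟨_, rfl⟩
  have a1 := abs_nonneg C1
  have a2 := abs_nonneg C2
  have a3 := abs_nonneg C3
  have a4 := abs_nonneg C4
  have a5 := abs_nonneg C5
  have a6 := abs_nonneg C6
  have a7 := abs_nonneg C7
  have a8 := abs_nonneg C8
  have a9 := abs_nonneg C9
  have hlamK : ∀ x ∈ K, lam x = -(hessGrad φ' φ' x / gradDot φ' φ' x) := fun x hx => hEqW (hKW hx)
  refine ⟨B, s₀, by linarith, hs₀, hs, ?_, ?_, ?_, ?_, ?_, ?_, ?_, ?_, ?_, ?_⟩
  · exact fun x hx => (h1 x hx).trans (by linarith [le_abs_self C1])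
  · exact fun x hx => (le_abs_self _).trans ((h2 x hx).trans (by linarith [le_abs_self C2]))
  · exact fun x hx => (h3 x hx).trans (by linarith [le_abs_self C3])
  · exact fun x hx => (le_abs_self _).trans ((h4 x hx).trans (by linarith [le_abs_self C4]))
  · exact fun x hx => (le_abs_self _).trans ((h5 x hx).trans (by linarith [le_abs_self C5]))
  · exact fun x hx => (h6 x hx).trans (by linarith [le_abs_self C6])
  · exact fun x hx => (le_abs_self _).trans ((h7 x hx).trans (by linarith [le_abs_self C7]))
  · exact fun x hx => (le_abs_self _).trans ((h8 x hx).trans (by linarith [le_abs_self C8]))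
  · intro x hx
    rw [hlamK x hx]
    have := (hpos x (hKV hx)).ne'
    field_simp
  · intro x hx u
    rw [hessGrad_eq hφ', gradDot_eq_inner]
    refine (abs_bilinear_sub_le _ (hL.2.1 x (hKV hx)) ?_ ?_ _).trans ?_
    · rw [← hessGrad_eq hφ', hlamK x hx, ← gradDot_self]
      have := (hpos x (hKV hx)).ne'
      field_simp
    · intro ζ hζ
      rw [hL.hessian_orthogonal hφ' (hKV hx) hζ, hlamK x hx]
    · have := (le_abs_self _).trans (h9 x hx)
      gcongr
      exact this.trans (by linarith [le_abs_self C9])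

end Weight

/-! ### The Carleman estimate for smooth functions -/

section Smooth

variable {n : ℕ}

/-- The component of a complex vector along the real vector `ν`. -/
def normalPart (ν : Rn n) (V : EuclideanSpace ℂ (Fin n)) : ℂ := ∑ j, ((ν j : ℝ) : ℂ) * V j

/-- The component of a complex vector orthogonal to the real unit vector `ν`. -/
def tangentialPart (ν : Rn n) (V : EuclideanSpace ℂ (Fin n)) : EuclideanSpace ℂ (Fin n) :=
  WithLp.toLp 2 fun j => V j - normalPart ν V * ((ν j : ℝ) : ℂ)

/-- The classical gradient of a complex function. -/
def cgrad (w : Rn n → ℂ) (x : Rn n) : EuclideanSpace ℂ (Fin n) :=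
  WithLp.toLp 2 fun j => pderiv j w x

/-- The conjugated Laplacian `e^{f/h}(-h²Δ)e^{-f/h}` written out for complex functions. -/
def conjOpC (h : ℝ) (f : Rn n → ℝ) (w : Rn n → ℂ) (x : Rn n) : ℂ :=
  (-(h : ℂ) ^ 2 * lapl w x - ((gradDot f f x : ℝ) : ℂ) * w x) +
    (2 * h * ∑ j, ((pderiv j f x : ℝ) : ℂ) * pderiv j w x + h * ((lapl f x : ℝ) : ℂ) * w x)

theorem pderiv_re {w : Rn n → ℂ} (hw : ContDiff ℝ ∞ w) (j : Fin n) (x : Rn n) :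
    pderiv j (fun x => (w x).re) x = (pderiv j w x).re := by
  have h := (Complex.reCLM.hasFDerivAt.comp x (hw.differentiableAt_top x).hasFDerivAt).fderiv
  change fderiv ℝ (fun x => (w x).re) x = _ at h
  rw [pderiv, h]
  rfl

theorem pderiv_im {w : Rn n → ℂ} (hw : ContDiff ℝ ∞ w) (j : Fin n) (x : Rn n) :
    pderiv j (fun x => (w x).im) x = (pderiv j w x).im := by
  have h := (Complex.imCLM.hasFDerivAt.comp x (hw.differentiableAt_top x).hasFDerivAt).fderiv
  change fderiv ℝ (fun x => (w x).im) x = _ at h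
  rw [pderiv, h]
  rfl

theorem ContDiff.complex_re {w : Rn n → ℂ} (hw : ContDiff ℝ ∞ w) :
    ContDiff ℝ ∞ (fun x => (w x).re) := Complex.reCLM.contDiff.comp hw

theorem ContDiff.complex_im {w : Rn n → ℂ} (hw : ContDiff ℝ ∞ w) :
    ContDiff ℝ ∞ (fun x => (w x).im) := Complex.imCLM.contDiff.comp hw

theorem lapl_re {w : Rn n → ℂ} (hw : ContDiff ℝ ∞ w) (x : Rn n) :
    lapl (fun x => (w x).re) x = (lapl w x).re := by
  rw [lapl, lapl, Complex.re_sum]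
  refine Finset.sum_congr rfl fun j _ => ?_
  rw [← pderiv_re (hw.pderiv j)]
  congr 1
  ext y
  exact pderiv_re hw j y

theorem lapl_im {w : Rn n → ℂ} (hw : ContDiff ℝ ∞ w) (x : Rn n) :
    lapl (fun x => (w x).im) x = (lapl w x).im := by
  rw [lapl, lapl, Complex.im_sum]
  refine Finset.sum_congr rfl fun j _ => ?_
  rw [← pderiv_im (hw.pderiv j)]
  congr 1
  ext y
  exact pderiv_im hw j y

theorem conjOpC_re {w : Rn n → ℂ} (hw : ContDiff ℝ ∞ w) (h : ℝ) (f : Rn n → ℝ) (x : Rn n) :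
    (conjOpC h f w x).re = conjOp h f (fun x => (w x).re) x := by
  have h1 : (-(h : ℂ) ^ 2) = ((-h ^ 2 : ℝ) : ℂ) := by push_cast; ring
  have h2 : (2 * h : ℂ) = ((2 * h : ℝ) : ℂ) := by push_cast; ring
  rw [conjOp, conjOpC, lapl_re hw, gradDot, gradDot, h1, h2]
  simp only [Complex.add_re, Complex.sub_re, Complex.re_ofReal_mul, Complex.re_sum, mul_assoc,
    pderiv_re hw]

theorem conjOpC_im {w : Rn n → ℂ} (hw : ContDiff ℝ ∞ w) (h : ℝ) (f : Rn n → ℝ) (x : Rn n) :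
    (conjOpC h f w x).im = conjOp h f (fun x => (w x).im) x := by
  have h1 : (-(h : ℂ) ^ 2) = ((-h ^ 2 : ℝ) : ℂ) := by push_cast; ring
  have h2 : (2 * h : ℂ) = ((2 * h : ℝ) : ℂ) := by push_cast; ring
  rw [conjOp, conjOpC, lapl_im hw, gradDot, gradDot, h1, h2]
  simp only [Complex.add_im, Complex.sub_im, Complex.im_ofReal_mul, Complex.im_sum, mul_assoc,
    pderiv_im hw]

theorem norm_sq_conjOpC {w : Rn n → ℂ} (hw : ContDiff ℝ ∞ w) (h : ℝ) (f : Rn n → ℝ) (x : Rn n) :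
    ‖conjOpC h f w x‖ ^ 2 =
      conjOp h f (fun x => (w x).re) x ^ 2 + conjOp h f (fun x => (w x).im) x ^ 2 := by
  rw [Complex.sq_norm, Complex.normSq_apply, conjOpC_re hw, conjOpC_im hw]
  ring

theorem norm_sq_re_add_im (z : ℂ) : ‖z‖ ^ 2 = z.re ^ 2 + z.im ^ 2 := by
  rw [Complex.sq_norm, Complex.normSq_apply]
  ring

theorem norm_sq_cgrad {w : Rn n → ℂ} (hw : ContDiff ℝ ∞ w) (x : Rn n) :
    ‖cgrad w x‖ ^ 2 =
      ‖gradient (fun x => (w x).re) x‖ ^ 2 + ‖gradient (fun x => (w x).im) x‖ ^ 2 := by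
  rw [EuclideanSpace.norm_sq_eq, EuclideanSpace.norm_sq_eq, EuclideanSpace.norm_sq_eq,
    ← Finset.sum_add_distrib]
  refine Finset.sum_congr rfl fun j _ => ?_
  rw [gradient_apply, gradient_apply, pderiv_re hw, pderiv_im hw, Real.norm_eq_abs,
    Real.norm_eq_abs, sq_abs, sq_abs]
  exact norm_sq_re_add_im _

theorem normalPart_cgrad_re {w : Rn n → ℂ} (hw : ContDiff ℝ ∞ w) (ν x : Rn n) :
    (normalPart ν (cgrad w x)).re = ⟪ν, gradient (fun x => (w x).re) x⟫_ℝ := by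
  rw [normalPart, Complex.re_sum, inner_eq_sum]
  refine Finset.sum_congr rfl fun j _ => ?_
  rw [Complex.re_ofReal_mul, gradient_apply, pderiv_re hw]
  rfl

theorem normalPart_cgrad_im {w : Rn n → ℂ} (hw : ContDiff ℝ ∞ w) (ν x : Rn n) :
    (normalPart ν (cgrad w x)).im = ⟪ν, gradient (fun x => (w x).im) x⟫_ℝ := by
  rw [normalPart, Complex.im_sum, inner_eq_sum]
  refine Finset.sum_congr rfl fun j _ => ?_
  rw [Complex.im_ofReal_mul, gradient_apply, pderiv_im hw]
  rfl

theorem norm_sq_tangentialPart_cgrad {w : Rn n → ℂ} (hw : ContDiff ℝ ∞ w) (ν x : Rn n) :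
    ‖tangentialPart ν (cgrad w x)‖ ^ 2 =
      ‖gradient (fun x => (w x).re) x - ⟪ν, gradient (fun x => (w x).re) x⟫_ℝ • ν‖ ^ 2 +
      ‖gradient (fun x => (w x).im) x - ⟪ν, gradient (fun x => (w x).im) x⟫_ℝ • ν‖ ^ 2 := by
  rw [EuclideanSpace.norm_sq_eq, EuclideanSpace.norm_sq_eq, EuclideanSpace.norm_sq_eq,
    ← Finset.sum_add_distrib]
  refine Finset.sum_congr rfl fun j _ => ?_
  rw [PiLp.sub_apply, PiLp.sub_apply, PiLp.smul_apply, PiLp.smul_apply, gradient_apply,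
    gradient_apply, pderiv_re hw, pderiv_im hw, Real.norm_eq_abs, Real.norm_eq_abs, sq_abs, sq_abs,
    norm_sq_re_add_im, ← normalPart_cgrad_re hw, ← normalPart_cgrad_im hw]
  simp [tangentialPart, cgrad]

/-- The Cauchy–Schwarz inequality in the plane. -/
theorem add_mul_le_of_sq_eq {a b c d X Y : ℝ} (hX : 0 ≤ X) (hY : 0 ≤ Y)
    (h1 : X ^ 2 = a ^ 2 + b ^ 2) (h2 : Y ^ 2 = c ^ 2 + d ^ 2) : a * c + b * d ≤ X * Y := by
  refine le_of_sq_le_sq ?_ (by positivity)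
  rw [mul_pow, h1, h2]
  nlinarith [sq_nonneg (a * d - b * c)]

/-- The boundary flux for a real function with value `U` and gradient `v`, where `p`, `l`, `m` are
the gradient and the Laplacian of the weight and the multiplier. The terms quadratic in the normal
derivative combine to `2 h³ (ν · p) (ν · v)²`, and each remaining term contains the value or the
tangential gradient. -/
theorem neg_normal_flux_le {h d P U l m : ℝ} {p v ν : Rn n} (hh : 0 < h) (hd0 : 0 ≤ d)
    (hd : d ≤ h ^ 3) (hP : 1 ≤ P) (hp : ‖p‖ ≤ P) (hl : |l| ≤ P) (hm : |m| ≤ P) (hν : ‖ν‖ = 1) :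
    -(-4 * h ^ 3 * (⟪ν, v⟫_ℝ * ⟪p, v⟫_ℝ) + 2 * h ^ 3 * (⟪ν, p⟫_ℝ * ‖v‖ ^ 2)
      - 2 * h ^ 3 * (⟪ν, v⟫_ℝ * (l * U)) - 2 * h * (⟪ν, p⟫_ℝ * (‖p‖ ^ 2 * (U * U)))
      + 4 * h ^ 3 * (⟪ν, v⟫_ℝ * (m * U)) - d * (⟪ν, v⟫_ℝ * U)) ≤
    2 * h ^ 3 * (⟪ν, p⟫_ℝ * ⟪ν, v⟫_ℝ ^ 2) + 8 * P ^ 3 *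
      (h * U ^ 2 + h ^ 3 * (|⟪ν, v⟫_ℝ| * |U|) + h ^ 3 * ‖v - ⟪ν, v⟫_ℝ • ν‖ ^ 2
        + h ^ 3 * (‖v - ⟪ν, v⟫_ℝ • ν‖ * |⟪ν, v⟫_ℝ|)) := by
  obtain ⟨t, ht⟩ : ∃ t, t = v - ⟪ν, v⟫_ℝ • ν := ⟨_, rfl⟩
  obtain ⟨a, ha⟩ : ∃ a, a = ⟪ν, v⟫_ℝ := ⟨_, rfl⟩
  obtain ⟨b, hb⟩ : ∃ b, b = ⟪ν, p⟫_ℝ := ⟨_, rfl⟩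
  have hv : v = t + a • ν := by rw [ht, ha]; abel
  have hνt : ⟪ν, t⟫_ℝ = 0 := by
    rw [ht, inner_sub_right, inner_smul_right, real_inner_self_eq_norm_sq, hν]
    ring
  have hpv : ⟪p, v⟫_ℝ = ⟪p, t⟫_ℝ + a * b := by
    rw [hb, hv, inner_add_right, inner_smul_right, real_inner_comm p ν]
  have hvn : ‖v‖ ^ 2 = ‖t‖ ^ 2 + a ^ 2 := by
    rw [hv, norm_add_sq_real, inner_smul_right, real_inner_comm, hνt, norm_smul, hν,
      Real.norm_eq_abs, mul_one, sq_abs]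
    ring
  have hbP : |b| ≤ P := by
    rw [hb]
    refine (abs_real_inner_le_norm _ _).trans ?_
    rw [hν, one_mul]
    exact hp
  have hP2 : P ≤ P ^ 3 := le_self_pow₀ hP three_ne_zero
  have hP3 : 1 ≤ P ^ 3 := one_le_pow₀ hP
  rw [← ht, ← ha, ← hb, hpv, hvn]
  have c1 : a * ⟪p, t⟫_ℝ ≤ P * (‖t‖ * |a|) := by
    calc a * ⟪p, t⟫_ℝ ≤ |a * ⟪p, t⟫_ℝ| := le_abs_self _
      _ ≤ |a| * (‖p‖ * ‖t‖) := by
        rw [abs_mul]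
        gcongr
        exact abs_real_inner_le_norm _ _
      _ ≤ |a| * (P * ‖t‖) := by gcongr
      _ = _ := by ring
  have c2 : -b * ‖t‖ ^ 2 ≤ P * ‖t‖ ^ 2 := by
    gcongr
    linarith [abs_le.1 hbP]
  have c3 : a * (l * U) ≤ P * (|a| * |U|) := by
    calc a * (l * U) ≤ |a * (l * U)| := le_abs_self _
      _ = |l| * (|a| * |U|) := by rw [abs_mul, abs_mul]; ring
      _ ≤ _ := by gcongr
  have c4 : b * (‖p‖ ^ 2 * (U * U)) ≤ P * (P ^ 2 * (U * U)) := by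
    calc b * (‖p‖ ^ 2 * (U * U)) ≤ P * (‖p‖ ^ 2 * (U * U)) := by
          have : 0 ≤ ‖p‖ ^ 2 * (U * U) := mul_nonneg (by positivity) (mul_self_nonneg U)
          gcongr
          linarith [abs_le.1 hbP]
      _ ≤ _ := by
          have := mul_self_nonneg U
          gcongr
  have c5 : -(a * (m * U)) ≤ P * (|a| * |U|) := by
    calc -(a * (m * U)) ≤ |a * (m * U)| := neg_le_abs _
      _ = |m| * (|a| * |U|) := by rw [abs_mul, abs_mul]; ring
      _ ≤ _ := by gcongr
  have c6 : d * (a * U) ≤ h ^ 3 * (|a| * |U|) := by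
    calc d * (a * U) ≤ d * |a * U| := by gcongr; exact le_abs_self _
      _ ≤ h ^ 3 * |a * U| := by gcongr
      _ = _ := by rw [abs_mul]
  have d1 : 4 * h ^ 3 * (a * ⟪p, t⟫_ℝ) ≤ 4 * h ^ 3 * (P ^ 3 * (‖t‖ * |a|)) := by
    refine mul_le_mul_of_nonneg_left (c1.trans ?_) (by positivity)
    gcongr
  have d2 : 2 * h ^ 3 * (-b * ‖t‖ ^ 2) ≤ 2 * h ^ 3 * (P ^ 3 * ‖t‖ ^ 2) := by
    refine mul_le_mul_of_nonneg_left (c2.trans ?_) (by positivity)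
    gcongr
  have d3 : 2 * h ^ 3 * (a * (l * U)) ≤ 2 * h ^ 3 * (P ^ 3 * (|a| * |U|)) := by
    refine mul_le_mul_of_nonneg_left (c3.trans ?_) (by positivity)
    gcongr
  have d4 : 2 * h * (b * (‖p‖ ^ 2 * (U * U))) ≤ 2 * h * (P * (P ^ 2 * (U * U))) := by gcongr
  have d5 : 4 * h ^ 3 * (-(a * (m * U))) ≤ 4 * h ^ 3 * (P ^ 3 * (|a| * |U|)) := by
    refine mul_le_mul_of_nonneg_left (c5.trans ?_) (by positivity)
    gcongr
  have d6 : h ^ 3 * (|a| * |U|) ≤ P ^ 3 * (h ^ 3 * (|a| * |U|)) :=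
    le_mul_of_one_le_left (by positivity) hP3
  have f1 : 0 ≤ P ^ 3 * (h ^ 3 * (‖t‖ * |a|)) := by positivity
  have f2 : 0 ≤ P ^ 3 * (h ^ 3 * ‖t‖ ^ 2) := by positivity
  have f3 : 0 ≤ P ^ 3 * (h ^ 3 * (|a| * |U|)) := by positivity
  have f4 : 0 ≤ P ^ 3 * (h * U ^ 2) := by positivity
  linarith

theorem sum_mul_carlemanFlux (h d : ℝ) (f m u : Rn n → ℝ) (ν x : Rn n) :
    ∑ j, ν j * carlemanFlux h f m d u j x =
      -4 * h ^ 3 * (⟪ν, gradient u x⟫_ℝ * ⟪gradient f x, gradient u x⟫_ℝ)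
      + 2 * h ^ 3 * (⟪ν, gradient f x⟫_ℝ * ‖gradient u x‖ ^ 2)
      - 2 * h ^ 3 * (⟪ν, gradient u x⟫_ℝ * (lapl f x * u x))
      - 2 * h * (⟪ν, gradient f x⟫_ℝ * (‖gradient f x‖ ^ 2 * (u x * u x)))
      + 4 * h ^ 3 * (⟪ν, gradient u x⟫_ℝ * (m x * u x)) - d * (⟪ν, gradient u x⟫_ℝ * u x) := by
  rw [← gradDot_eq_inner, ← gradDot_self, ← gradDot_self, inner_eq_sum, inner_eq_sum]
  simp only [gradient_apply, Finset.sum_mul, Finset.mul_sum, ← Finset.sum_add_distrib,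
    ← Finset.sum_sub_distrib]
  refine Finset.sum_congr rfl fun j _ => ?_
  rw [carlemanFlux]
  ring

theorem integral_le_mul_integral_of_le_smul {α : Type*} [MeasurableSpace α] {σ μ : Measure α}
    {b : ℝ≥0} (h : σ ≤ b • μ) {g : α → ℝ} (hg0 : 0 ≤ᵐ[μ] g) (hg : Integrable g μ) :
    ∫ x, g x ∂σ ≤ b * ∫ x, g x ∂μ := by
  have h1 := integral_mono_measure h (Measure.smul_absolutelyContinuous.ae_le hg0)
    (hg.smul_measure_nnreal (c := b))
  rwa [integral_smul_nnreal_measure] at h1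

theorem integrable_surfaceMeasure {Ω : Set (Rn n)} (hΩb : Bornology.IsBounded Ω)
    [IsFiniteMeasure (surfaceMeasure Ω)] {g : Rn n → ℝ} (hg : ContinuousOn g (frontier Ω)) :
    Integrable g (surfaceMeasure Ω) := by
  have hfc : IsCompact (frontier Ω) :=
    Metric.isCompact_of_isClosed_isBounded isClosed_frontier
      (hΩb.closure.subset frontier_subset_closure)
  have h1 : IntegrableOn g (frontier Ω) (surfaceMeasure Ω) := hg.integrableOn_compact hfc
  rwa [IntegrableOn, surfaceMeasure, Measure.restrict_restrict isClosed_frontier.measurableSet,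
    Set.inter_self] at h1

theorem ae_surfaceMeasure_mem_frontier (Ω : Set (Rn n)) :
    ∀ᵐ x ∂surfaceMeasure Ω, x ∈ frontier Ω :=
  ae_restrict_mem isClosed_frontier.measurableSet

theorem integrableOn_of_continuous {E : Type*} [NormedAddCommGroup E] {Ω : Set (Rn n)}
    (hΩb : Bornology.IsBounded Ω) {g : Rn n → E} (hg : Continuous g) : IntegrableOn g Ω :=
  (hg.continuousOn.integrableOn_compact
    (Metric.isCompact_of_isClosed_isBounded isClosed_closure hΩb.closure)).mono_set subset_closure

theorem smoothNormalDeriv_eq_inner (Ω : Set (Rn n)) (f : Rn n → ℝ) (x : Rn n) :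
    smoothNormalDeriv Ω f x = ⟪outerNormal Ω x, gradient f x⟫_ℝ := by
  rw [real_inner_comm, gradient, InnerProductSpace.toDual_symm_apply]
  rfl

theorem smoothNormalDeriv_convexWeight (Ω : Set (Rn n)) {φ : Rn n → ℝ} (hφ : ContDiff ℝ ∞ φ)
    (θ : ℝ) (x : Rn n) : smoothNormalDeriv Ω (convexWeight φ θ) x =
      (1 + θ * φ x) * smoothNormalDeriv Ω φ x := by
  rw [smoothNormalDeriv_eq_inner, smoothNormalDeriv_eq_inner,
    inner_eq_sum, inner_eq_sum, Finset.mul_sum]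
  refine Finset.sum_congr rfl fun j _ => ?_
  rw [gradient_apply, gradient_apply, pderiv_convexWeight hφ]
  ring

theorem continuousOn_smoothNormalDeriv {Ω : Set (Rn n)} (hΩ : HasC2Boundary Ω) {f : Rn n → ℝ}
    (hf : ContDiff ℝ ∞ f) : ContinuousOn (smoothNormalDeriv Ω f) (frontier Ω) :=
  (hf.continuous_fderiv (by simp)).continuousOn.clm_apply (continuousOn_outerNormal hΩ)

theorem measurableSet_boundaryPlus {Ω : Set (Rn n)} (hΩ : HasC2Boundary Ω) {f : Rn n → ℝ}
    (hf : ContDiff ℝ ∞ f) : MeasurableSet (boundaryPlus Ω f) :=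
  ((continuousOn_smoothNormalDeriv hΩ hf).preimage_isClosed_of_isClosed isClosed_frontier
    isClosed_Ici).measurableSet

theorem measurableSet_boundaryMinus {Ω : Set (Rn n)} (hΩ : HasC2Boundary Ω) {f : Rn n → ℝ}
    (hf : ContDiff ℝ ∞ f) : MeasurableSet (boundaryMinus Ω f) :=
  ((continuousOn_smoothNormalDeriv hΩ hf).neg.preimage_isClosed_of_isClosed isClosed_frontier
    isClosed_Ici).measurableSet

theorem ContDiff.continuous_cgrad {w : Rn n → ℂ} (hw : ContDiff ℝ ∞ w) : Continuous (cgrad w) :=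
  (PiLp.continuous_toLp 2 _).comp (continuous_pi fun j => (hw.pderiv j).continuous)

theorem continuousOn_normalPart_cgrad {Ω : Set (Rn n)} (hΩ : HasC2Boundary Ω) {w : Rn n → ℂ}
    (hw : ContDiff ℝ ∞ w) :
    ContinuousOn (fun x => normalPart (outerNormal Ω x) (cgrad w x)) (frontier Ω) := by
  refine continuousOn_finsetSum _ fun j _ => ContinuousOn.mul ?_ (hw.pderiv j).continuous.continuousOn
  exact Complex.continuous_ofReal.comp_continuousOn
    ((EuclideanSpace.proj (𝕜 := ℝ) j).continuous.comp_continuousOn (continuousOn_outerNormal hΩ))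

theorem continuousOn_tangentialPart_cgrad {Ω : Set (Rn n)} (hΩ : HasC2Boundary Ω) {w : Rn n → ℂ}
    (hw : ContDiff ℝ ∞ w) :
    ContinuousOn (fun x => tangentialPart (outerNormal Ω x) (cgrad w x)) (frontier Ω) := by
  refine (PiLp.continuous_toLp 2 _).comp_continuousOn (continuousOn_pi.2 fun j => ?_)
  refine (hw.pderiv j).continuous.continuousOn.sub ((continuousOn_normalPart_cgrad hΩ hw).mul ?_)
  exact Complex.continuous_ofReal.comp_continuousOn
    ((EuclideanSpace.proj (𝕜 := ℝ) j).continuous.comp_continuousOn (continuousOn_outerNormal hΩ))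

/-- The divergence theorem for a smooth vector field. -/
theorem integral_div_eq {Ω : Set (Rn n)} (hΩb : Bornology.IsBounded Ω) (hΩ : HasC2Boundary Ω)
    [IsFiniteMeasure (surfaceMeasure Ω)] {σ : Measure (Rn n)} {b : ℝ≥0}
    (hb : σ ≤ b • surfaceMeasure Ω)
    (hσ : ∀ F : Rn n → ℝ, ContDiff ℝ 1 F → ∀ w : Rn n,
      ∫ x in Ω, fderiv ℝ F x w = ∫ x, ⟪outerNormal Ω x, w⟫_ℝ * F x ∂σ)
    {F : Fin n → Rn n → ℝ} (hF : ∀ j, ContDiff ℝ ∞ (F j)) :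
    ∫ x in Ω, ∑ j, pderiv j (F j) x = ∫ x, ∑ j, outerNormal Ω x j * F j x ∂σ := by
  rw [integral_finsetSum _ fun j _ => integrableOn_of_continuous hΩb ((hF j).pderiv j).continuous,
    integral_finsetSum]
  · refine Finset.sum_congr rfl fun j _ => ?_
    refine (hσ (F j) ((hF j).of_le (by norm_cast)) (stdVec j)).trans ?_
    refine integral_congr_ae (Eventually.of_forall fun x => ?_)
    simp [stdVec, EuclideanSpace.inner_single_right]
  · intro j _
    refine ((integrable_surfaceMeasure hΩb ?_).smul_measure_nnreal (c := b)).mono_measure hb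
    exact ((EuclideanSpace.proj (𝕜 := ℝ) j).continuous.comp_continuousOn
      (continuousOn_outerNormal hΩ)).mul (hF j).continuous.continuousOn

/-- The pointwise estimate for the boundary flux of the real and imaginary parts together. -/
theorem neg_normal_flux_complex_le {h d P : ℝ} {f m : Rn n → ℝ} {w : Rn n → ℂ}
    (hw : ContDiff ℝ ∞ w) {ν x : Rn n} (hh : 0 < h) (hd0 : 0 ≤ d)
    (hd : d ≤ h ^ 3) (hP : 1 ≤ P) (hp : ‖gradient f x‖ ≤ P) (hl : |lapl f x| ≤ P) (hm : |m x| ≤ P)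
    (hν : ‖ν‖ = 1) :
    -(∑ j, ν j * (carlemanFlux h f m d (fun x => (w x).re) j x +
        carlemanFlux h f m d (fun x => (w x).im) j x)) ≤
    2 * h ^ 3 * (⟪ν, gradient f x⟫_ℝ * ‖normalPart ν (cgrad w x)‖ ^ 2) + 8 * P ^ 3 *
      (h * ‖w x‖ ^ 2 + h ^ 3 * (‖normalPart ν (cgrad w x)‖ * ‖w x‖)
        + h ^ 3 * ‖tangentialPart ν (cgrad w x)‖ ^ 2
        + h ^ 3 * (‖tangentialPart ν (cgrad w x)‖ * ‖normalPart ν (cgrad w x)‖)) := by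
  have e1 := neg_normal_flux_le (p := gradient f x) (U := (w x).re) (l := lapl f x) (m := m x)
    (v := gradient (fun x => (w x).re) x) hh hd0 hd hP hp hl hm hν
  have e2 := neg_normal_flux_le (p := gradient f x) (U := (w x).im) (l := lapl f x) (m := m x)
    (v := gradient (fun x => (w x).im) x) hh hd0 hd hP hp hl hm hν
  have s1 := sum_mul_carlemanFlux h d f m (fun x => (w x).re) ν x
  have s2 := sum_mul_carlemanFlux h d f m (fun x => (w x).im) ν x
  have hN : ‖normalPart ν (cgrad w x)‖ ^ 2 = ⟪ν, gradient (fun x => (w x).re) x⟫_ℝ ^ 2 +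
      ⟪ν, gradient (fun x => (w x).im) x⟫_ℝ ^ 2 := by
    rw [norm_sq_re_add_im, normalPart_cgrad_re hw, normalPart_cgrad_im hw]
  have hT := norm_sq_tangentialPart_cgrad hw ν x
  have hW := norm_sq_re_add_im (w x)
  have a1 := add_mul_le_of_sq_eq (norm_nonneg (normalPart ν (cgrad w x))) (norm_nonneg (w x))
    (a := |⟪ν, gradient (fun x => (w x).re) x⟫_ℝ|) (b := |⟪ν, gradient (fun x => (w x).im) x⟫_ℝ|)
    (c := |(w x).re|) (d := |(w x).im|) (by simpa only [sq_abs] using hN)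
    (by simpa only [sq_abs] using hW)
  have a2 := add_mul_le_of_sq_eq (norm_nonneg (tangentialPart ν (cgrad w x)))
    (norm_nonneg (normalPart ν (cgrad w x))) hT
    (c := |⟪ν, gradient (fun x => (w x).re) x⟫_ℝ|) (d := |⟪ν, gradient (fun x => (w x).im) x⟫_ℝ|)
    (by simpa only [sq_abs] using hN)
  simp only [mul_add, Finset.sum_add_distrib, neg_add]
  rw [s1, s2]
  refine (add_le_add e1 e2).trans ?_
  rw [hN, hW, hT]
  have b1 := mul_le_mul_of_nonneg_left a1 (by positivity : 0 ≤ 8 * P ^ 3 * h ^ 3)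
  have b2 := mul_le_mul_of_nonneg_left a2 (by positivity : 0 ≤ 8 * P ^ 3 * h ^ 3)
  linarith

/-- Bounds for the coefficients of the boundary flux that are uniform in `h` and `ε`. -/
theorem CarlemanBounds.convexWeight_bounds {K : Set (Rn n)} {φ lam : Rn n → ℝ} {B s₀ θ : ℝ}
    (hφ : ContDiff ℝ ∞ φ) (H : CarlemanBounds K φ lam B s₀) (hθ0 : 0 ≤ θ) (hθ1 : θ * B ≤ 1 / 2)
    {x : Rn n} (hx : x ∈ K) :
    ‖gradient (convexWeight φ θ) x‖ ≤ 4 * B ^ 2 ∧ |lapl (convexWeight φ θ) x| ≤ 4 * B ^ 2 ∧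
      |carlemanMultiplier φ lam θ x| ≤ 4 * B ^ 2 := by
  have hB := H.one_le
  obtain ⟨hg1, hg2⟩ := H.one_add_mem hθ0 hθ1 hx
  have hg : |1 + θ * φ x| ≤ 2 := abs_le.2 ⟨by linarith, hg2⟩
  refine ⟨?_, ?_, ?_⟩
  · have h1 : gradient (convexWeight φ θ) x = (1 + θ * φ x) • gradient φ x := by
      ext j
      rw [gradient_apply, pderiv_convexWeight hφ, PiLp.smul_apply, gradient_apply, smul_eq_mul]
    rw [h1, norm_smul, Real.norm_eq_abs]
    have := mul_le_mul hg (H.grad x hx) (norm_nonneg _) zero_le_two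
    nlinarith
  · have h0 : lapl (convexWeight φ θ) x = (1 + θ * φ x) * lapl φ x + θ * ‖gradient φ x‖ ^ 2 := by
      rw [lapl_convexWeight hφ, ← gradDot_self]
      ring
    rw [h0]
    have h1 := mul_le_mul hg (H.lap x hx) (abs_nonneg _) zero_le_two
    have h2 : ‖gradient φ x‖ ^ 2 ≤ B ^ 2 := by
      have := H.grad x hx
      gcongr
    have h3 : θ * ‖gradient φ x‖ ^ 2 ≤ θ * B ^ 2 := by gcongr
    rw [← abs_mul] at h1
    have h4 : 0 ≤ θ * ‖gradient φ x‖ ^ 2 := by positivity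
    rw [abs_le] at h1 ⊢
    constructor <;> nlinarith
  · rw [carlemanMultiplier, abs_mul]
    have := mul_le_mul hg (H.lam_le x hx) (abs_nonneg _) zero_le_two
    nlinarith

/-- The integrated Carleman inequality, with the boundary flux written as an integral against a
measure that satisfies the divergence theorem. -/
theorem CarlemanBounds.integral_le {Ω : Set (Rn n)} (hΩo : IsOpen Ω) (hΩb : Bornology.IsBounded Ω)
    (hΩ : HasC2Boundary Ω) [IsFiniteMeasure (surfaceMeasure Ω)] {σ : Measure (Rn n)} {b : ℝ≥0}
    (hb : σ ≤ b • surfaceMeasure Ω)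
    (hσ : ∀ F : Rn n → ℝ, ContDiff ℝ 1 F → ∀ w : Rn n,
      ∫ x in Ω, fderiv ℝ F x w = ∫ x, ⟪outerNormal Ω x, w⟫_ℝ * F x ∂σ)
    {φ lam : Rn n → ℝ} {B s₀ : ℝ}
    (hφ : ContDiff ℝ ∞ φ) (hlam : ContDiff ℝ ∞ lam) (H : CarlemanBounds (closure Ω) φ lam B s₀)
    {δ ε h : ℝ} (hδ0 : 0 < δ) (hδ1 : δ ≤ 1) (hδ : δ * (4 * B ^ 2 + 1) ≤ s₀ ^ 2 / 2)
    (hε0 : 0 < ε) (hε1 : 12 * (4 * B ^ 2) ^ 2 * ε ≤ s₀ ^ 2 / 4)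
    (hε2 : 12 * (4 * B ^ 2) ^ 2 * ε ≤ δ / 2) (hε3 : ε ≤ 1) (hh : 0 < h)
    (hhε : h / ε * B ≤ 1 / 2) {w : Rn n → ℂ} (hw : ContDiff ℝ ∞ w) :
    min (s₀ ^ 2 / 4) (δ / 2) * (h ^ 2 / ε) *
        ((∫ x in Ω, ‖w x‖ ^ 2) + h ^ 2 * ∫ x in Ω, ‖cgrad w x‖ ^ 2) ≤
      (∫ x in Ω, ‖conjOpC h (convexWeight φ (h / ε)) w x‖ ^ 2) +
      ∫ x, (2 * h ^ 3 * (smoothNormalDeriv Ω (convexWeight φ (h / ε)) x *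
          ‖normalPart (outerNormal Ω x) (cgrad w x)‖ ^ 2) + 8 * (4 * B ^ 2) ^ 3 *
      (h * ‖w x‖ ^ 2 + h ^ 3 * (‖normalPart (outerNormal Ω x) (cgrad w x)‖ * ‖w x‖)
        + h ^ 3 * ‖tangentialPart (outerNormal Ω x) (cgrad w x)‖ ^ 2
        + h ^ 3 * (‖tangentialPart (outerNormal Ω x) (cgrad w x)‖ *
            ‖normalPart (outerNormal Ω x) (cgrad w x)‖))) ∂σ := by
  have hB := H.one_le
  set θ := h / ε with hθ
  have hθ0 : 0 < θ := by positivity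
  have hθ1 : θ ≤ 1 / 2 := by nlinarith
  set f := convexWeight φ θ with hf_def
  set m := carlemanMultiplier φ lam θ with hm_def
  set d := δ * (h * θ) * h ^ 2 with hd_def
  set κ := min (s₀ ^ 2 / 4) (δ / 2) with hκ
  have hf : ContDiff ℝ ∞ f := hφ.convexWeight θ
  have hm : ContDiff ℝ ∞ m := by
    rw [hm_def]
    unfold carlemanMultiplier
    fun_prop
  have hre := hw.complex_re
  have him := hw.complex_im
  have hd0 : 0 ≤ d := by positivity
  have hd1 : d ≤ h ^ 3 := by
    have : d = δ * θ * h ^ 3 := by rw [hd_def]; ring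
    rw [this]
    refine mul_le_of_le_one_left (by positivity) ?_
    nlinarith
  have hF : ∀ j, ContDiff ℝ ∞ (fun x => carlemanFlux h f m d (fun x => (w x).re) j x +
      carlemanFlux h f m d (fun x => (w x).im) j x) := fun j =>
    (hf.carlemanFlux hm hre j).add (hf.carlemanFlux hm him j)
  have hdiv := integral_div_eq hΩb hΩ hb hσ hF
  have hcP : Continuous (conjOpC h f w) := by
    have h1 : Continuous (lapl w) := hw.lapl.continuous
    have h2 : Continuous (gradDot f f) := (hf.gradDot hf).continuous
    have h3 : Continuous (lapl f) := hf.lapl.continuous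
    have h4 : ∀ j, Continuous (pderiv j f) := fun j => (hf.pderiv j).continuous
    have h5 : ∀ j, Continuous (pderiv j w) := fun j => (hw.pderiv j).continuous
    have h6 := hw.continuous
    unfold conjOpC
    fun_prop
  have hcg := hw.continuous_cgrad
  have hpt : ∀ x ∈ Ω, (∑ j, pderiv j (fun x => carlemanFlux h f m d (fun x => (w x).re) j x +
      carlemanFlux h f m d (fun x => (w x).im) j x) x) +
      κ * (h ^ 2 / ε) * (‖w x‖ ^ 2 + h ^ 2 * ‖cgrad w x‖ ^ 2) ≤ ‖conjOpC h f w x‖ ^ 2 := by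
    intro x hx
    have e1 := H.div_flux_add_le hφ hlam hδ0 hδ1 hδ hε0 hε1 hε2 hε3 hh hhε hre (subset_closure hx)
    have e2 := H.div_flux_add_le hφ hlam hδ0 hδ1 hδ hε0 hε1 hε2 hε3 hh hhε him (subset_closure hx)
    rw [norm_sq_conjOpC hw, norm_sq_re_add_im (w x), norm_sq_cgrad hw]
    rw [Finset.sum_congr rfl fun j _ => pderiv_add (hf.carlemanFlux hm hre j)
      (hf.carlemanFlux hm him j) j x, Finset.sum_add_distrib]
    linarith
  have i1 : IntegrableOn (fun x => ∑ j, pderiv j (fun x =>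
      carlemanFlux h f m d (fun x => (w x).re) j x +
      carlemanFlux h f m d (fun x => (w x).im) j x) x) Ω :=
    integrableOn_of_continuous hΩb (continuous_finsetSum _ fun j _ => ((hF j).pderiv j).continuous)
  have i2 : IntegrableOn (fun x => ‖w x‖ ^ 2) Ω :=
    integrableOn_of_continuous hΩb (hw.continuous.norm.pow 2)
  have i3 : IntegrableOn (fun x => ‖cgrad w x‖ ^ 2) Ω :=
    integrableOn_of_continuous hΩb (hcg.norm.pow 2)
  have i4 : IntegrableOn (fun x => ‖conjOpC h f w x‖ ^ 2) Ω :=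
    integrableOn_of_continuous hΩb (hcP.norm.pow 2)
  have i5 : IntegrableOn (fun x => κ * (h ^ 2 / ε) * (‖w x‖ ^ 2 + h ^ 2 * ‖cgrad w x‖ ^ 2)) Ω :=
    (i2.add (i3.const_mul (h ^ 2))).const_mul _
  have hint := setIntegral_mono_on (i1.add i5) i4 hΩo.measurableSet hpt
  simp only [Pi.add_apply] at hint
  rw [integral_add i1 i5, integral_const_mul, integral_add i2 (i3.const_mul (h ^ 2)),
    integral_const_mul, hdiv] at hint
  have hcN := continuousOn_normalPart_cgrad hΩ hw
  have hcT := continuousOn_tangentialPart_cgrad hΩ hw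
  have hcf := continuousOn_smoothNormalDeriv hΩ hf
  have hcw : ContinuousOn w (frontier Ω) := hw.continuous.continuousOn
  have hσint : ∀ g : Rn n → ℝ, ContinuousOn g (frontier Ω) → Integrable g σ := fun g hg =>
    ((integrable_surfaceMeasure hΩb hg).smul_measure_nnreal (c := b)).mono_measure hb
  have hσae : ∀ᵐ x ∂σ, x ∈ frontier Ω :=
    (Measure.absolutelyContinuous_of_le hb).ae_le
      (Measure.smul_absolutelyContinuous.ae_le (ae_surfaceMeasure_mem_frontier Ω))
  have hbd := integral_mono_ae (μ := σ)
    (f := fun x => -(∑ j, outerNormal Ω x j * (carlemanFlux h f m d (fun x => (w x).re) j x +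
        carlemanFlux h f m d (fun x => (w x).im) j x)))
    (g := fun x => 2 * h ^ 3 * (smoothNormalDeriv Ω f x *
          ‖normalPart (outerNormal Ω x) (cgrad w x)‖ ^ 2) + 8 * (4 * B ^ 2) ^ 3 *
      (h * ‖w x‖ ^ 2 + h ^ 3 * (‖normalPart (outerNormal Ω x) (cgrad w x)‖ * ‖w x‖)
        + h ^ 3 * ‖tangentialPart (outerNormal Ω x) (cgrad w x)‖ ^ 2
        + h ^ 3 * (‖tangentialPart (outerNormal Ω x) (cgrad w x)‖ *
            ‖normalPart (outerNormal Ω x) (cgrad w x)‖)))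
    (hσint _ (continuousOn_finsetSum _ fun j _ => ContinuousOn.mul
      ((EuclideanSpace.proj (𝕜 := ℝ) j).continuous.comp_continuousOn
      (continuousOn_outerNormal hΩ)) (hF j).continuous.continuousOn).neg)
    (hσint _ (by fun_prop)) (by
      filter_upwards [hσae] with x hx
      obtain ⟨k1, k2, k3⟩ := H.convexWeight_bounds hφ hθ0.le hhε (frontier_subset_closure hx)
      rw [smoothNormalDeriv_eq_inner]
      exact neg_normal_flux_complex_le hw hh hd0 hd1 (by nlinarith) k1 k2 k3
        (norm_outerNormal hΩ hx))
  rw [integral_neg] at hbd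
  linarith

/-- The passage from the measure of the divergence theorem, whose integrals carry the subscript `1`,
to surface measure. Here `M` and `M'` are the parts of the weighted normal term on which the normal
derivative of the weight is nonnegative and nonpositive. The term `M'` appears on the left with a
favourable sign, the other terms appear on the right with a favourable sign, so that one-sided
comparison of the measures suffices for each of them. -/
theorem comparable_boundary_terms {h ε κ Q b₁ b₂ X Y W NW T2 TN M M' W₁ NW₁ T2₁ TN₁ M₁ M'₁ : ℝ}
    (hh : 0 < h) (hε : 0 < ε) (hκ0 : 0 < κ) (hP : 2 ≤ Q) (hb₁0 : 0 ≤ b₁) (hb₂0 : 0 ≤ b₂)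
    (key : κ * (h ^ 2 / ε) * X ≤ Y + (2 * h ^ 3 * (M₁ + M'₁) +
      Q * (h * W₁ + h ^ 3 * NW₁ + h ^ 3 * T2₁ + h ^ 3 * TN₁)))
    (j1 : W₁ ≤ b₁ * W) (j2 : NW₁ ≤ b₁ * NW) (j3 : T2₁ ≤ b₁ * T2) (j4 : TN₁ ≤ b₁ * TN)
    (j5 : M₁ ≤ b₁ * M) (j6 : -M' ≤ b₂ * -M'₁) (j7 : 0 ≤ -M'₁) (j8 : 0 ≤ M) (k1 : 0 ≤ W)
    (k2 : 0 ≤ NW) (k3 : 0 ≤ T2) (k4 : 0 ≤ TN) (k5 : 0 ≤ Y) (k6 : 0 ≤ X) :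
    h ^ 2 / ε * X - h ^ 3 * M' ≤ (1 / κ + b₂) * (1 + Q * b₁) * h * W
      + (1 / κ + b₂) * (1 + Q * b₁) * h ^ 3 * NW + (1 / κ + b₂) * (1 + Q * b₁) * h ^ 3 * M
      + (1 / κ + b₂) * (1 + Q * b₁) * h ^ 3 * T2 + (1 / κ + b₂) * (1 + Q * b₁) * h ^ 3 * TN
      + (1 / κ + b₂) * (1 + Q * b₁) * Y := by
  obtain ⟨S, hS⟩ : ∃ S, S = h * W + h ^ 3 * NW + h ^ 3 * M + h ^ 3 * T2 + h ^ 3 * TN := ⟨_, rfl⟩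
  have hS0 : 0 ≤ S := by rw [hS]; positivity
  have r1 : κ * (h ^ 2 / ε * X) + 2 * (h ^ 3 * -M'₁) ≤ Y + Q * (b₁ * S) := by
    have m1 : Q * (h * W₁) ≤ Q * (h * (b₁ * W)) := by gcongr
    have m2 : Q * (h ^ 3 * NW₁) ≤ Q * (h ^ 3 * (b₁ * NW)) := by gcongr
    have m3 : Q * (h ^ 3 * T2₁) ≤ Q * (h ^ 3 * (b₁ * T2)) := by gcongr
    have m4 : Q * (h ^ 3 * TN₁) ≤ Q * (h ^ 3 * (b₁ * TN)) := by gcongr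
    have m5 : 2 * (h ^ 3 * M₁) ≤ Q * (h ^ 3 * (b₁ * M)) := by
      calc 2 * (h ^ 3 * M₁) ≤ 2 * (h ^ 3 * (b₁ * M)) := by gcongr
        _ ≤ _ := by gcongr
    rw [hS]
    linear_combination key + m1 + m2 + m3 + m4 + m5
  have r2 : Y + Q * (b₁ * S) ≤ (1 + Q * b₁) * (Y + S) := by
    have : 0 ≤ Q * b₁ * Y := by positivity
    nlinarith
  have r3 : h ^ 3 * -M' ≤ b₂ * (h ^ 3 * -M'₁) := by
    calc h ^ 3 * -M' ≤ h ^ 3 * (b₂ * -M'₁) := by gcongr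
      _ = _ := by ring
  have X0 : 0 ≤ h ^ 2 / ε * X := by positivity
  have Z0 : 0 ≤ h ^ 3 * -M'₁ := by positivity
  generalize h ^ 2 / ε * X = X₁ at *
  have r4 : X₁ ≤ 1 / κ * (κ * X₁ + 2 * (h ^ 3 * -M'₁)) := by
    have : 1 / κ * (κ * X₁ + 2 * (h ^ 3 * -M'₁)) = X₁ + 1 / κ * (2 * (h ^ 3 * -M'₁)) := by
      field_simp
    rw [this]
    have : 0 ≤ 1 / κ * (2 * (h ^ 3 * -M'₁)) := by positivity
    linarith
  have r5 : b₂ * (h ^ 3 * -M'₁) ≤ b₂ * (κ * X₁ + 2 * (h ^ 3 * -M'₁)) := by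
    refine mul_le_mul_of_nonneg_left ?_ hb₂0
    have : 0 ≤ κ * X₁ := by positivity
    linarith
  have r6 : (1 / κ + b₂) * (κ * X₁ + 2 * (h ^ 3 * -M'₁)) ≤
      (1 / κ + b₂) * ((1 + Q * b₁) * (Y + S)) :=
    mul_le_mul_of_nonneg_left (r1.trans r2) (by positivity)
  rw [hS] at r6
  linear_combination r6 + r4 + r5 + r3

/-- The estimate for functions that are smooth up to the boundary. The measure of the divergence
theorem is replaced by the surface measure, which is comparable to it, term by term: each of the
boundary terms has a sign. -/
theorem CarlemanBounds.exists_boundary_estimate {Ω : Set (Rn n)} (hΩo : IsOpen Ω)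
    (hΩb : Bornology.IsBounded Ω) (hΩ : HasC2Boundary Ω)
    {φ lam : Rn n → ℝ} {B s₀ : ℝ}
    (hφ : ContDiff ℝ ∞ φ) (hlam : ContDiff ℝ ∞ lam) (H : CarlemanBounds (closure Ω) φ lam B s₀) :
    ∃ C > (0 : ℝ), ∃ ε₀ > (0 : ℝ), ∃ c₀ > (0 : ℝ),
      ∀ ε : ℝ, 0 < ε → ε ≤ ε₀ → ∀ h : ℝ, 0 < h → h ≤ c₀ * ε →
        ∀ w : Rn n → ℂ, ContDiff ℝ ∞ w →
          h ^ 2 / ε * ((∫ x in Ω, ‖w x‖ ^ 2) + h ^ 2 * ∫ x in Ω, ‖cgrad w x‖ ^ 2)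
            - h ^ 3 * ∫ x in boundaryMinus Ω φ,
                smoothNormalDeriv Ω (convexWeight φ (h / ε)) x *
                  ‖normalPart (outerNormal Ω x) (cgrad w x)‖ ^ 2 ∂(surfaceMeasure Ω)
          ≤ C * h * ∫ x, ‖w x‖ ^ 2 ∂(surfaceMeasure Ω)
            + C * h ^ 3 * ∫ x, ‖normalPart (outerNormal Ω x) (cgrad w x)‖ * ‖w x‖
                ∂(surfaceMeasure Ω)
            + C * h ^ 3 * ∫ x in boundaryPlus Ω φ,
                smoothNormalDeriv Ω (convexWeight φ (h / ε)) x *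
                  ‖normalPart (outerNormal Ω x) (cgrad w x)‖ ^ 2 ∂(surfaceMeasure Ω)
            + C * h ^ 3 * ∫ x, ‖tangentialPart (outerNormal Ω x) (cgrad w x)‖ ^ 2
                ∂(surfaceMeasure Ω)
            + C * h ^ 3 * ∫ x, ‖tangentialPart (outerNormal Ω x) (cgrad w x)‖ *
                ‖normalPart (outerNormal Ω x) (cgrad w x)‖ ∂(surfaceMeasure Ω)
            + C * ∫ x in Ω, ‖conjOpC h (convexWeight φ (h / ε)) w x‖ ^ 2 := by
  obtain ⟨hfin, ⟨σ, hσfin, ⟨b₁, hb₁⟩, ⟨b₂, hb₂⟩, hσ⟩, -⟩ := exists_divergence_measure hΩo hΩb hΩ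
  have hB := H.one_le
  have hs := H.pos
  -- `δ` satisfies the smallness condition of the pointwise inequality, whose gain is then `κ h²/ε`
  obtain ⟨δ, hδ⟩ : ∃ δ, δ = min 1 (s₀ ^ 2 / 2 / (4 * B ^ 2 + 1)) := ⟨_, rfl⟩
  have hδ0 : 0 < δ := by rw [hδ]; positivity
  have hδ1 : δ ≤ 1 := hδ ▸ min_le_left _ _
  have hδ2 : δ * (4 * B ^ 2 + 1) ≤ s₀ ^ 2 / 2 := by
    rw [← le_div_iff₀ (by positivity)]
    exact hδ ▸ min_le_right _ _
  obtain ⟨κ, hκ⟩ : ∃ κ, κ = min (s₀ ^ 2 / 4) (δ / 2) := ⟨_, rfl⟩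
  have hκ0 : 0 < κ := by rw [hκ]; positivity
  have hP : 2 ≤ 8 * (4 * B ^ 2) ^ 3 := by
    have : 1 ≤ 4 * B ^ 2 := by nlinarith
    linarith [one_le_pow₀ this (n := 3)]
  obtain ⟨Q, hQ⟩ : ∃ Q, Q = 8 * (4 * B ^ 2) ^ 3 := ⟨_, rfl⟩
  rw [← hQ] at hP
  have hb₁0 : (0 : ℝ) ≤ b₁ := b₁.2
  have hb₂0 : (0 : ℝ) ≤ b₂ := b₂.2
  -- the bound on `ε` makes the errors of order `h²` smaller than the gain, and the bound on `h/ε`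
  -- keeps `1 + (h/ε) φ` between `1/2` and `2`
  refine ⟨(1 / κ + b₂) * (1 + Q * b₁), by positivity,
    min 1 (κ / (12 * (4 * B ^ 2) ^ 2)), by positivity, 1 / (2 * B), by positivity, ?_⟩
  intro ε hε hεle h hh hhle w hw
  have hεκ : 12 * (4 * B ^ 2) ^ 2 * ε ≤ κ := by
    rw [mul_comm, ← le_div_iff₀ (by positivity)]
    exact hεle.trans (min_le_right _ _)
  have hhε : h / ε * B ≤ 1 / 2 := by
    rw [div_mul_eq_mul_div, div_le_iff₀ hε]
    calc h * B ≤ 1 / (2 * B) * ε * B := by gcongr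
      _ = 1 / 2 * ε := by field_simp
  have key := H.integral_le hΩo hΩb hΩ hb₁ hσ hφ hlam hδ0 hδ1 hδ2 hε
    (hεκ.trans (hκ ▸ min_le_left _ _)) (hεκ.trans (hκ ▸ min_le_right _ _))
    (hεle.trans (min_le_left _ _)) hh hhε hw
  rw [← hκ, ← hQ] at key
  have hθ0 : 0 < h / ε := by positivity
  obtain ⟨f, hf⟩ : ∃ f, f = convexWeight φ (h / ε) := ⟨_, rfl⟩
  have hsgn : ∀ x ∈ frontier Ω, 1 / 2 ≤ 1 + h / ε * φ x := fun x hx =>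
    (H.one_add_mem hθ0.le hhε (frontier_subset_closure hx)).1
  have hfeq : ∀ x, smoothNormalDeriv Ω f x = (1 + h / ε * φ x) * smoothNormalDeriv Ω φ x := fun x =>
    hf ▸ smoothNormalDeriv_convexWeight Ω hφ _ x
  have hfc : ContDiff ℝ ∞ f := hf ▸ hφ.convexWeight _
  rw [← hf] at key ⊢
  have hcN := continuousOn_normalPart_cgrad hΩ hw
  have hcT := continuousOn_tangentialPart_cgrad hΩ hw
  have hcf := continuousOn_smoothNormalDeriv hΩ hfc
  have hcw : ContinuousOn w (frontier Ω) := hw.continuous.continuousOn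
  obtain ⟨N, hN⟩ : ∃ N : Rn n → ℂ, N = fun x => normalPart (outerNormal Ω x) (cgrad w x) :=
    ⟨_, rfl⟩
  obtain ⟨T, hT⟩ : ∃ T : Rn n → EuclideanSpace ℂ (Fin n),
    T = fun x => tangentialPart (outerNormal Ω x) (cgrad w x) := ⟨_, rfl⟩
  have hNx := fun x => congrFun hN x
  have hTx := fun x => congrFun hT x
  rw [← hN] at hcN
  rw [← hT] at hcT
  simp only [← hNx, ← hTx] at key ⊢
  have hμint : ∀ g : Rn n → ℝ, ContinuousOn g (frontier Ω) → Integrable g (surfaceMeasure Ω) :=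
    fun g hg => integrable_surfaceMeasure hΩb hg
  have hσint : ∀ g : Rn n → ℝ, ContinuousOn g (frontier Ω) → Integrable g σ := fun g hg =>
    ((hμint g hg).smul_measure_nnreal (c := b₁)).mono_measure hb₁
  have hσae : ∀ᵐ x ∂σ, x ∈ frontier Ω :=
    (Measure.absolutelyContinuous_of_le hb₁).ae_le
      (Measure.smul_absolutelyContinuous.ae_le (ae_surfaceMeasure_mem_frontier Ω))
  -- the weighted normal term is split according to the sign of the normal derivative of the weight
  have hplus := measurableSet_boundaryPlus hΩ hφ
  have hminus := measurableSet_boundaryMinus hΩ hφ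
  have hgc : ContinuousOn (fun x => smoothNormalDeriv Ω f x * ‖N x‖ ^ 2) (frontier Ω) := by
    fun_prop
  have hsplit : ∫ x, smoothNormalDeriv Ω f x * ‖N x‖ ^ 2 ∂σ =
      (∫ x in boundaryPlus Ω φ, smoothNormalDeriv Ω f x * ‖N x‖ ^ 2 ∂σ) +
      ∫ x in boundaryMinus Ω φ, smoothNormalDeriv Ω f x * ‖N x‖ ^ 2 ∂σ := by
    rw [← integral_indicator hplus, ← integral_indicator hminus,
      ← integral_add ((hσint _ hgc).indicator hplus) ((hσint _ hgc).indicator hminus)]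
    refine integral_congr_ae ?_
    filter_upwards [hσae] with x hx
    rcases lt_trichotomy (smoothNormalDeriv Ω φ x) 0 with h0 | h0 | h0
    · have h1 : x ∉ boundaryPlus Ω φ := fun h => absurd h.2 (not_le.2 h0)
      have h2 : x ∈ boundaryMinus Ω φ := ⟨hx, by linarith⟩
      simp [h1, h2]
    · simp [Set.indicator, hfeq, h0]
    · have h1 : x ∈ boundaryPlus Ω φ := ⟨hx, h0.le⟩
      have h2 : x ∉ boundaryMinus Ω φ := fun h => absurd h.2 (by linarith)
      simp [h1, h2]
  have hσi := hσint _ hgc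
  have j1 : ∫ x, ‖w x‖ ^ 2 ∂σ ≤ b₁ * ∫ x, ‖w x‖ ^ 2 ∂surfaceMeasure Ω :=
    integral_le_mul_integral_of_le_smul hb₁ (Eventually.of_forall fun x => by positivity)
      (hμint _ (by fun_prop))
  have j2 : ∫ x, ‖N x‖ * ‖w x‖ ∂σ ≤ b₁ * ∫ x, ‖N x‖ * ‖w x‖ ∂surfaceMeasure Ω :=
    integral_le_mul_integral_of_le_smul hb₁ (Eventually.of_forall fun x => by positivity)
      (hμint _ (by fun_prop))
  have j3 : ∫ x, ‖T x‖ ^ 2 ∂σ ≤ b₁ * ∫ x, ‖T x‖ ^ 2 ∂surfaceMeasure Ω :=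
    integral_le_mul_integral_of_le_smul hb₁ (Eventually.of_forall fun x => by positivity)
      (hμint _ (by fun_prop))
  have j4 : ∫ x, ‖T x‖ * ‖N x‖ ∂σ ≤ b₁ * ∫ x, ‖T x‖ * ‖N x‖ ∂surfaceMeasure Ω :=
    integral_le_mul_integral_of_le_smul hb₁ (Eventually.of_forall fun x => by positivity)
      (hμint _ (by fun_prop))
  have hrestr : ∀ (S : Set (Rn n)), MeasurableSet S → ∀ (σ μ : Measure (Rn n)) (b : ℝ≥0),
      σ ≤ b • μ → σ.restrict S ≤ b • μ.restrict S := fun S _ σ μ b hle => by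
    rw [← Measure.restrict_smul]
    exact Measure.restrict_mono subset_rfl hle
  have hpos : ∀ x ∈ boundaryPlus Ω φ, 0 ≤ smoothNormalDeriv Ω f x * ‖N x‖ ^ 2 := by
    intro x hx
    rw [hfeq]
    have := hsgn x hx.1
    have := hx.2
    positivity
  have hneg : ∀ x ∈ boundaryMinus Ω φ, 0 ≤ -(smoothNormalDeriv Ω f x * ‖N x‖ ^ 2) := by
    intro x hx
    rw [hfeq]
    have h1 := hsgn x hx.1
    have h2 := hx.2
    have : 0 ≤ (1 + h / ε * φ x) * (-smoothNormalDeriv Ω φ x) * ‖N x‖ ^ 2 := by positivity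
    linarith
  have j5 : ∫ x in boundaryPlus Ω φ, smoothNormalDeriv Ω f x * ‖N x‖ ^ 2 ∂σ ≤
      b₁ * ∫ x in boundaryPlus Ω φ, smoothNormalDeriv Ω f x * ‖N x‖ ^ 2 ∂surfaceMeasure Ω :=
    integral_le_mul_integral_of_le_smul (hrestr _ hplus _ _ _ hb₁)
      ((ae_restrict_mem hplus).mono hpos) (hμint _ hgc).integrableOn
  have j6 : -∫ x in boundaryMinus Ω φ, smoothNormalDeriv Ω f x * ‖N x‖ ^ 2 ∂surfaceMeasure Ω ≤
      b₂ * -∫ x in boundaryMinus Ω φ, smoothNormalDeriv Ω f x * ‖N x‖ ^ 2 ∂σ := by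
    rw [← integral_neg, ← integral_neg]
    exact integral_le_mul_integral_of_le_smul (hrestr _ hminus _ _ _ hb₂)
      ((ae_restrict_mem hminus).mono hneg) hσi.neg.integrableOn
  have j7 : 0 ≤ -∫ x in boundaryMinus Ω φ, smoothNormalDeriv Ω f x * ‖N x‖ ^ 2 ∂σ := by
    rw [← integral_neg]
    exact setIntegral_nonneg hminus hneg
  have j8 : 0 ≤ ∫ x in boundaryPlus Ω φ, smoothNormalDeriv Ω f x * ‖N x‖ ^ 2 ∂surfaceMeasure Ω :=
    setIntegral_nonneg hplus hpos
  have hexp : ∫ x, (2 * h ^ 3 * (smoothNormalDeriv Ω f x * ‖N x‖ ^ 2) + Q * (h * ‖w x‖ ^ 2 +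
      h ^ 3 * (‖N x‖ * ‖w x‖) + h ^ 3 * ‖T x‖ ^ 2 + h ^ 3 * (‖T x‖ * ‖N x‖))) ∂σ =
      2 * h ^ 3 * (∫ x, smoothNormalDeriv Ω f x * ‖N x‖ ^ 2 ∂σ) + Q * (h * (∫ x, ‖w x‖ ^ 2 ∂σ) +
      h ^ 3 * (∫ x, ‖N x‖ * ‖w x‖ ∂σ) + h ^ 3 * (∫ x, ‖T x‖ ^ 2 ∂σ) +
      h ^ 3 * ∫ x, ‖T x‖ * ‖N x‖ ∂σ) := by
    rw [integral_add, integral_const_mul, integral_const_mul, integral_add, integral_add,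
      integral_add, integral_const_mul, integral_const_mul, integral_const_mul, integral_const_mul]
    all_goals exact hσint _ (by fun_prop)
  rw [hexp, hsplit] at key
  have k1 : 0 ≤ ∫ x, ‖w x‖ ^ 2 ∂surfaceMeasure Ω := integral_nonneg fun x => by positivity
  have k2 : 0 ≤ ∫ x, ‖N x‖ * ‖w x‖ ∂surfaceMeasure Ω := integral_nonneg fun x => by positivity
  have k3 : 0 ≤ ∫ x, ‖T x‖ ^ 2 ∂surfaceMeasure Ω := integral_nonneg fun x => by positivity
  have k4 : 0 ≤ ∫ x, ‖T x‖ * ‖N x‖ ∂surfaceMeasure Ω := integral_nonneg fun x => by positivity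
  have k5 : 0 ≤ ∫ x in Ω, ‖conjOpC h f w x‖ ^ 2 := integral_nonneg fun x => by positivity
  have k6 : 0 ≤ (∫ x in Ω, ‖w x‖ ^ 2) + h ^ 2 * ∫ x in Ω, ‖cgrad w x‖ ^ 2 := by
    have l1 : 0 ≤ ∫ x in Ω, ‖w x‖ ^ 2 := integral_nonneg fun x => by positivity
    have l2 : 0 ≤ ∫ x in Ω, ‖cgrad w x‖ ^ 2 := integral_nonneg fun x => by positivity
    positivity
  exact comparable_boundary_terms hh hε hκ0 hP hb₁0 hb₂0 key j1 j2 j3 j4 j5 j6 j7 j8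
    k1 k2 k3 k4 k5 k6

end Smooth

/-! ### Smooth approximation in the second order Sobolev space -/

section Approximation

variable {n : ℕ}

open scoped FourierTransform LineDeriv Real

theorem norm_toLp_fourierMultiplierCLM_le {g : Rn n → ℂ} (hg : g.HasTemperateGrowth) {C : ℝ}
    (hC : ∀ x, ‖g x‖ ≤ C) (f : 𝓢(Rn n, ℂ)) :
    ‖(SchwartzMap.fourierMultiplierCLM ℂ g f).toLp 2‖ ≤ C * ‖f.toLp 2‖ := by
  rw [SchwartzMap.fourierMultiplierCLM_apply, ← SchwartzMap.norm_fourier_toL2_eq,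
    FourierTransform.fourier_fourierInv_eq, ← SchwartzMap.norm_fourier_toL2_eq f]
  refine Lp.norm_le_mul_norm_of_ae_le_mul ?_
  filter_upwards [(SchwartzMap.smulLeftCLM ℂ g (𝓕 f)).coeFn_toLp 2 volume,
    (𝓕 f).coeFn_toLp 2 volume] with x h1 h2
  rw [h1, h2, SchwartzMap.smulLeftCLM_apply_apply hg, norm_smul]
  exact mul_le_mul_of_nonneg_right (hC x) (norm_nonneg _)

/-- A bounded Fourier multiplier maps `L²`-convergent sequences of Schwartz functions to
`L²`-convergent sequences. -/
theorem exists_tendsto_fourierMultiplierCLM {g : Rn n → ℂ} (hg : g.HasTemperateGrowth) {C : ℝ}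
    (hC : ∀ x, ‖g x‖ ≤ C) {G : ℕ → 𝓢(Rn n, ℂ)} {G₀ : Lp ℂ 2 (volume : Measure (Rn n))}
    (hG : Tendsto (fun k => (G k).toLp 2) atTop (𝓝 G₀)) :
    ∃ W : Lp ℂ 2 (volume : Measure (Rn n)),
      Tendsto (fun k => (SchwartzMap.fourierMultiplierCLM ℂ g (G k)).toLp 2) atTop (𝓝 W) := by
  refine cauchySeq_tendsto_of_complete ?_
  have hC0 : 0 ≤ C := (norm_nonneg _).trans (hC 0)
  have hlin : ∀ k l, dist ((SchwartzMap.fourierMultiplierCLM ℂ g (G k)).toLp 2 volume)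
      ((SchwartzMap.fourierMultiplierCLM ℂ g (G l)).toLp 2 volume) ≤
      C * dist ((G k).toLp 2 volume) ((G l).toLp 2 volume) := by
    intro k l
    have hsub : ∀ u v : 𝓢(Rn n, ℂ), u.toLp 2 volume - v.toLp 2 volume = (u - v).toLp 2 volume :=
      fun u v => ((SchwartzMap.toLpCLM ℂ ℂ 2 volume).map_sub u v).symm
    rw [dist_eq_norm, dist_eq_norm, hsub, hsub, ← map_sub]
    exact norm_toLp_fourierMultiplierCLM_le hg hC _
  rw [Metric.cauchySeq_iff]
  intro ε hε
  obtain ⟨N, hN⟩ := Metric.cauchySeq_iff.1 hG.cauchySeq (ε / (C + 1)) (by positivity)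
  refine ⟨N, fun k hk l hl => (hlin k l).trans_lt ?_⟩
  have h1 := hN k hk l hl
  rw [lt_div_iff₀ (by positivity)] at h1
  nlinarith [dist_nonneg (x := (G k).toLp 2 volume) (y := (G l).toLp 2 volume)]

/-- The symbol `(1 + |x|²)⁻¹` of the Bessel potential of order `-2`. -/
def besselSymbol (x : Rn n) : ℂ := (((1 + ‖x‖ ^ 2) ^ ((-2 : ℝ) / 2) : ℝ) : ℂ)

theorem hasTemperateGrowth_besselSymbol :
    (besselSymbol : Rn n → ℂ).HasTemperateGrowth := by
  unfold besselSymbol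
  fun_prop

theorem norm_besselSymbol (x : Rn n) : ‖besselSymbol x‖ = (1 + ‖x‖ ^ 2)⁻¹ := by
  rw [besselSymbol, Complex.norm_real, Real.norm_eq_abs, abs_of_nonneg (by positivity)]
  norm_num [Real.rpow_neg_one]

/-- The symbol of the directional derivative, up to the factor `2πi`. -/
def innerSymbol (m x : Rn n) : ℂ := ((⟪x, m⟫_ℝ : ℝ) : ℂ)

theorem hasTemperateGrowth_innerSymbol (m : Rn n) : (innerSymbol m).HasTemperateGrowth := by
  unfold innerSymbol
  fun_prop

theorem lineDerivOp_fourierMultiplierCLM {g : Rn n → ℂ} (hg : g.HasTemperateGrowth)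
    (m : Rn n) (f : 𝓢(Rn n, ℂ)) :
    ∂_{m} (SchwartzMap.fourierMultiplierCLM ℂ g f) =
      (2 * π * Complex.I) • SchwartzMap.fourierMultiplierCLM ℂ (innerSymbol m * g) f := by
  rw [SchwartzMap.lineDeriv_eq_fourierMultiplierCLM,
    ← SchwartzMap.fourierMultiplierCLM_fourierMultiplierCLM_apply
      (hasTemperateGrowth_innerSymbol m) hg,
    ← SchwartzMap.fourierMultiplierCLM_ofReal ℂ (by fun_prop)]
  rfl

theorem norm_stdVec (j : Fin n) : ‖(stdVec j : Rn n)‖ = 1 := by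
  simp [stdVec]

theorem norm_innerSymbol_stdVec_le (j : Fin n) (x : Rn n) : ‖innerSymbol (stdVec j) x‖ ≤ ‖x‖ := by
  rw [innerSymbol, Complex.norm_real]
  simpa [norm_stdVec] using norm_inner_le_norm (𝕜 := ℝ) x (stdVec j)

theorem pderiv_schwartz (j : Fin n) (f : 𝓢(Rn n, ℂ)) :
    pderiv j (f : Rn n → ℂ) = (∂_{(stdVec j : Rn n)} f : 𝓢(Rn n, ℂ)) := by
  ext x
  rw [SchwartzMap.lineDerivOp_apply_eq_fderiv]
  rfl

theorem tendsto_eLpNorm_sub_of_tendsto_toLp {f : ℕ → 𝓢(Rn n, ℂ)}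
    {W : Lp ℂ 2 (volume : Measure (Rn n))} (h : Tendsto (fun k => (f k).toLp 2) atTop (𝓝 W)) :
    Tendsto (fun k => eLpNorm (fun x => f k x - W x) 2 volume) atTop (𝓝 0) := by
  rw [Lp.tendsto_Lp_iff_tendsto_eLpNorm'] at h
  refine h.congr fun k => eLpNorm_congr_ae ?_
  filter_upwards [(f k).coeFn_toLp 2 volume] with x hx
  rw [Pi.sub_apply, hx]

/-- An element of `H²(ℝⁿ)` is the limit in `H²(ℝⁿ)` of Schwartz functions: it is the Bessel
potential of order `-2` of some `G₀ ∈ L²`, and the approximants are the Bessel potentials of Schwartz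
functions that converge to `G₀` in `L²`. Derivatives up to second order of the Bessel potential are bounded
Fourier multipliers. -/
theorem exists_schwartz_approximation {V : Lp ℂ 2 (volume : Measure (Rn n))}
    (hV : TemperedDistribution.MemSobolev 2 2 (V : 𝓢'(Rn n, ℂ))) :
    ∃ (w : ℕ → 𝓢(Rn n, ℂ)) (D : Fin n → Lp ℂ 2 (volume : Measure (Rn n)))
      (D2 : Fin n → Fin n → Lp ℂ 2 (volume : Measure (Rn n))),
      Tendsto (fun k => eLpNorm (fun x => w k x - V x) 2 volume) atTop (𝓝 0) ∧
      (∀ j, Tendsto (fun k => eLpNorm (fun x => pderiv j (w k) x - D j x) 2 volume) atTop (𝓝 0)) ∧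
      ∀ i j, Tendsto (fun k => eLpNorm (fun x => pderiv i (pderiv j (w k)) x - D2 i j x) 2 volume)
        atTop (𝓝 0) := by
  obtain ⟨G₀, hG₀⟩ := hV
  have hdense := SchwartzMap.denseRange_toLpCLM (E := Rn n) (F := ℂ) (p := 2) (μ := volume)
    ENNReal.ofNat_ne_top
  obtain ⟨G', hG', hlim⟩ := mem_closure_iff_seq_limit.1 (hdense G₀)
  choose G hG using hG'
  have hlimG : Tendsto (fun k => (G k).toLp 2) atTop (𝓝 G₀) :=
    hlim.congr fun k => (hG k).symm
  have tg := hasTemperateGrowth_besselSymbol (n := n)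
  have ti := fun j : Fin n => hasTemperateGrowth_innerSymbol (stdVec j : Rn n)
  have b0 : ∀ x : Rn n, ‖besselSymbol x‖ ≤ 1 := fun x => by
    rw [norm_besselSymbol]
    exact inv_le_one_of_one_le₀ (by nlinarith [sq_nonneg ‖x‖])
  have b1 : ∀ (j : Fin n) (x : Rn n),
      ‖(innerSymbol (stdVec j) * besselSymbol : Rn n → ℂ) x‖ ≤ 1 :=
    fun j x => by
      rw [Pi.mul_apply, norm_mul, norm_besselSymbol, ← div_eq_mul_inv, div_le_one (by positivity)]
      nlinarith [norm_innerSymbol_stdVec_le j x, sq_nonneg (‖x‖ - 1), sq_nonneg ‖x‖]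
  have b2 : ∀ (i j : Fin n) (x : Rn n),
      ‖(innerSymbol (stdVec i) * (innerSymbol (stdVec j) * besselSymbol) : Rn n → ℂ) x‖ ≤ 1 :=
    fun i j x => by
      rw [Pi.mul_apply, Pi.mul_apply, norm_mul, norm_mul, norm_besselSymbol, ← mul_assoc,
        ← div_eq_mul_inv, div_le_one (by positivity)]
      have := mul_le_mul (norm_innerSymbol_stdVec_le i x) (norm_innerSymbol_stdVec_le j x)
        (norm_nonneg _) (norm_nonneg _)
      nlinarith
  obtain ⟨W, hW⟩ := exists_tendsto_fourierMultiplierCLM tg b0 hlimG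
  choose D hD using fun j => exists_tendsto_fourierMultiplierCLM ((ti j).mul tg) (b1 j) hlimG
  choose D2 hD2 using fun i j =>
    exists_tendsto_fourierMultiplierCLM ((ti i).mul ((ti j).mul tg)) (b2 i j) hlimG
  -- the limit in `L²` and the limit of tempered distributions coincide
  have hWV : W = V := by
    have h1 : Tendsto (fun k => ((SchwartzMap.fourierMultiplierCLM ℂ besselSymbol (G k)).toLp 2
        volume : 𝓢'(Rn n, ℂ))) atTop (𝓝 (W : 𝓢'(Rn n, ℂ))) :=
      ((Lp.toTemperedDistributionCLM ℂ volume 2).continuous.tendsto W).comp hW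
    have h2 : Tendsto (fun k => TemperedDistribution.besselPotential (Rn n) ℂ (-2)
        ((G k).toLp 2 volume : 𝓢'(Rn n, ℂ))) atTop
        (𝓝 (TemperedDistribution.besselPotential (Rn n) ℂ (-2) (G₀ : 𝓢'(Rn n, ℂ)))) :=
      (((TemperedDistribution.besselPotential (Rn n) ℂ (-2)).comp
        (Lp.toTemperedDistributionCLM ℂ volume 2)).continuous.tendsto G₀).comp hlimG
    have h3 : ∀ k, TemperedDistribution.besselPotential (Rn n) ℂ (-2)
        ((G k).toLp 2 volume : 𝓢'(Rn n, ℂ)) =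
        ((SchwartzMap.fourierMultiplierCLM ℂ besselSymbol (G k)).toLp 2 volume :
          𝓢'(Rn n, ℂ)) := by
      intro k
      rw [Lp.toTemperedDistribution_toLp_eq, Lp.toTemperedDistribution_toLp_eq,
        ← TemperedDistribution.fourierMultiplierCLM_toTemperedDistributionCLM_eq tg]
      rfl
    have h4 : TemperedDistribution.besselPotential (Rn n) ℂ (-2) (G₀ : 𝓢'(Rn n, ℂ)) =
        (V : 𝓢'(Rn n, ℂ)) := by
      rw [← hG₀, TemperedDistribution.besselPotential_besselPotential_apply]
      simp
    rw [h4] at h2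
    have h5 : (W : 𝓢'(Rn n, ℂ)) = (V : 𝓢'(Rn n, ℂ)) :=
      tendsto_nhds_unique h1 (h2.congr h3)
    have h6 := LinearMap.ker_eq_bot.1
      (Lp.ker_toTemperedDistributionCLM_eq_bot (F := ℂ) (μ := (volume : Measure (Rn n))) (p := 2))
    exact h6 h5
  have hsm : ∀ (c : ℂ) (f : 𝓢(Rn n, ℂ)), (c • f).toLp 2 volume = c • f.toLp 2 volume :=
    fun c f => (SchwartzMap.toLpCLM ℂ ℂ 2 volume).map_smul c f
  refine ⟨fun k => SchwartzMap.fourierMultiplierCLM ℂ besselSymbol (G k),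
    fun j => (2 * π * Complex.I : ℂ) • D j,
    fun i j => (2 * π * Complex.I : ℂ) • (2 * π * Complex.I : ℂ) • D2 i j, ?_, ?_, ?_⟩
  · exact hWV ▸ tendsto_eLpNorm_sub_of_tendsto_toLp hW
  · intro j
    simp_rw [pderiv_schwartz, lineDerivOp_fourierMultiplierCLM tg]
    refine tendsto_eLpNorm_sub_of_tendsto_toLp ?_
    simp_rw [hsm]
    exact (hD j).const_smul _
  · intro i j
    simp_rw [pderiv_schwartz, lineDerivOp_fourierMultiplierCLM tg, LineDeriv.lineDerivOp_smul,
      lineDerivOp_fourierMultiplierCLM ((ti j).mul tg)]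
    refine tendsto_eLpNorm_sub_of_tendsto_toLp ?_
    simp_rw [hsm]
    exact ((hD2 i j).const_smul _).const_smul _

end Approximation

/-! ### Convergence of sequences of functions in `L²` -/

section L2

variable {α : Type*} [MeasurableSpace α] {μ : Measure α}
  {E F : Type*} [NormedAddCommGroup E] [NormedAddCommGroup F]

/-- The functions `w k` and `u` are square integrable and `w k → u` in `L²(μ)`. -/
structure L2Tendsto (μ : Measure α) (w : ℕ → α → E) (u : α → E) : Prop where
  memLp : ∀ k, MemLp (w k) 2 μ
  memLp_lim : MemLp u 2 μ
  tendsto : Tendsto (fun k => eLpNorm (fun x => w k x - u x) 2 μ) atTop (𝓝 0)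

namespace L2Tendsto

theorem congr_lim {w : ℕ → α → E} {u u' : α → E} (h : L2Tendsto μ w u) (hu : u =ᵐ[μ] u') :
    L2Tendsto μ w u' where
  memLp := h.memLp
  memLp_lim := h.memLp_lim.ae_eq hu
  tendsto := h.tendsto.congr fun k => eLpNorm_congr_ae <| by
    filter_upwards [hu] with x hx
    rw [hx]

theorem congr_seq {w w' : ℕ → α → E} {u : α → E} (h : L2Tendsto μ w u)
    (hw : ∀ k, w k =ᵐ[μ] w' k) : L2Tendsto μ w' u where
  memLp := fun k => (h.memLp k).ae_eq (hw k)
  memLp_lim := h.memLp_lim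
  tendsto := h.tendsto.congr fun k => eLpNorm_congr_ae <| by
    filter_upwards [hw k] with x hx
    rw [hx]

theorem mono_measure {ν : Measure α} {w : ℕ → α → E} {u : α → E} (h : L2Tendsto μ w u)
    (hν : ν ≤ μ) : L2Tendsto ν w u where
  memLp := fun k => (h.memLp k).mono_measure hν
  memLp_lim := h.memLp_lim.mono_measure hν
  tendsto := tendsto_of_tendsto_of_tendsto_of_le_of_le tendsto_const_nhds h.tendsto
    (fun _ => zero_le) (fun _ => eLpNorm_mono_measure _ hν)

theorem restrict {w : ℕ → α → E} {u : α → E} (h : L2Tendsto μ w u) (s : Set α) :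
    L2Tendsto (μ.restrict s) w u := h.mono_measure Measure.restrict_le_self

theorem const {u : α → E} (hu : MemLp u 2 μ) : L2Tendsto μ (fun _ => u) u where
  memLp := fun _ => hu
  memLp_lim := hu
  tendsto := by simp

theorem add {w w' : ℕ → α → E} {u u' : α → E} (h : L2Tendsto μ w u) (h' : L2Tendsto μ w' u') :
    L2Tendsto μ (fun k x => w k x + w' k x) (fun x => u x + u' x) where
  memLp := fun k => (h.memLp k).add (h'.memLp k)
  memLp_lim := h.memLp_lim.add h'.memLp_lim
  tendsto := by
    have h1 := h.tendsto.add h'.tendsto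
    rw [add_zero] at h1
    refine tendsto_of_tendsto_of_tendsto_of_le_of_le tendsto_const_nhds h1 (fun _ => zero_le)
      fun k => ?_
    have h2 := eLpNorm_add_le ((h.memLp k).sub h.memLp_lim).1 ((h'.memLp k).sub h'.memLp_lim).1
      one_le_two
    refine le_trans (le_of_eq (eLpNorm_congr_ae (Eventually.of_forall fun x => ?_))) h2
    simp only [Pi.add_apply, Pi.sub_apply]
    abel

/-- A pointwise Lipschitz image of a sequence that converges in `L²` converges in `L²`. -/
theorem of_norm_le {w : ℕ → α → E} {u : α → E} {w' : ℕ → α → F} {u' : α → F} (c : ℝ)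
    (h : L2Tendsto μ w u) (hw' : ∀ k, AEStronglyMeasurable (w' k) μ)
    (hu' : AEStronglyMeasurable u' μ) (h1 : ∀ k, ∀ᵐ x ∂μ, ‖w' k x‖ ≤ c * ‖w k x‖)
    (h2 : ∀ᵐ x ∂μ, ‖u' x‖ ≤ c * ‖u x‖)
    (h3 : ∀ k, ∀ᵐ x ∂μ, ‖w' k x - u' x‖ ≤ c * ‖w k x - u x‖) : L2Tendsto μ w' u' where
  memLp := fun k => (h.memLp k).of_le_mul (hw' k) (h1 k)
  memLp_lim := h.memLp_lim.of_le_mul hu' h2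
  tendsto := by
    have h4 := ENNReal.Tendsto.const_mul (a := ENNReal.ofReal c) h.tendsto
      (Or.inr ENNReal.ofReal_ne_top)
    rw [mul_zero] at h4
    exact tendsto_of_tendsto_of_tendsto_of_le_of_le tendsto_const_nhds h4 (fun _ => zero_le)
      fun k => eLpNorm_le_mul_eLpNorm_of_ae_le_mul (h3 k) 2

theorem norm {w : ℕ → α → E} {u : α → E} (h : L2Tendsto μ w u) :
    L2Tendsto μ (fun k x => ‖w k x‖) (fun x => ‖u x‖) :=
  h.of_norm_le 1 (fun k => (h.memLp k).1.norm) h.memLp_lim.1.norm (by simp) (by simp)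
    fun k => Eventually.of_forall fun x => by
      rw [one_mul, Real.norm_eq_abs]
      exact abs_norm_sub_norm_le _ _

/-- Multiplication by a bounded function. -/
theorem smul_bounded {𝕜 : Type*} [NormedField 𝕜] [NormedSpace 𝕜 E] {w : ℕ → α → E} {u : α → E}
    {ρ : α → 𝕜} {c : ℝ} (h : L2Tendsto μ w u) (hρ : AEStronglyMeasurable ρ μ)
    (hc : ∀ᵐ x ∂μ, ‖ρ x‖ ≤ c) :
    L2Tendsto μ (fun k x => ρ x • w k x) (fun x => ρ x • u x) := by
  have hb : ∀ v : α → E, ∀ᵐ x ∂μ, ‖ρ x • v x‖ ≤ c * ‖v x‖ := fun v => by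
    filter_upwards [hc] with x hx
    rw [norm_smul]
    gcongr
  refine h.of_norm_le c (fun k => hρ.smul (h.memLp k).1) (hρ.smul h.memLp_lim.1) (fun k => hb _)
    (hb _) fun k => ?_
  filter_upwards [hb fun x => w k x - u x] with x hx
  rwa [← smul_sub]

theorem sum {ι : Type*} {s : Finset ι} {w : ι → ℕ → α → E} {u : ι → α → E}
    (h : ∀ i ∈ s, L2Tendsto μ (w i) (u i)) :
    L2Tendsto μ (fun k x => ∑ i ∈ s, w i k x) (fun x => ∑ i ∈ s, u i x) := by
  classical
  induction s using Finset.induction_on with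
  | empty => simpa using const (μ := μ) (u := fun _ : α => (0 : E)) MemLp.zero
  | insert a s ha ih =>
    simp_rw [Finset.sum_insert ha]
    exact (h a (Finset.mem_insert_self a s)).add
      (ih fun i hi => h i (Finset.mem_insert_of_mem hi))

theorem toLp {n : ℕ} {w : Fin n → ℕ → α → ℂ} {u : Fin n → α → ℂ}
    (h : ∀ j, L2Tendsto μ (w j) (u j)) :
    L2Tendsto μ (fun k x => (WithLp.toLp 2 fun j => w j k x : EuclideanSpace ℂ (Fin n)))
      (fun x => WithLp.toLp 2 fun j => u j x) := by
  have hv : ∀ v : Fin n → ℂ, (WithLp.toLp 2 v : EuclideanSpace ℂ (Fin n)) =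
      ∑ j, v j • EuclideanSpace.single j (1 : ℂ) := fun v => by
    ext i
    simp [Pi.single_apply]
  have h1 : ∀ j, L2Tendsto μ
      (fun k x => w j k x • (EuclideanSpace.single j (1 : ℂ) : EuclideanSpace ℂ (Fin n)))
      (fun x => u j x • (EuclideanSpace.single j (1 : ℂ) : EuclideanSpace ℂ (Fin n))) := by
    intro j
    refine (h j).of_norm_le 1 (fun k => ((h j).memLp k).1.smul_const _)
      ((h j).memLp_lim.1.smul_const _) (fun k => Eventually.of_forall fun x => ?_)
      (Eventually.of_forall fun x => ?_) fun k => Eventually.of_forall fun x => ?_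
    · simp [norm_smul]
    · simp [norm_smul]
    · simp [← sub_smul, norm_smul]
  have h2 := sum (s := Finset.univ) fun j _ => h1 j
  simp_rw [hv]
  exact h2

theorem tendsto_eLpNorm_sub {w w' : ℕ → α → E} {u : α → E} (h : L2Tendsto μ w u)
    (h' : L2Tendsto μ w' u) :
    Tendsto (fun p : ℕ × ℕ => eLpNorm (fun x => w p.1 x - w' p.2 x) 2 μ) atTop (𝓝 0) := by
  rw [← prod_atTop_atTop_eq]
  have h1 := (h.tendsto.comp (tendsto_fst (f := atTop) (g := atTop (α := ℕ)))).add
    (h'.tendsto.comp (tendsto_snd (f := atTop (α := ℕ)) (g := atTop)))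
  rw [add_zero] at h1
  refine tendsto_of_tendsto_of_tendsto_of_le_of_le tendsto_const_nhds h1 (fun _ => zero_le)
    fun p => ?_
  have h2 := eLpNorm_sub_le ((h.memLp p.1).sub h.memLp_lim).1 ((h'.memLp p.2).sub h'.memLp_lim).1
    (one_le_two (α := ℝ≥0∞))
  refine le_trans (le_of_eq (eLpNorm_congr_ae (Eventually.of_forall fun x => ?_))) h2
  simp only [Pi.sub_apply]
  abel

/-- Integrals of products converge if both factors converge in `L²`. -/
theorem tendsto_integral_smul [NormedSpace ℝ E] {w : ℕ → α → ℝ} {u : α → ℝ} {w' : ℕ → α → E}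
    {u' : α → E} (h : L2Tendsto μ w u) (h' : L2Tendsto μ w' u') :
    Tendsto (fun k => ∫ x, w k x • w' k x ∂μ) atTop (𝓝 (∫ x, u x • u' x ∂μ)) := by
  refine tendsto_integral_of_L1' _ (h.memLp_lim.1.smul h'.memLp_lim.1)
    (Eventually.of_forall fun k => memLp_one_iff_integrable.1 ((h'.memLp k).smul (h.memLp k))) ?_
  have hN : Tendsto (fun k => eLpNorm (w' k) 2 μ) atTop (𝓝 (eLpNorm u' 2 μ)) := by
    have hb : Tendsto (fun k => eLpNorm (fun x => w' k x - u' x) 2 μ + eLpNorm u' 2 μ) atTop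
        (𝓝 (0 + eLpNorm u' 2 μ)) := h'.tendsto.add tendsto_const_nhds
    have ha : Tendsto (fun k => eLpNorm u' 2 μ - eLpNorm (fun x => w' k x - u' x) 2 μ) atTop
        (𝓝 (eLpNorm u' 2 μ - 0)) :=
      ENNReal.Tendsto.sub tendsto_const_nhds h'.tendsto (Or.inr ENNReal.zero_ne_top)
    rw [zero_add] at hb
    rw [tsub_zero] at ha
    refine tendsto_of_tendsto_of_tendsto_of_le_of_le ha hb (fun k => ?_) fun k => ?_
    · rw [tsub_le_iff_right]
      have h2 := eLpNorm_sub_le (h'.memLp k).1 ((h'.memLp k).sub h'.memLp_lim).1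
        (one_le_two (α := ℝ≥0∞))
      refine le_trans (le_of_eq (eLpNorm_congr_ae (Eventually.of_forall fun x => ?_))) h2
      simp
    · have h2 := eLpNorm_add_le ((h'.memLp k).sub h'.memLp_lim).1 h'.memLp_lim.1
        (one_le_two (α := ℝ≥0∞))
      refine le_trans (le_of_eq (eLpNorm_congr_ae (Eventually.of_forall fun x => ?_))) h2
      simp
  have hlim : Tendsto (fun k => eLpNorm (fun x => w k x - u x) 2 μ * eLpNorm (w' k) 2 μ +
      eLpNorm u 2 μ * eLpNorm (fun x => w' k x - u' x) 2 μ) atTop (𝓝 0) := by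
    have h1 := ENNReal.Tendsto.mul h.tendsto (Or.inr h'.memLp_lim.2.ne) hN
      (Or.inr ENNReal.zero_ne_top)
    have h2 := ENNReal.Tendsto.const_mul (a := eLpNorm u 2 μ) h'.tendsto
      (Or.inr h.memLp_lim.2.ne)
    simpa using h1.add h2
  refine tendsto_of_tendsto_of_tendsto_of_le_of_le tendsto_const_nhds hlim (fun _ => zero_le)
    fun k => ?_
  have m1 := (h.memLp k).sub h.memLp_lim
  have m2 := (h'.memLp k).sub h'.memLp_lim
  have e1 := eLpNorm_smul_le_mul_eLpNorm (p := 2) (q := 2) (r := 1) (h'.memLp k).1 m1.1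
  have e2 := eLpNorm_smul_le_mul_eLpNorm (p := 2) (q := 2) (r := 1) m2.1 h.memLp_lim.1
  have e3 := eLpNorm_add_le (m1.1.smul (h'.memLp k).1) (h.memLp_lim.1.smul m2.1)
    (le_refl (1 : ℝ≥0∞))
  refine le_trans (le_of_eq (eLpNorm_congr_ae (Eventually.of_forall fun x => ?_)))
    (e3.trans (add_le_add e1 e2))
  simp only [Pi.sub_apply, Pi.add_apply, Pi.smul_apply', sub_smul, smul_sub]
  abel

/-- Weighted integrals of products of norms converge. -/
theorem tendsto_integral_norm_mul_norm {w : ℕ → α → E} {u : α → E} {w' : ℕ → α → F} {u' : α → F}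
    {ρ : α → ℝ} {c : ℝ} (h : L2Tendsto μ w u) (h' : L2Tendsto μ w' u')
    (hρ : AEStronglyMeasurable ρ μ) (hc : ∀ᵐ x ∂μ, ‖ρ x‖ ≤ c) :
    Tendsto (fun k => ∫ x, ρ x * (‖w k x‖ * ‖w' k x‖) ∂μ) atTop
      (𝓝 (∫ x, ρ x * (‖u x‖ * ‖u' x‖) ∂μ)) := by
  simpa only [smul_eq_mul, mul_assoc] using
    (h.norm.smul_bounded hρ hc).tendsto_integral_smul h'.norm

theorem tendsto_integral_norm_sq {w : ℕ → α → E} {u : α → E} (h : L2Tendsto μ w u) :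
    Tendsto (fun k => ∫ x, ‖w k x‖ ^ 2 ∂μ) atTop (𝓝 (∫ x, ‖u x‖ ^ 2 ∂μ)) := by
  simpa only [smul_eq_mul, sq] using h.norm.tendsto_integral_smul h.norm

end L2Tendsto

end L2

/-! ### Weak derivatives and smooth approximation in a bounded open set -/

section Weak

variable {n : ℕ} {Ω : Set (Rn n)}

theorem memLp_restrict_of_continuous {E : Type*} [NormedAddCommGroup E]
    (hΩb : Bornology.IsBounded Ω) {g : Rn n → E} (hg : Continuous g) :
    MemLp g 2 (volume.restrict Ω) := by
  have hK := Metric.isCompact_of_isClosed_isBounded isClosed_closure hΩb.closure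
  obtain ⟨B, hB⟩ := hK.exists_bound_of_continuousOn hg.continuousOn
  have hfin : IsFiniteMeasure (volume.restrict (closure Ω)) :=
    ⟨by simpa using hK.measure_lt_top⟩
  have h1 : MemLp g 2 (volume.restrict (closure Ω)) := by
    refine MemLp.of_bound hg.aestronglyMeasurable B ?_
    filter_upwards [ae_restrict_mem isClosed_closure.measurableSet] with x hx
    exact hB x hx
  exact h1.mono_measure (Measure.restrict_mono subset_closure le_rfl)

theorem L2Tendsto.mul_continuous (hΩb : Bornology.IsBounded Ω) {w : ℕ → Rn n → ℂ} {u : Rn n → ℂ}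
    (h : L2Tendsto (volume.restrict Ω) w u) {e : Rn n → ℂ} (he : Continuous e) :
    L2Tendsto (volume.restrict Ω) (fun k x => e x * w k x) (fun x => e x * u x) := by
  have hK := Metric.isCompact_of_isClosed_isBounded isClosed_closure hΩb.closure
  obtain ⟨B, hB⟩ := hK.exists_bound_of_continuousOn he.continuousOn
  refine h.smul_bounded (c := B) he.aestronglyMeasurable ?_
  filter_upwards [ae_restrict_of_ae_restrict_of_subset subset_closure
    (ae_restrict_mem isClosed_closure.measurableSet)] with x hx
  exact hB x hx

/-- The weak derivative is the `L²` limit of the derivatives of smooth approximations. -/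
theorem hasWeakPartial_of_tendsto (hΩb : Bornology.IsBounded Ω)
    {w : ℕ → Rn n → ℂ} {u g : Rn n → ℂ} (hw : ∀ k, ContDiff ℝ ∞ (w k)) (j : Fin n)
    (hu : L2Tendsto (volume.restrict Ω) w u)
    (hg : L2Tendsto (volume.restrict Ω) (fun k => pderiv j (w k)) g) :
    HasWeakPartial Ω j u g := by
  have hfin : IsFiniteMeasure (volume.restrict Ω) := ⟨by simpa using hΩb.measure_lt_top⟩
  refine ⟨IntegrableOn.locallyIntegrableOn (hu.memLp_lim.integrable one_le_two),
    IntegrableOn.locallyIntegrableOn (hg.memLp_lim.integrable one_le_two), ?_⟩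
  intro χ hχ hχc hχs
  have c1 : Continuous (pderiv j χ) := (hχ.pderiv j).continuous
  have t1 := (L2Tendsto.const (memLp_restrict_of_continuous hΩb c1)).tendsto_integral_smul hu
  have t2 := (L2Tendsto.const (memLp_restrict_of_continuous hΩb
    hχ.continuous)).tendsto_integral_smul hg
  refine tendsto_nhds_unique t1 (t2.neg.congr fun k => ?_)
  have z1 : ∀ x, x ∉ Ω → χ x = 0 := fun x hx =>
    image_eq_zero_of_notMem_tsupport fun h => hx (hχs h)
  have z2 : ∀ x, x ∉ Ω → pderiv j χ x = 0 := fun x hx => by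
    have : fderiv ℝ χ x = 0 := image_eq_zero_of_notMem_tsupport fun h =>
      hx (hχs (tsupport_fderiv_subset ℝ h))
    rw [pderiv, this]
    rfl
  rw [setIntegral_eq_integral_of_forall_compl_eq_zero (fun x hx => by rw [z1 x hx, zero_smul]),
    setIntegral_eq_integral_of_forall_compl_eq_zero (fun x hx => by rw [z2 x hx, zero_smul])]
  have hc' : HasCompactSupport (pderiv j χ) := hχc.fderiv_apply (𝕜 := ℝ) (v := stdVec j)
  have key := integral_smul_fderiv_eq_neg_fderiv_smul_of_integrable
    (μ := (volume : Measure (Rn n))) (f := χ) (g := w k) (v := stdVec j)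
    ((c1.smul (hw k).continuous).integrable_of_hasCompactSupport hc'.smul_right)
    ((hχ.continuous.smul ((hw k).pderiv j).continuous).integrable_of_hasCompactSupport
      hχc.smul_right)
    ((hχ.continuous.smul (hw k).continuous).integrable_of_hasCompactSupport hχc.smul_right)
    (fun x _ => hχ.differentiableAt_top x) (fun x _ => (hw k).differentiableAt_top x)
  change -∫ x, χ x • fderiv ℝ (w k) x (stdVec j) = _
  rw [key, neg_neg]
  rfl

theorem HasWeakPartial.ae_eq (hΩo : IsOpen Ω) {j : Fin n} {u u' g g' : Rn n → ℂ}
    (h : HasWeakPartial Ω j u g) (h' : HasWeakPartial Ω j u' g')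
    (hu : u =ᵐ[volume.restrict Ω] u') : g =ᵐ[volume.restrict Ω] g' := by
  have h1 : ∀ᵐ x, x ∈ Ω → (fun x => g x - g' x) x = 0 := by
    refine hΩo.ae_eq_zero_of_integral_contDiff_smul_eq_zero (h.2.1.sub h'.2.1) ?_
    intro χ hχ hχc hχs
    have z1 : ∀ x, x ∉ Ω → χ x = 0 := fun x hx =>
      image_eq_zero_of_notMem_tsupport fun h => hx (hχs h)
    have hint : ∀ f : Rn n → ℂ, LocallyIntegrableOn f Ω → Integrable (fun x => χ x • f x) := by
      intro f hf
      have h2 : IntegrableOn f (tsupport χ) := hf.integrableOn_compact_subset hχs hχc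
      have h3 : IntegrableOn (fun x => χ x • f x) (tsupport χ) :=
        h2.continuousOn_smul hχ.continuous.continuousOn hχc
      refine (integrableOn_iff_integrable_of_support_subset fun x hx => ?_).1 h3
      by_contra hcon
      exact hx (by simp [image_eq_zero_of_notMem_tsupport hcon])
    have e1 := h.2.2 χ hχ hχc hχs
    have e2 := h'.2.2 χ hχ hχc hχs
    have e3 : ∫ x in Ω, fderiv ℝ χ x (stdVec j) • u x =
        ∫ x in Ω, fderiv ℝ χ x (stdVec j) • u' x := integral_congr_ae <| by
      filter_upwards [hu] with x hx
      rw [hx]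
    rw [e1, e2, neg_inj,
      setIntegral_eq_integral_of_forall_compl_eq_zero (fun x hx => by rw [z1 x hx, zero_smul]),
      setIntegral_eq_integral_of_forall_compl_eq_zero (fun x hx => by rw [z1 x hx, zero_smul])]
      at e3
    simp_rw [smul_sub]
    rw [integral_sub (hint g h.2.1) (hint g' h'.2.1), e3, sub_self]
  rw [EventuallyEq, ae_restrict_iff' hΩo.measurableSet]
  filter_upwards [h1] with x hx hxΩ
  exact sub_eq_zero.1 (hx hxΩ)

theorem HasWeakPartial.weakPartial_ae_eq (hΩo : IsOpen Ω) {j : Fin n} {u g : Rn n → ℂ}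
    (h : HasWeakPartial Ω j u g) : weakPartial Ω j u =ᵐ[volume.restrict Ω] g := by
  have hex : ∃ g, HasWeakPartial Ω j u g := ⟨g, h⟩
  rw [weakPartial, dif_pos hex]
  exact hex.choose_spec.ae_eq hΩo h (ae_eq_refl u)

end Weak

/-! ### The conjugated operator on the second order Sobolev space -/

section SecondOrder

variable {n : ℕ} {Ω : Set (Rn n)}

/-- The smooth functions `w k` converge to `u` in `L²(Ω)`, and their first and second derivatives
converge to `D` and `D2` in `L²(Ω)`. -/
structure H2Approx (Ω : Set (Rn n)) (w : ℕ → Rn n → ℂ) (u : Rn n → ℂ) (D : Fin n → Rn n → ℂ)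
    (D2 : Fin n → Fin n → Rn n → ℂ) : Prop where
  smooth : ∀ k, ContDiff ℝ ∞ (w k)
  fun_lim : L2Tendsto (volume.restrict Ω) w u
  deriv_lim : ∀ j, L2Tendsto (volume.restrict Ω) (fun k => pderiv j (w k)) (D j)
  deriv2_lim : ∀ i j, L2Tendsto (volume.restrict Ω) (fun k => pderiv i (pderiv j (w k))) (D2 i j)

theorem MemH2.exists_approx (hΩb : Bornology.IsBounded Ω) {v : Rn n → ℂ} (hv : MemH2 Ω v) :
    ∃ w D D2, H2Approx Ω w v D D2 := by
  obtain ⟨V, hV, hvV⟩ := hv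
  obtain ⟨w, D, D2, h0, h1, h2⟩ := exists_schwartz_approximation hV
  have hw : ∀ k, ContDiff ℝ ∞ (w k) := fun k => (w k).smooth ⊤
  have hr : ∀ {f : ℕ → Rn n → ℂ} {g : Rn n → ℂ},
      Tendsto (fun k => eLpNorm (fun x => f k x - g x) 2 volume) atTop (𝓝 0) →
      Tendsto (fun k => eLpNorm (fun x => f k x - g x) 2 (volume.restrict Ω)) atTop (𝓝 0) :=
    fun hf => tendsto_of_tendsto_of_tendsto_of_le_of_le tendsto_const_nhds hf (fun _ => zero_le)
      (fun _ => eLpNorm_mono_measure _ Measure.restrict_le_self)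
  refine ⟨fun k => w k, fun j => D j, fun i j => D2 i j, hw, ?_, fun j => ?_, fun i j => ?_⟩
  · exact L2Tendsto.congr_lim ⟨fun k => memLp_restrict_of_continuous hΩb (hw k).continuous,
      (Lp.memLp V).restrict Ω, hr h0⟩ hvV.symm
  · exact ⟨fun k => memLp_restrict_of_continuous hΩb ((hw k).pderiv j).continuous,
      (Lp.memLp (D j)).restrict Ω, hr (h1 j)⟩
  · exact ⟨fun k => memLp_restrict_of_continuous hΩb (((hw k).pderiv j).pderiv i).continuous,
      (Lp.memLp (D2 i j)).restrict Ω, hr (h2 i j)⟩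

namespace H2Approx

variable {w : ℕ → Rn n → ℂ} {u : Rn n → ℂ} {D : Fin n → Rn n → ℂ} {D2 : Fin n → Fin n → Rn n → ℂ}

theorem congr_lim (h : H2Approx Ω w u D D2) {u' : Rn n → ℂ} (hu : u =ᵐ[volume.restrict Ω] u') :
    H2Approx Ω w u' D D2 :=
  { h with fun_lim := h.fun_lim.congr_lim hu }

theorem weakPartial_ae_eq (hΩo : IsOpen Ω) (hΩb : Bornology.IsBounded Ω)
    (h : H2Approx Ω w u D D2) (j : Fin n) : D j =ᵐ[volume.restrict Ω] weakPartial Ω j u :=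
  ((hasWeakPartial_of_tendsto hΩb h.smooth j h.fun_lim (h.deriv_lim j)).weakPartial_ae_eq hΩo).symm

theorem weakPartial_weakPartial_ae_eq (hΩo : IsOpen Ω) (hΩb : Bornology.IsBounded Ω)
    (h : H2Approx Ω w u D D2) (i j : Fin n) :
    D2 i j =ᵐ[volume.restrict Ω] weakPartial Ω i (weakPartial Ω j u) :=
  ((hasWeakPartial_of_tendsto hΩb (fun k => (h.smooth k).pderiv j) i
    ((h.deriv_lim j).congr_lim (h.weakPartial_ae_eq hΩo hΩb j))
    (h.deriv2_lim i j)).weakPartial_ae_eq hΩo).symm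

/-- The limits can be taken to be the weak derivatives. -/
theorem weak (hΩo : IsOpen Ω) (hΩb : Bornology.IsBounded Ω) (h : H2Approx Ω w u D D2) :
    H2Approx Ω w u (fun j => weakPartial Ω j u)
      (fun i j => weakPartial Ω i (weakPartial Ω j u)) where
  smooth := h.smooth
  fun_lim := h.fun_lim
  deriv_lim j := (h.deriv_lim j).congr_lim (h.weakPartial_ae_eq hΩo hΩb j)
  deriv2_lim i j := (h.deriv2_lim i j).congr_lim (h.weakPartial_weakPartial_ae_eq hΩo hΩb i j)

theorem mul_smooth (hΩb : Bornology.IsBounded Ω) (h : H2Approx Ω w u D D2) {e : Rn n → ℂ}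
    (he : ContDiff ℝ ∞ e) :
    H2Approx Ω (fun k x => e x * w k x) (fun x => e x * u x)
      (fun j x => e x * D j x + pderiv j e x * u x)
      (fun i j x => (e x * D2 i j x + pderiv i e x * D j x) +
        (pderiv j e x * D i x + pderiv i (pderiv j e) x * u x)) where
  smooth k := he.mul (h.smooth k)
  fun_lim := h.fun_lim.mul_continuous hΩb he.continuous
  deriv_lim j := by
    have h1 := ((h.deriv_lim j).mul_continuous hΩb he.continuous).add
      (h.fun_lim.mul_continuous hΩb (he.pderiv j).continuous)
    refine h1.congr_seq fun k => Eventually.of_forall fun x => ?_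
    simp only [pderiv_mul he (h.smooth k)]
    ring
  deriv2_lim i j := by
    have h1 := (((h.deriv2_lim i j).mul_continuous hΩb he.continuous).add
      ((h.deriv_lim j).mul_continuous hΩb (he.pderiv i).continuous)).add
      (((h.deriv_lim i).mul_continuous hΩb (he.pderiv j).continuous).add
      (h.fun_lim.mul_continuous hΩb ((he.pderiv j).pderiv i).continuous))
    refine h1.congr_seq fun k => Eventually.of_forall fun x => ?_
    have hw := h.smooth k
    have e1 : pderiv j (fun x => e x * w k x) =
        fun x => e x * pderiv j (w k) x + w k x * pderiv j e x := funext (pderiv_mul he hw j)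
    dsimp only
    rw [e1, pderiv_add (he.mul (hw.pderiv j)) (hw.mul (he.pderiv j)),
      pderiv_mul he (hw.pderiv j), pderiv_mul hw (he.pderiv j)]
    ring

end H2Approx

/-- Conjugation of the Laplacian by exponentials gives the written out operator. -/
theorem exp_mul_lapl_exp_mul {f : Rn n → ℝ} (hf : ContDiff ℝ ∞ f) {h : ℝ} (hh : h ≠ 0)
    {w : Rn n → ℂ} (hw : ContDiff ℝ ∞ w) (x : Rn n) :
    (Real.exp (f x / h) : ℂ) * (-(h : ℂ) ^ 2 *
      ∑ j, pderiv j (pderiv j (fun y => (Real.exp (-(f y / h)) : ℂ) * w y)) x) =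
      conjOpC h f w x := by
  have he : ContDiff ℝ ∞ (fun y => (Real.exp (-(f y / h)) : ℂ)) :=
    Complex.ofRealCLM.contDiff.comp (Real.contDiff_exp.comp (hf.div_const h).neg)
  have hfc : ∀ j, ContDiff ℝ ∞ (fun y => ((pderiv j f y : ℝ) : ℂ)) := fun j =>
    Complex.ofRealCLM.contDiff.comp (hf.pderiv j)
  have hofR : ∀ (g : Rn n → ℝ), ContDiff ℝ ∞ g → ∀ j x,
      pderiv j (fun y => ((g y : ℝ) : ℂ)) x = ((pderiv j g x : ℝ) : ℂ) := by
    intro g hg j x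
    have h1 := (Complex.ofRealCLM.hasFDerivAt.comp x (hg.differentiableAt_top x).hasFDerivAt).fderiv
    change fderiv ℝ (fun x => ((g x : ℝ) : ℂ)) x = _ at h1
    rw [pderiv, h1]
    rfl
  have hexp : ∀ j, pderiv j (fun y => (Real.exp (-(f y / h)) : ℂ)) =
      fun y => (-(1 / h) : ℂ) * ((pderiv j f y : ℝ) * (Real.exp (-(f y / h)) : ℂ)) := by
    intro j
    ext y
    have h1 : HasFDerivAt (fun y => Real.exp (-(f y / h)))
        (Real.exp (-(f y / h)) • -(h⁻¹ • fderiv ℝ f y)) y := by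
      have h2 := (hf.differentiableAt_top y).hasFDerivAt.mul_const h⁻¹
      simp only [div_eq_mul_inv]
      exact h2.neg.exp
    rw [hofR (fun y => Real.exp (-(f y / h))) (Real.contDiff_exp.comp (hf.div_const h).neg),
      pderiv, h1.fderiv]
    simp only [pderiv, smul_eq_mul, FunLike.coe_smul, FunLike.coe_neg, Pi.smul_apply, Pi.neg_apply]
    push_cast
    ring
  have key : ∀ j, pderiv j (pderiv j (fun y => (Real.exp (-(f y / h)) : ℂ) * w y)) x =
      (Real.exp (-(f x / h)) : ℂ) * (pderiv j (pderiv j w) x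
        - (2 / h : ℂ) * ((pderiv j f x : ℝ) * pderiv j w x)
        - (1 / h : ℂ) * ((pderiv j (pderiv j f) x : ℝ) * w x)
        + (1 / h : ℂ) ^ 2 * (((pderiv j f x * pderiv j f x : ℝ) : ℂ) * w x)) := by
    intro j
    have e1 : pderiv j (fun y => (Real.exp (-(f y / h)) : ℂ) * w y) =
        fun y => (Real.exp (-(f y / h)) : ℂ) * pderiv j w y +
          w y * pderiv j (fun y => (Real.exp (-(f y / h)) : ℂ)) y := funext (pderiv_mul he hw j)
    rw [e1, pderiv_add (he.mul (hw.pderiv j)) (hw.mul (he.pderiv j)),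
      pderiv_mul he (hw.pderiv j), pderiv_mul hw (he.pderiv j), hexp j,
      pderiv_const_mul ((hfc j).mul he), pderiv_mul (hfc j) he, hexp j, hofR _ (hf.pderiv j)]
    push_cast
    ring
  simp_rw [key]
  have hE : (Real.exp (f x / h) : ℂ) * (Real.exp (-(f x / h)) : ℂ) = 1 := by
    rw [← Complex.ofReal_mul, ← Real.exp_add]
    simp
  have hhc : (h : ℂ) ≠ 0 := by exact_mod_cast hh
  rw [← Finset.mul_sum, mul_left_comm _ (Real.exp (-(f x / h)) : ℂ), ← mul_assoc, hE, one_mul,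
    conjOpC, lapl, lapl, gradDot]
  push_cast
  simp only [Finset.mul_sum, Finset.sum_mul, ← Finset.sum_add_distrib, ← Finset.sum_sub_distrib]
  refine Finset.sum_congr rfl fun j _ => ?_
  field_simp
  ring

/-- The conjugated operator on `H²(Ω)` is the `L²` limit of the operators on smooth
approximations. -/
theorem H2Approx.tendsto_conjLaplacian (hΩo : IsOpen Ω) (hΩb : Bornology.IsBounded Ω)
    {w : ℕ → Rn n → ℂ} {v : Rn n → ℂ} {D : Fin n → Rn n → ℂ} {D2 : Fin n → Fin n → Rn n → ℂ}
    (H : H2Approx Ω w v D D2) {f g : Rn n → ℝ} (hf : ContDiff ℝ ∞ f) (hfg : Set.EqOn f g Ω)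
    {h : ℝ} (hh : h ≠ 0) :
    L2Tendsto (volume.restrict Ω) (fun k => conjOpC h f (w k)) (conjLaplacian Ω h g v) := by
  have he : ContDiff ℝ ∞ (fun y => (Real.exp (-(f y / h)) : ℂ)) :=
    Complex.ofRealCLM.contDiff.comp (Real.contDiff_exp.comp (hf.div_const h).neg)
  have he' : ContDiff ℝ ∞ (fun y => (Real.exp (f y / h) : ℂ)) :=
    Complex.ofRealCLM.contDiff.comp (Real.contDiff_exp.comp (hf.div_const h))
  have hcongr : (fun x => (Real.exp (-(f x / h)) : ℂ) * v x) =ᵐ[volume.restrict Ω]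
      fun x => (Real.exp (-(g x / h)) : ℂ) * v x := by
    filter_upwards [ae_restrict_mem hΩo.measurableSet] with x hx
    rw [hfg hx]
  have H1 := ((H.mul_smooth hΩb he).congr_lim hcongr).weak hΩo hΩb
  have H2 := L2Tendsto.sum (s := Finset.univ) fun j _ => H1.deriv2_lim j j
  have H3 := (H2.mul_continuous hΩb
    (e := fun _ => (-(h : ℂ) ^ 2)) continuous_const).mul_continuous hΩb he'.continuous
  refine (H3.congr_seq fun k => Eventually.of_forall fun x =>
    exp_mul_lapl_exp_mul hf hh (H.smooth k) x).congr_lim ?_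
  filter_upwards [ae_restrict_mem hΩo.measurableSet] with x hx
  rw [conjLaplacian, weakLaplacian, hfg hx]

end SecondOrder

/-! ### Boundary traces -/

section Trace

variable {n : ℕ} {Ω : Set (Rn n)}

theorem MeasureTheory.MemLp.eLpNorm_two_eq_sqrt {α E : Type*} [MeasurableSpace α] {μ : Measure α}
    [NormedAddCommGroup E] {f : α → E} (hf : MemLp f 2 μ) :
    eLpNorm f 2 μ = ENNReal.ofReal (√(∫ x, ‖f x‖ ^ 2 ∂μ)) := by
  rw [hf.eLpNorm_eq_integral_rpow_norm two_ne_zero ENNReal.ofNat_ne_top, Real.sqrt_eq_rpow]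
  norm_num

theorem sqrt_add_le_sqrt_add_sqrt {a b : ℝ} (ha : 0 ≤ a) (hb : 0 ≤ b) : √(a + b) ≤ √a + √b := by
  rw [Real.sqrt_le_iff]
  refine ⟨by positivity, ?_⟩
  rw [add_sq, Real.sq_sqrt ha, Real.sq_sqrt hb]
  have : 0 ≤ 2 * √a * √b := by positivity
  linarith

theorem memLp_surfaceMeasure {E : Type*} [NormedAddCommGroup E] (hΩb : Bornology.IsBounded Ω)
    [IsFiniteMeasure (surfaceMeasure Ω)] {g : Rn n → E} (hg : Continuous g) :
    MemLp g 2 (surfaceMeasure Ω) := by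
  have hfc : IsCompact (frontier Ω) :=
    Metric.isCompact_of_isClosed_isBounded isClosed_frontier
      (hΩb.closure.subset frontier_subset_closure)
  obtain ⟨B, hB⟩ := hfc.exists_bound_of_continuousOn hg.continuousOn
  refine MemLp.of_bound hg.aestronglyMeasurable B ?_
  filter_upwards [ae_surfaceMeasure_mem_frontier Ω] with x hx
  exact hB x hx

/-- The trace inequality, obtained from the divergence theorem for the field `|w|² N`, where `N` is
a smooth field that is transversal to the boundary. -/
theorem exists_integral_surfaceMeasure_le (hΩo : IsOpen Ω) (hΩb : Bornology.IsBounded Ω)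
    (hΩ : HasC2Boundary Ω) : ∃ A ≥ (0 : ℝ), ∀ w : Rn n → ℂ, ContDiff ℝ ∞ w →
      ∫ x, ‖w x‖ ^ 2 ∂surfaceMeasure Ω ≤
        A * ((∫ x in Ω, ‖w x‖ ^ 2) + ∑ j, ∫ x in Ω, ‖pderiv j w x‖ ^ 2) := by
  obtain ⟨hfin, ⟨σ, hσfin, ⟨b₁, hb₁⟩, ⟨b₂, hb₂⟩, hσ⟩, N, hN, c, hc, hcN⟩ :=
    exists_divergence_measure hΩo hΩb hΩ
  have hK := Metric.isCompact_of_isClosed_isBounded isClosed_closure hΩb.closure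
  have hNj : ∀ j, ContDiff ℝ ∞ (fun x => N x j) := fun j =>
    (EuclideanSpace.proj (𝕜 := ℝ) j).contDiff.comp hN
  choose B₁ hB₁ using fun j => hK.exists_bound_of_continuousOn (hNj j).continuous.continuousOn
  choose B₂ hB₂ using fun j =>
    hK.exists_bound_of_continuousOn ((hNj j).pderiv j).continuous.continuousOn
  obtain ⟨B, hB⟩ : ∃ B : ℝ, B = ∑ j, (|B₁ j| + |B₂ j|) := ⟨_, rfl⟩
  have hB0 : 0 ≤ B := hB ▸ Finset.sum_nonneg fun j _ => by positivity
  have hBj : ∀ j, |B₁ j| + |B₂ j| ≤ B := fun j => by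
    rw [hB]
    exact Finset.single_le_sum (f := fun j => |B₁ j| + |B₂ j|) (fun _ _ => by positivity)
      (Finset.mem_univ j)
  refine ⟨b₂ / c * (B * (n + 1)), by positivity, fun w hw => ?_⟩
  have hq : ContDiff ℝ ∞ (fun x => (w x).re * (w x).re + (w x).im * (w x).im) :=
    (hw.complex_re.mul hw.complex_re).add (hw.complex_im.mul hw.complex_im)
  have hqw : ∀ x, (w x).re * (w x).re + (w x).im * (w x).im = ‖w x‖ ^ 2 := fun x => by
    rw [norm_sq_re_add_im]
    ring
  have hF : ∀ j, ContDiff ℝ ∞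
      (fun x => N x j * ((w x).re * (w x).re + (w x).im * (w x).im)) := fun j => (hNj j).mul hq
  have hdiv := integral_div_eq hΩb hΩ hb₁ hσ hF
  have hpt : ∀ x ∈ Ω, ∑ j, pderiv j
      (fun x => N x j * ((w x).re * (w x).re + (w x).im * (w x).im)) x ≤
      B * ((n + 1) * ‖w x‖ ^ 2 + ∑ j, ‖pderiv j w x‖ ^ 2) := by
    intro x hx
    have hj : ∀ j, pderiv j (fun x => N x j * ((w x).re * (w x).re + (w x).im * (w x).im)) x ≤
        B * (‖w x‖ ^ 2 + ‖pderiv j w x‖ ^ 2) := by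
      intro j
      rw [pderiv_mul (hNj j) hq, pderiv_add (hw.complex_re.mul hw.complex_re)
        (hw.complex_im.mul hw.complex_im), pderiv_mul hw.complex_re hw.complex_re,
        pderiv_mul hw.complex_im hw.complex_im, pderiv_re hw, pderiv_im hw, hqw,
        norm_sq_re_add_im (pderiv j w x)]
      have k1 : |N x j| ≤ |B₁ j| := (hB₁ j x (subset_closure hx)).trans (le_abs_self _)
      have k2 : |pderiv j (fun x => N x j) x| ≤ |B₂ j| :=
        (hB₂ j x (subset_closure hx)).trans (le_abs_self _)
      have k3 := hBj j
      obtain ⟨a, ha⟩ : ∃ a, a = (w x).re * (pderiv j w x).re + (w x).re * (pderiv j w x).re +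
          ((w x).im * (pderiv j w x).im + (w x).im * (pderiv j w x).im) := ⟨_, rfl⟩
      have k4 : |a| ≤ ‖w x‖ ^ 2 + ((pderiv j w x).re ^ 2 + (pderiv j w x).im ^ 2) := by
        rw [ha, norm_sq_re_add_im, abs_le]
        constructor
        · nlinarith [sq_nonneg ((w x).re + (pderiv j w x).re),
            sq_nonneg ((w x).im + (pderiv j w x).im)]
        · nlinarith [sq_nonneg ((w x).re - (pderiv j w x).re),
            sq_nonneg ((w x).im - (pderiv j w x).im)]
      rw [← ha]
      obtain ⟨q, hq'⟩ : ∃ q, q = (pderiv j w x).re ^ 2 + (pderiv j w x).im ^ 2 := ⟨_, rfl⟩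
      rw [← hq'] at k4 ⊢
      have hq0 : 0 ≤ q := hq' ▸ by positivity
      calc N x j * a + ‖w x‖ ^ 2 * pderiv j (fun x => N x j) x
          ≤ |N x j * a| + ‖w x‖ ^ 2 * |pderiv j (fun x => N x j) x| := by
            gcongr
            · exact le_abs_self _
            · exact le_abs_self _
        _ ≤ |B₁ j| * (‖w x‖ ^ 2 + q) + ‖w x‖ ^ 2 * |B₂ j| := by
            rw [abs_mul]
            gcongr
        _ ≤ (|B₁ j| + |B₂ j|) * (‖w x‖ ^ 2 + q) := by
            have : 0 ≤ |B₂ j| * q := by positivity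
            linarith
        _ ≤ _ := by gcongr
    refine (Finset.sum_le_sum fun j _ => hj j).trans ?_
    rw [← Finset.mul_sum, Finset.sum_add_distrib, Finset.sum_const, Finset.card_univ,
      Fintype.card_fin, nsmul_eq_mul]
    gcongr
    linarith
  have i1 : IntegrableOn (fun x => ‖w x‖ ^ 2) Ω :=
    integrableOn_of_continuous hΩb (hw.continuous.norm.pow 2)
  have i2 : ∀ j, IntegrableOn (fun x => ‖pderiv j w x‖ ^ 2) Ω := fun j =>
    integrableOn_of_continuous hΩb ((hw.pderiv j).continuous.norm.pow 2)
  have i3 : IntegrableOn (fun x => ∑ j, ‖pderiv j w x‖ ^ 2) Ω :=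
    integrable_finsetSum _ fun j _ => i2 j
  have i4 : IntegrableOn (fun x => ∑ j, pderiv j
      (fun x => N x j * ((w x).re * (w x).re + (w x).im * (w x).im)) x) Ω :=
    integrableOn_of_continuous hΩb (continuous_finsetSum _ fun j _ => ((hF j).pderiv j).continuous)
  have hint := setIntegral_mono_on i4 (((i1.const_mul ((n : ℝ) + 1)).add i3).const_mul B)
    hΩo.measurableSet hpt
  simp only [Pi.add_apply] at hint
  rw [integral_const_mul, integral_add (i1.const_mul ((n : ℝ) + 1)) i3, integral_const_mul,
    integral_finsetSum _ fun j _ => i2 j, hdiv] at hint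
  have hμi : ContinuousOn (fun x => ‖w x‖ ^ 2) (frontier Ω) := (hw.continuous.norm.pow 2).continuousOn
  have hσint : ∀ g : Rn n → ℝ, ContinuousOn g (frontier Ω) → Integrable g σ := fun g hg =>
    ((integrable_surfaceMeasure hΩb hg).smul_measure_nnreal (c := b₁)).mono_measure hb₁
  have hσae : ∀ᵐ x ∂σ, x ∈ frontier Ω :=
    (Measure.absolutelyContinuous_of_le hb₁).ae_le
      (Measure.smul_absolutelyContinuous.ae_le (ae_surfaceMeasure_mem_frontier Ω))
  have hlow : c * ∫ x, ‖w x‖ ^ 2 ∂σ ≤ ∫ x, ∑ j, outerNormal Ω x j *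
      (N x j * ((w x).re * (w x).re + (w x).im * (w x).im)) ∂σ := by
    rw [← integral_const_mul]
    refine integral_mono_ae ((hσint _ hμi).const_mul c) (hσint _
      (continuousOn_finsetSum _ fun j _ => ContinuousOn.mul
      ((EuclideanSpace.proj (𝕜 := ℝ) j).continuous.comp_continuousOn
      (continuousOn_outerNormal hΩ)) (hF j).continuous.continuousOn)) ?_
    filter_upwards [hσae] with x hx
    have h1 := hcN x hx
    rw [inner_eq_sum] at h1
    have h2 : ∑ j, outerNormal Ω x j * (N x j * ((w x).re * (w x).re + (w x).im * (w x).im)) =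
        (∑ j, N x j * outerNormal Ω x j) * ‖w x‖ ^ 2 := by
      rw [Finset.sum_mul]
      refine Finset.sum_congr rfl fun j _ => ?_
      rw [hqw]
      ring
    rw [h2]
    gcongr
  have hup : ∫ x, ‖w x‖ ^ 2 ∂surfaceMeasure Ω ≤ b₂ * ∫ x, ‖w x‖ ^ 2 ∂σ :=
    integral_le_mul_integral_of_le_smul hb₂ (Eventually.of_forall fun x => by positivity)
      (hσint _ hμi)
  have hS0 : 0 ≤ ∑ j, ∫ x in Ω, ‖pderiv j w x‖ ^ 2 :=
    Finset.sum_nonneg fun j _ => integral_nonneg fun x => by positivity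
  have hfinal : c * ∫ x, ‖w x‖ ^ 2 ∂σ ≤
      B * (n + 1) * ((∫ x in Ω, ‖w x‖ ^ 2) + ∑ j, ∫ x in Ω, ‖pderiv j w x‖ ^ 2) := by
    refine (hlow.trans hint).trans ?_
    rw [mul_assoc]
    gcongr
    have : 0 ≤ (n : ℝ) * ∑ j, ∫ x in Ω, ‖pderiv j w x‖ ^ 2 := by positivity
    linarith
  calc ∫ x, ‖w x‖ ^ 2 ∂surfaceMeasure Ω ≤ b₂ * ∫ x, ‖w x‖ ^ 2 ∂σ := hup
    _ = b₂ / c * (c * ∫ x, ‖w x‖ ^ 2 ∂σ) := by field_simp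
    _ ≤ b₂ / c * (B * (n + 1) * ((∫ x in Ω, ‖w x‖ ^ 2) + ∑ j, ∫ x in Ω, ‖pderiv j w x‖ ^ 2)) := by
        gcongr
    _ = _ := by ring

/-- The trace inequality in terms of `L²` norms. -/
theorem exists_eLpNorm_surfaceMeasure_le (hΩo : IsOpen Ω) (hΩb : Bornology.IsBounded Ω)
    (hΩ : HasC2Boundary Ω) : ∃ A : ℝ, ∀ w : Rn n → ℂ, ContDiff ℝ ∞ w →
      eLpNorm w 2 (surfaceMeasure Ω) ≤ ENNReal.ofReal A *
        (eLpNorm w 2 (volume.restrict Ω) + ∑ j, eLpNorm (pderiv j w) 2 (volume.restrict Ω)) := by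
  have hfin := (exists_divergence_measure hΩo hΩb hΩ).1
  obtain ⟨A, hA0, hA⟩ := exists_integral_surfaceMeasure_le hΩo hΩb hΩ
  refine ⟨√A, fun w hw => ?_⟩
  rw [(memLp_surfaceMeasure hΩb hw.continuous).eLpNorm_two_eq_sqrt,
    (memLp_restrict_of_continuous hΩb hw.continuous).eLpNorm_two_eq_sqrt,
    Finset.sum_congr rfl fun j _ =>
      (memLp_restrict_of_continuous hΩb (hw.pderiv j).continuous).eLpNorm_two_eq_sqrt,
    ← ENNReal.ofReal_sum_of_nonneg fun j _ => Real.sqrt_nonneg _,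
    ← ENNReal.ofReal_add (Real.sqrt_nonneg _) (Finset.sum_nonneg fun j _ => Real.sqrt_nonneg _),
    ← ENNReal.ofReal_mul (Real.sqrt_nonneg _)]
  refine ENNReal.ofReal_le_ofReal ((Real.sqrt_le_sqrt (hA w hw)).trans ?_)
  rw [Real.sqrt_mul hA0]
  gcongr
  have hI : ∀ f : Rn n → ℂ, 0 ≤ ∫ x in Ω, ‖f x‖ ^ 2 := fun f =>
    integral_nonneg fun x => by positivity
  have hsum : ∀ s : Finset (Fin n), √(∑ j ∈ s, ∫ x in Ω, ‖pderiv j w x‖ ^ 2) ≤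
      ∑ j ∈ s, √(∫ x in Ω, ‖pderiv j w x‖ ^ 2) := by
    intro s
    induction s using Finset.induction_on with
    | empty => simp
    | insert a s ha ih =>
      rw [Finset.sum_insert ha, Finset.sum_insert ha]
      exact (sqrt_add_le_sqrt_add_sqrt (hI _) (Finset.sum_nonneg fun j _ => hI _)).trans (by gcongr)
  exact (sqrt_add_le_sqrt_add_sqrt (hI _) (Finset.sum_nonneg fun j _ => hI _)).trans
    (by gcongr; exact hsum _)

/-- The restrictions to the boundary of smooth functions that converge in `H¹(Ω)` converge to the
trace of the limit. -/
theorem tendsto_boundaryTrace (hΩo : IsOpen Ω) (hΩb : Bornology.IsBounded Ω)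
    (hΩ : HasC2Boundary Ω) {w : ℕ → Rn n → ℂ} {u : Rn n → ℂ} (hw : ∀ k, ContDiff ℝ ∞ (w k))
    (hu : L2Tendsto (volume.restrict Ω) w u)
    (hD : ∀ j, L2Tendsto (volume.restrict Ω) (fun k => pderiv j (w k)) (weakPartial Ω j u)) :
    L2Tendsto (surfaceMeasure Ω) w (boundaryTrace Ω u) := by
  have hfin := (exists_divergence_measure hΩo hΩb hΩ).1
  obtain ⟨A, hA⟩ := exists_eLpNorm_surfaceMeasure_le hΩo hΩb hΩ
  have hmem : ∀ {f : Rn n → ℂ}, ContDiff ℝ ∞ f → MemLp f 2 (surfaceMeasure Ω) := fun hf =>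
    memLp_surfaceMeasure hΩb hf.continuous
  have hcompare : ∀ w' : ℕ → Rn n → ℂ, (∀ k, ContDiff ℝ ∞ (w' k)) →
      L2Tendsto (volume.restrict Ω) w' u →
      (∀ j, L2Tendsto (volume.restrict Ω) (fun k => pderiv j (w' k)) (weakPartial Ω j u)) →
      Tendsto (fun p : ℕ × ℕ => eLpNorm (fun x => w p.1 x - w' p.2 x) 2 (surfaceMeasure Ω)) atTop
        (𝓝 0) := by
    intro w' hw' hu' hD'
    have h1 := ENNReal.Tendsto.const_mul (a := ENNReal.ofReal A)
      ((hu.tendsto_eLpNorm_sub hu').add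
        (tendsto_finsetSum Finset.univ fun j _ => (hD j).tendsto_eLpNorm_sub (hD' j)))
      (Or.inr ENNReal.ofReal_ne_top)
    rw [Finset.sum_const_zero, add_zero, mul_zero] at h1
    refine tendsto_of_tendsto_of_tendsto_of_le_of_le tendsto_const_nhds h1 (fun _ => zero_le)
      fun p => ?_
    refine (hA _ ((hw p.1).sub (hw' p.2))).trans (le_of_eq ?_)
    congr 2
    refine Finset.sum_congr rfl fun j _ => ?_
    congr 1
    ext x
    simp only [pderiv]
    rw [fderiv_fun_sub ((hw p.1).differentiableAt_top x) ((hw' p.2).differentiableAt_top x)]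
    rfl
  -- by the trace inequality the restrictions form a Cauchy sequence
  have hex : ∃ g, HasTrace Ω u g := by
    have hcau : CauchySeq (fun k => (hmem (hw k)).toLp (w k)) := by
      rw [Lp.cauchySeq_Lp_iff_cauchySeq_eLpNorm]
      refine (hcompare w hw hu hD).congr fun p => eLpNorm_congr_ae ?_
      filter_upwards [(hmem (hw p.1)).coeFn_toLp, (hmem (hw p.2)).coeFn_toLp] with x h1 h2
      rw [Pi.sub_apply, h1, h2]
    obtain ⟨g, hg⟩ := cauchySeq_tendsto_of_complete hcau
    rw [Lp.tendsto_Lp_iff_tendsto_eLpNorm'] at hg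
    refine ⟨g, Lp.memLp g, w, hw, hu.tendsto, fun j => (hD j).tendsto, ?_⟩
    refine hg.congr fun k => eLpNorm_congr_ae ?_
    filter_upwards [(hmem (hw k)).coeFn_toLp] with x h1
    rw [Pi.sub_apply, h1]
  have hbt : HasTrace Ω u (boundaryTrace Ω u) := by
    rw [boundaryTrace, dif_pos hex]
    exact hex.choose_spec
  obtain ⟨hgm, w', hw', hu', hD', hlim⟩ := hbt
  -- the trace is defined through some other approximating sequence `w'`, whose boundary values
  -- have the same limit as those of `w`
  have hdiag := (hcompare w' hw' ⟨fun k => memLp_restrict_of_continuous hΩb (hw' k).continuous,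
    hu.memLp_lim, hu'⟩ (fun j => ⟨fun k => memLp_restrict_of_continuous hΩb
      ((hw' k).pderiv j).continuous, (hD j).memLp_lim, hD' j⟩)).comp tendsto_atTop_diagonal
  refine ⟨fun k => hmem (hw k), hgm, ?_⟩
  have h1 := hdiag.add hlim
  rw [add_zero] at h1
  refine tendsto_of_tendsto_of_tendsto_of_le_of_le tendsto_const_nhds h1 (fun _ => zero_le)
    fun k => ?_
  have h2 := eLpNorm_add_le ((hmem (hw k)).sub (hmem (hw' k))).1
    ((hmem (hw' k)).sub hgm).1 (one_le_two (α := ℝ≥0∞))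
  refine le_trans (le_of_eq (eLpNorm_congr_ae (Eventually.of_forall fun x => ?_))) h2
  simp only [Pi.add_apply, Pi.sub_apply]
  abel

end Trace

/-! ### Passage to the limit -/

section Limit

variable {n : ℕ} {Ω : Set (Rn n)}

theorem aestronglyMeasurable_outerNormal (hΩ : HasC2Boundary Ω) (j : Fin n) :
    AEStronglyMeasurable (fun x => ((outerNormal Ω x j : ℝ) : ℂ)) (surfaceMeasure Ω) := by
  refine ContinuousOn.aestronglyMeasurable ?_ isClosed_frontier.measurableSet
  exact Complex.continuous_ofReal.comp_continuousOn
    ((EuclideanSpace.proj (𝕜 := ℝ) j).continuous.comp_continuousOn (continuousOn_outerNormal hΩ))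

theorem ae_norm_outerNormal_apply_le (hΩ : HasC2Boundary Ω) (j : Fin n) :
    ∀ᵐ x ∂surfaceMeasure Ω, ‖((outerNormal Ω x j : ℝ) : ℂ)‖ ≤ 1 := by
  filter_upwards [ae_surfaceMeasure_mem_frontier Ω] with x hx
  rw [Complex.norm_real, ← norm_outerNormal hΩ hx]
  exact PiLp.norm_apply_le _ _

namespace H2Approx

variable {w : ℕ → Rn n → ℂ} {v : Rn n → ℂ}

theorem tendsto_trace (hΩo : IsOpen Ω) (hΩb : Bornology.IsBounded Ω) (hΩ : HasC2Boundary Ω)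
    (H : H2Approx Ω w v (fun j => weakPartial Ω j v)
      (fun i j => weakPartial Ω i (weakPartial Ω j v))) :
    L2Tendsto (surfaceMeasure Ω) w (boundaryTrace Ω v) :=
  tendsto_boundaryTrace hΩo hΩb hΩ H.smooth H.fun_lim H.deriv_lim

theorem tendsto_trace_weakPartial (hΩo : IsOpen Ω) (hΩb : Bornology.IsBounded Ω)
    (hΩ : HasC2Boundary Ω) (H : H2Approx Ω w v (fun j => weakPartial Ω j v)
      (fun i j => weakPartial Ω i (weakPartial Ω j v))) (j : Fin n) :
    L2Tendsto (surfaceMeasure Ω) (fun k => pderiv j (w k)) (boundaryTrace Ω (weakPartial Ω j v)) :=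
  tendsto_boundaryTrace hΩo hΩb hΩ (fun k => (H.smooth k).pderiv j) (H.deriv_lim j)
    fun i => H.deriv2_lim i j

theorem tendsto_normalDeriv (hΩo : IsOpen Ω) (hΩb : Bornology.IsBounded Ω)
    (hΩ : HasC2Boundary Ω) (H : H2Approx Ω w v (fun j => weakPartial Ω j v)
      (fun i j => weakPartial Ω i (weakPartial Ω j v))) :
    L2Tendsto (surfaceMeasure Ω) (fun k x => normalPart (outerNormal Ω x) (cgrad (w k) x))
      (normalDeriv Ω v) :=
  L2Tendsto.sum (s := Finset.univ) fun j _ =>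
    (H.tendsto_trace_weakPartial hΩo hΩb hΩ j).smul_bounded
      (aestronglyMeasurable_outerNormal hΩ j) (ae_norm_outerNormal_apply_le hΩ j)

theorem tendsto_tangentialGradient (hΩo : IsOpen Ω) (hΩb : Bornology.IsBounded Ω)
    (hΩ : HasC2Boundary Ω) (H : H2Approx Ω w v (fun j => weakPartial Ω j v)
      (fun i j => weakPartial Ω i (weakPartial Ω j v))) :
    L2Tendsto (surfaceMeasure Ω) (fun k x => tangentialPart (outerNormal Ω x) (cgrad (w k) x))
      (tangentialGradient Ω v) := by
  refine L2Tendsto.toLp fun j => ?_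
  have h1 := (H.tendsto_trace_weakPartial hΩo hΩb hΩ j).add
    ((H.tendsto_normalDeriv hΩo hΩb hΩ).smul_bounded
      (aestronglyMeasurable_outerNormal hΩ j).neg (c := 1)
      ((ae_norm_outerNormal_apply_le hΩ j).mono fun x hx => by rwa [Pi.neg_apply, norm_neg]))
  refine (h1.congr_seq fun k => Eventually.of_forall fun x => ?_).congr_lim
    (Eventually.of_forall fun x => ?_)
  · simp only [Pi.neg_apply, smul_eq_mul, cgrad]
    ring
  · simp only [Pi.neg_apply, smul_eq_mul, boundaryGradient]
    ring

theorem tendsto_weakGradient (H : H2Approx Ω w v (fun j => weakPartial Ω j v)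
      (fun i j => weakPartial Ω i (weakPartial Ω j v))) :
    L2Tendsto (volume.restrict Ω) (fun k => cgrad (w k)) (weakGradient Ω v) :=
  L2Tendsto.toLp H.deriv_lim

end H2Approx

theorem convexifiedWeight_eq_convexWeight (φ : Rn n → ℝ) (h ε : ℝ) :
    convexifiedWeight φ h ε = convexWeight φ (h / ε) := by
  ext x
  rw [convexifiedWeight, convexWeight, div_div, mul_comm ε 2]
  ring

theorem smoothNormalDeriv_congr {V : Set (Rn n)} (hV : IsOpen V) {f g : Rn n → ℝ}
    (hfg : Set.EqOn f g V) {x : Rn n} (hx : x ∈ V) :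
    smoothNormalDeriv Ω f x = smoothNormalDeriv Ω g x := by
  rw [smoothNormalDeriv, smoothNormalDeriv,
    (hfg.eventuallyEq_of_mem (hV.mem_nhds hx)).fderiv_eq]

theorem boundaryPlus_congr {V : Set (Rn n)} (hV : IsOpen V) {f g : Rn n → ℝ}
    (hfg : Set.EqOn f g V) (hΩV : frontier Ω ⊆ V) : boundaryPlus Ω f = boundaryPlus Ω g := by
  ext x
  exact and_congr_right fun hx => by rw [smoothNormalDeriv_congr hV hfg (hΩV hx)]

theorem boundaryMinus_congr {V : Set (Rn n)} (hV : IsOpen V) {f g : Rn n → ℝ}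
    (hfg : Set.EqOn f g V) (hΩV : frontier Ω ⊆ V) : boundaryMinus Ω f = boundaryMinus Ω g := by
  ext x
  exact and_congr_right fun hx => by rw [smoothNormalDeriv_congr hV hfg (hΩV hx)]

end Limit

end

theorem mainTheorem2 {n : ℕ} (hn : 3 ≤ n) (Ω Ω' : Set (Rn n))
    (hΩ_open : IsOpen Ω) (hΩ_bdd : Bornology.IsBounded Ω) (hΩ_C2 : HasC2Boundary Ω)
    (hΩ'_open : IsOpen Ω') (hΩΩ' : closure Ω ⊆ Ω')
    (φ : Rn n → ℝ) (hφ : IsLimitingCarlemanWeight Ω' φ) :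
    ∃ C > (0 : ℝ), ∃ ε₀ > (0 : ℝ), ∃ c₀ > (0 : ℝ),
      ∀ ε : ℝ, 0 < ε → ε ≤ ε₀ → ∀ h : ℝ, 0 < h → h ≤ c₀ * ε →
        ∀ v : Rn n → ℂ, MemH2 Ω v →
          h ^ 2 / ε * normSqH1scl Ω h v
            - h ^ 3 * ∫ x in boundaryMinus Ω φ,
                smoothNormalDeriv Ω (convexifiedWeight φ h ε) x * ‖normalDeriv Ω v x‖ ^ 2
                  ∂(surfaceMeasure Ω)
          ≤ C * h * ∫ x, ‖boundaryTrace Ω v x‖ ^ 2 ∂(surfaceMeasure Ω)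
            + C * h ^ 3 * ∫ x, ‖normalDeriv Ω v x‖ * ‖boundaryTrace Ω v x‖ ∂(surfaceMeasure Ω)
            + C * h ^ 3 * ∫ x in boundaryPlus Ω φ,
                smoothNormalDeriv Ω (convexifiedWeight φ h ε) x * ‖normalDeriv Ω v x‖ ^ 2
                  ∂(surfaceMeasure Ω)
            + C * h ^ 3 * ∫ x, ‖tangentialGradient Ω v x‖ ^ 2 ∂(surfaceMeasure Ω)
            + C * h ^ 3 * ∫ x, ‖tangentialGradient Ω v x‖ * ‖normalDeriv Ω v x‖
                ∂(surfaceMeasure Ω)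
            + C * ∫ x in Ω, ‖conjLaplacian Ω h (convexifiedWeight φ h ε) v x‖ ^ 2 := by
  have hK := Metric.isCompact_of_isClosed_isBounded isClosed_closure hΩ_bdd.closure
  obtain ⟨φ', lam, hφ', hlam, ⟨V, hV, hKV, hEq⟩, B, s₀, HB⟩ :=
    hφ.exists_carlemanBounds hΩ'_open hK hΩΩ'
  obtain ⟨C, hC, ε₀, hε₀, c₀, hc₀, key⟩ :=
    HB.exists_boundary_estimate hΩ_open hΩ_bdd hΩ_C2 hφ' hlam
  refine ⟨C, hC, ε₀, hε₀, c₀, hc₀, fun ε hε hεle h hh hhle v hv => ?_⟩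
  obtain ⟨w, D, D2, H0⟩ := hv.exists_approx hΩ_bdd
  have H := H0.weak hΩ_open hΩ_bdd
  have hfV : frontier Ω ⊆ V := frontier_subset_closure.trans hKV
  obtain ⟨f, hf⟩ : ∃ f, f = convexWeight φ' (h / ε) := ⟨_, rfl⟩
  have hfc : ContDiff ℝ ∞ f := hf ▸ hφ'.convexWeight _
  have hfEq : Set.EqOn f (convexifiedWeight φ h ε) V := fun x hx => by
    rw [hf, convexifiedWeight_eq_convexWeight, convexWeight, convexWeight, hEq hx]
  -- the estimate for the smooth approximants, which is preserved in the limit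
  have key' := fun k => key ε hε hεle h hh hhle (w k) (H.smooth k)
  rw [← hf] at key'
  have hplus := measurableSet_boundaryPlus hΩ_C2 hφ'
  have hminus := measurableSet_boundaryMinus hΩ_C2 hφ'
  -- only the values of the weight near `closure Ω` matter, where the globally smooth weight agrees
  -- with the given one
  rw [← boundaryPlus_congr hV hEq hfV, ← boundaryMinus_congr hV hEq hfV,
    setIntegral_congr_fun hplus fun x hx => by
      rw [← smoothNormalDeriv_congr hV hfEq (hfV hx.1)],
    setIntegral_congr_fun hminus fun x hx => by
      rw [← smoothNormalDeriv_congr hV hfEq (hfV hx.1)]]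
  have hfc' := continuousOn_smoothNormalDeriv hΩ_C2 hfc
  have hfm : AEStronglyMeasurable (smoothNormalDeriv Ω f) (surfaceMeasure Ω) :=
    hfc'.aestronglyMeasurable isClosed_frontier.measurableSet
  have hfb : ∃ b, ∀ᵐ x ∂surfaceMeasure Ω, ‖smoothNormalDeriv Ω f x‖ ≤ b := by
    obtain ⟨b, hb⟩ := (hK.of_isClosed_subset isClosed_frontier
      frontier_subset_closure).exists_bound_of_continuousOn hfc'
    exact ⟨b, (ae_surfaceMeasure_mem_frontier Ω).mono hb⟩
  obtain ⟨b, hb⟩ := hfb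
  have t0 := H.tendsto_trace hΩ_open hΩ_bdd hΩ_C2
  have tN := H.tendsto_normalDeriv hΩ_open hΩ_bdd hΩ_C2
  have tT := H.tendsto_tangentialGradient hΩ_open hΩ_bdd hΩ_C2
  have tP := (H.tendsto_conjLaplacian hΩ_open hΩ_bdd hfc (hfEq.mono (subset_closure.trans hKV))
    hh.ne').tendsto_integral_norm_sq
  have tw := H.fun_lim.tendsto_integral_norm_sq
  have tg := H.tendsto_weakGradient.tendsto_integral_norm_sq
  have tS : ∀ S : Set (Rn n), Tendsto (fun k => ∫ x in S, smoothNormalDeriv Ω f x *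
      ‖normalPart (outerNormal Ω x) (cgrad (w k) x)‖ ^ 2 ∂surfaceMeasure Ω) atTop
      (𝓝 (∫ x in S, smoothNormalDeriv Ω f x * ‖normalDeriv Ω v x‖ ^ 2 ∂surfaceMeasure Ω)) := by
    intro S
    simpa only [sq] using (tN.restrict S).tendsto_integral_norm_mul_norm (tN.restrict S)
      hfm.restrict (ae_restrict_of_ae hb)
  have tNw := tN.norm.tendsto_integral_smul t0.norm
  have tTN := tT.norm.tendsto_integral_smul tN.norm
  simp only [smul_eq_mul] at tNw tTN
  have hnorm : normSqH1scl Ω h v =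
      (∫ x in Ω, ‖v x‖ ^ 2) + h ^ 2 * ∫ x in Ω, ‖weakGradient Ω v x‖ ^ 2 := by
    rw [normSqH1scl, ← integral_const_mul]
    simp only [norm_smul, mul_pow, Complex.norm_real, Real.norm_eq_abs, sq_abs]
  rw [hnorm]
  exact le_of_tendsto_of_tendsto'
    (((tw.add (tg.const_mul _)).const_mul _).sub ((tS _).const_mul _))
    ((((((t0.tendsto_integral_norm_sq.const_mul _).add (tNw.const_mul _)).add
      ((tS _).const_mul _)).add (tT.tendsto_integral_norm_sq.const_mul _)).add
      (tTN.const_mul _)).add (tP.const_mul _)) key'
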